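/- **Processes.** Processes over names $x,y,\dots$ are $P,Q ::= \mathbf 0 \mid [x\leftrightarrow y] \mid P\,\|\,Q \mid (\nu x)(P\,\|\,Q) \mid P\oplus Q \mid x.\mathsf{some};P \mid x.\mathsf{none} \mid x.\mathsf{some}_{w_1,\dots,w_n};P \mid x[y];(P\,\|\,Q) \mid x(y);P \mid x.\ell;P \mid x\{i:P_i\}_{i\in I} \mid\, ?x[y];P \mid\, !x(y);P \mid x[\,] \mid x();P$ ($I$ finite; in $(\nu x)(P\|Q)$ the name $x$ is bound in $P,Q$; in $x[y];(P\|Q)$ the name $y$ is bound in $P$; in $x(y);P$, $?x[y];P$, $!x(y);P$ it is bound in $P$), up to renaming of bound names. Structural congruence $\equiv$ is the least congruence with $[x\leftrightarrow y]\equiv[y\leftrightarrow x]$; $\|$ commutative and associative with unit $\mathbf 0$; $\oplus$ commutative, associative and idempotent; $(\nu x)(P\|Q)\equiv(\nu x)(Q\|P)$; $(\nu x)((P\|Q)\|R)\equiv(\nu x)(P\|R)\|Q$ if $x\notin fn(Q)$; $(\nu x)((\nu y)(P\|Q)\|R)\equiv(\nu y)((\nu x)(P\|R)\|Q)$ if $x\notin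 fn(Q)$, $y\notin fn(R)$; and $(\nu x)(!x(y);P\,\|\,Q)\equiv Q$ if $x\notin fn(Q)$. ND-contexts are $\mathcal N::=[\cdot]\mid \mathcal N\|P\mid(\nu x)(\mathcal N\|P)\mid\mathcal N\oplus P$; the commitment $D(\mathcal N)$ replaces each subcontext $\mathcal N'\oplus P$ by $\mathcal N'$. Eager reduction $\longrightarrow$ is the least relation closed under $\equiv$ on both sides and under the contexts $(\nu x)(\cdot\|Q)$, $\cdot\,\|Q$, $\cdot\oplus Q$, with - $(\nu x)(\mathcal N[[x\leftrightarrow y]]\|Q)\longrightarrow D(\mathcal N)[Q\{y/x\}]$; - $(\nu x)(\mathcal N[x[\,]]\|\mathcal N'[x();Q])\longrightarrow D(\mathcal N)[\mathbf 0]\,\|\,D(\mathcal N')[Q]$; - $(\nu x)(\mathcal N[x[y];(P\|Q)]\|\mathcal N'[x(z);R])\longrightarrow D(\mathcal N)[(\nu x)(Q\|(\nu y)(P\|D(\mathcal N')[R\{y/z\}]))]$; - $(\nu x)(\mathcal N[x.k;P]\|\mathcal N'[x\{i:Q_i\}_{i\in I}])\longrightarrow(\nu x)(D(\mathcal N)[P]\|D(\mathcal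 N')[Q_k])$ for $k\in I$; - $(\nu x)(\mathcal N[?x[y];P]\|\mathcal N'[!x(z);Q])\longrightarrow D(\mathcal N')[(\nu x)((\nu y)(D(\mathcal N)[P]\|Q\{y/z\})\,\|\,!x(z);Q)]$; - $(\nu x)(\mathcal N[x.\mathsf{some};P]\|\mathcal N'[x.\mathsf{some}_{w_1,\dots,w_n};Q])\longrightarrow(\nu x)(D(\mathcal N)[P]\|D(\mathcal N')[Q])$; - $(\nu x)(\mathcal N[x.\mathsf{none}]\|\mathcal N'[x.\mathsf{some}_{w_1,\dots,w_n};Q])\longrightarrow D(\mathcal N)[\mathbf 0]\,\|\,D(\mathcal N')[w_1.\mathsf{none}\|\cdots\|w_n.\mathsf{none}]$, where no name is captured and no bound name escapes its binder (in particular $x$ may not occur in a committed context, continuation or list of names that leaves the scope of $x$). $P\longrightarrow^*Q$ means finitely many, possibly zero, reductions modulo $\equiv$. Finally $\succeq_\oplus$ is the least relation with $P\succeq_\oplus P$; $P_1\oplus P_2\succeq_\oplus P'$ if $P_1\succeq_\oplus P'$ or $P_2\succeq_\oplus P'$; and, whenever $P\succeq_\oplus P'$ and $Q\succeq_\oplus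 Q'$, also $P\|Q\succeq_\oplus P'\|Q'$, $(\nu x)(P\|Q)\succeq_\oplus(\nu x)(P'\|Q')$ and $P\oplus Q\succeq_\oplus P'\oplus Q'$. **Terms.** Terms, linear bags and unrestricted bags of $\lambda_{\mathtt C}$ are $M,N::=x\mid x[i]\mid\lambda x.M\mid M\,(C\star U)\mid\mathtt{fail}^{\tilde x}\mid M[\tilde x\leftarrow x]\mid M\langle\langle C\star U/x\rangle\rangle\mid M\langle C/\tilde x\rangle\mid M\langle U/x^!\rangle$, $C::=\mathtt 1\mid[M]\cdot C$, $U::=\mathtt 1^!\mid[M]^!\mid U\diamond U$, up to renaming of bound variables; the variable(s) $x$, $\tilde x$, $x$, $\tilde x$, $x^!$ are bound in $M$ in $\lambda x.M$, $M[\tilde x\leftarrow x]$, $M\langle\langle C\star U/x\rangle\rangle$, $M\langle C/\tilde x\rangle$, $M\langle U/x^!\rangle$ respectively, and the sharing variable $x$ is free in $M[\tilde x\leftarrow x]$. $C_i$ is the $i$-th element of $C$ and $|C|$ its size; $U_i$ is the $i$-th position of $U$, and $\mathtt 1^!$ if there is none; $llfv$ denotes the linear (incl. sharing) free variables; a term is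 closed if it has no free variables. $head(M)$ is $x$ for $M=x$, $x[i]$ for $M=x[i]$, $head(M')$ for $M=M'\,(C\star U)$, $M'\langle C/\tilde x\rangle$, $M'\langle U/x^!\rangle$, and for $M=M'[\tilde x\leftarrow x]$ it is $x$ if $head(M')\in\tilde x$ and $head(M')$ otherwise; other terms have no head variable. $M\{|N/h|\}$ replaces the head variable $h$ of $M$ by $N$ without capture. Reduction is closed under the contexts $\mathcal C::=[\cdot]\mid\mathcal C\,(C\star U)\mid\mathcal C\langle C/\tilde x\rangle\mid\mathcal C\langle U/x^!\rangle\mid\mathcal C[\tilde x\leftarrow x]$ and generated by - $(\lambda x.M)(C\star U)\to M\langle\langle C\star U/x\rangle\rangle$; - $(M[\tilde x\leftarrow x])\langle\langle C\star U/x\rangle\rangle\to M\langle C/\tilde x\rangle\langle U/x^!\rangle$ if $|C|=|\tilde x|$ and $M$ is not a failure term; - $M\langle C/\tilde x,x_j\rangle\to(M\{|C_i/x_j|\})\langle(C\setminus C_i)/\tilde x\rangle$ if $head(M)=x_j$, $0<i\le|C|$; - $(M[\tilde x\leftarrow x])\langle\langle C\star U/x\rangle\rangle\to\mathtt{fail}^{\tilde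 y}$ if $|C|\ne|\tilde x|$ and $\tilde y=(llfv(M)\setminus\tilde x)\cup llfv(C)$; - $M\langle U/x^!\rangle\to M\{|N/x[i]|\}\langle U/x^!\rangle$ if $head(M)=x[i]$, $U_i=[N]^!$; and $M\langle U/x^!\rangle\to M\{|\mathtt{fail}^\emptyset/x[i]|\}\langle U/x^!\rangle$ if $head(M)=x[i]$, $U_i=\mathtt 1^!$; - $\mathtt{fail}^{\tilde x}(C\star U)\to\mathtt{fail}^{\tilde x\cup llfv(C)}$; $(\mathtt{fail}^{\tilde x\uplus\tilde y}[\tilde x\leftarrow x])\langle\langle C\star U/x\rangle\rangle\to\mathtt{fail}^{\tilde y\cup llfv(C)}$ if $|C|=|\tilde x|$; $\mathtt{fail}^{\tilde y\uplus\tilde x}\langle C/\tilde x\rangle\to\mathtt{fail}^{\tilde y\cup llfv(C)}$; $\mathtt{fail}^{\tilde y}\langle U/x^!\rangle\to\mathtt{fail}^{\tilde y}$. **Well-formedness.** Strict types are $\sigma,\tau::=\mathbf{unit}\mid(\pi,\eta)\to\sigma$, multiset types $\pi$ are $\omega$ or $\sigma_1\wedge\dots\wedge\sigma_n$, list types $\eta,\epsilon$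 are non-empty lists of strict types; $\sigma^k$ is $\sigma\wedge\dots\wedge\sigma$ ($k$ times; $\sigma^0=\omega$), and $\eta\sim\epsilon$ means that $\eta$ is a prefix of $\epsilon$. $\Theta$ assigns list types to unrestricted variables $x^!$, and $\Gamma,\Delta$ assign strict or multiset types to variables; commas denote unions with disjoint domains, and $-$ is the empty context. $M$ is well-formed if $\Theta;\Gamma\vDash M:\tau$ is derivable for some $\Theta,\Gamma,\tau$ by: - $\Theta;x:\sigma\vDash x:\sigma$; $\ \Theta,x^!:\eta;\Delta\vDash x[i]:\sigma$ if $\Theta,x^!:\eta;x:\eta_i,\Delta\vDash x:\sigma$ ($1\le i\le|\eta|$); $\ \Theta;\Gamma\vDash\mathtt{fail}^{\tilde x}:\tau$ if $\mathrm{dom}(\Gamma)=\tilde x$ and $\Gamma$ assigns no $\omega$; - $\Theta;-\vDash\mathtt 1:\omega$; $\ \Theta;\Gamma,\Delta\vDash[M]\cdot C:\sigma^{k+1}$ if $\Theta;\Gamma\vDash M:\sigma$ and $\Theta;\Delta\vDash C:\sigma^k$; - $\Theta;-\vDash\mathtt 1^!:\sigma$; $\ \Theta;-\vDash[M]^!:\sigma$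 if $\Theta;-\vDash M:\sigma$; $\ \Theta;-\vDash U\diamond V:\epsilon\diamond\eta$ if $\Theta;-\vDash U:\epsilon$ and $\Theta;-\vDash V:\eta$; $\ \Theta;\Gamma\vDash C\star U:(\sigma^k,\eta)$ if $\Theta;\Gamma\vDash C:\sigma^k$ and $\Theta;-\vDash U:\eta$; - $\Theta;\Gamma,x:\omega\vDash M[\leftarrow x]:\tau$ if $\Theta;\Gamma\vDash M:\tau$; $\ \Theta;\Gamma,x:\sigma^k\vDash M[x_1,\dots,x_k\leftarrow x]:\tau$ if $k\ne0$ and $\Theta;\Gamma,x_1:\sigma,\dots,x_k:\sigma\vDash M:\tau$; - $\Theta;\Gamma\vDash\lambda x.(M[\tilde x\leftarrow x]):(\sigma^k,\eta)\to\tau$ if $\Theta,x^!:\eta;\Gamma,x:\sigma^k\vDash M[\tilde x\leftarrow x]:\tau$; - $\Theta;\Gamma,\Delta\vDash M\,B:\tau$ if $\Theta;\Gamma\vDash M:(\sigma^j,\eta)\to\tau$, $\Theta;\Delta\vDash B:(\sigma^k,\epsilon)$, $\eta\sim\epsilon$; - $\Theta;\Gamma,\Delta\vDash(M[\tilde x\leftarrow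 x])\langle\langle B/x\rangle\rangle:\tau$ if $\Theta,x^!:\eta;\Gamma,x:\sigma^j\vDash M[\tilde x\leftarrow x]:\tau$, $\Theta;\Delta\vDash B:(\sigma^k,\epsilon)$, $\eta\sim\epsilon$; - $\Theta;\Gamma,\Delta\vDash M\langle C/x_1,\dots,x_k\rangle:\tau$ if $\Theta;\Gamma,x_1:\sigma,\dots,x_k:\sigma\vDash M:\tau$ and $\Theta;\Delta\vDash C:\sigma^k$; $\ \Theta;\Gamma\vDash M\langle U/x^!\rangle:\tau$ if $\Theta,x^!:\eta;\Gamma\vDash M:\tau$, $\Theta;-\vDash U:\epsilon$, $\eta\sim\epsilon$. **Translation.** Each variable $x$ gives rise to names $x,x^\ell,x^!$; other names introduced below are fresh; in the list $w_1,\dots,w_n$ of a prefix $\mathsf{some}_{w_1,\dots,w_n}$, $llfv$ stands for the corresponding names ($x^\ell$ for a sharing variable $x$). - $[\![x]\!]_u=x.\mathsf{some};[x\leftrightarrow u]$; $\ [\![x[j]]\!]_u=\,?x^![y];y.j;[y\leftrightarrow u]$; $\ [\![\mathtt{fail}^{x_1,\dots,x_k}]\!]_u=u.\mathsf{none}\|x_1.\mathsf{none}\|\cdots\|x_k.\mathsf{none}$;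 - $[\![\lambda x.M]\!]_u=u.\mathsf{some};u(x);x.\mathsf{some};x(x^\ell);x(x^!);x();[\![M]\!]_u$; - $[\![M\langle\langle C\star U/x\rangle\rangle]\!]_u=(\nu x)(x.\mathsf{some};x(x^\ell);x(x^!);x();[\![M]\!]_u\,\|\,[\![C\star U]\!]_x)$; - $[\![M\,(C\star U)]\!]_u=(\nu v)([\![M]\!]_v\,\|\,v.\mathsf{some}_{u,llfv(C)};v[x];([\![C\star U]\!]_x\|[v\leftrightarrow u]))$; - $[\![C\star U]\!]_x=x.\mathsf{some}_{llfv(C)};x[x^\ell];([\![C]\!]_{x^\ell}\,\|\,x[x^!];(!x^!(y);[\![U]\!]_y\,\|\,x[\,]))$; - for $C=[N]\cdot C'$: $[\![C]\!]_{z}=z.\mathsf{some}_{llfv(C)};z(y);z.\mathsf{some}_{y,llfv(C)};z.\mathsf{some};z[w];(w.\mathsf{some}_{llfv(N)};[\![N]\!]_w\,\|\,([\![C']\!]_z\|y.\mathsf{none}))$; - $[\![\mathtt 1]\!]_z=z.\mathsf{some}_\emptyset;z(y);(y.\mathsf{some};y[\,]\,\|\,z.\mathsf{some}_\emptyset;z.\mathsf{none})$;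 - $[\![U]\!]_y=y\{i:[\![U_i]\!]_y\}$ over all positions $i$ of $U$, where for a position $[\![[N]^!]\!]_y=[\![N]\!]_y$ and $[\![\mathtt 1^!]\!]_y=y.\mathsf{none}$; - $[\![M\langle[M_1]\cdots[M_k]/x_1,\dots,x_k\rangle]\!]_u=(\nu z_1)(z_1.\mathsf{some}_{llfv(M_1)};[\![M_1]\!]_{z_1}\|\cdots(\nu z_k)(z_k.\mathsf{some}_{llfv(M_k)};[\![M_k]\!]_{z_k}\|\bigoplus_{p}[\![M]\!]_u\{z_1/x_{p(1)}\}\cdots\{z_k/x_{p(k)}\})\cdots)$, $p$ ranging over the permutations of $\{1,\dots,k\}$; - $[\![M\langle U/x^!\rangle]\!]_u=(\nu x^!)([\![M]\!]_u\,\|\,!x^!(y);[\![U]\!]_y)$; - $[\![M[\leftarrow x]]\!]_u=x^\ell.\mathsf{some};x^\ell[y];(y.\mathsf{some}_{u,llfv(M)};y();[\![M]\!]_u\,\|\,x^\ell.\mathsf{none})$; - for $\tilde x\neq\emptyset$: $[\![M[\tilde x\leftarrow x]]\!]_u=x^\ell.\mathsf{some};x^\ell[y];(y.\mathsf{some}_\emptyset;y();\mathbf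 0\,\|\,x^\ell.\mathsf{some};x^\ell.\mathsf{some}_{u,llfv(M)\setminus\tilde x};\bigoplus_{x_i\in\tilde x}x^\ell(x_i);[\![M[(\tilde x\setminus x_i)\leftarrow x]]\!]_u)$. **Theorem (Loose Completeness).** Let $N$ be a well-formed closed $\lambda_{\mathtt C}$-term, let $N\to M$, and let $u$ be a name. Then there is a process $Q$ with $[\![N]\!]_u\longrightarrow^*Q$ and $[\![M]\!]_u\succeq_\oplus Q$. -/

import Mathlib

/-! Bound names and variables are de Bruijn indices, so that terms and processes are literally
taken up to alpha-equivalence and side conditions `x ∉ fn(Q)` read `Q = Q'.rename Nat.succ`. -/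

/-- Lifting of a renaming under `k` binders. -/
def up (k : ℕ) (f : ℕ → ℕ) : ℕ → ℕ :=
  fun i => if i < k then i else f (i - k) + k

/-- The renaming that sends the index `0` to `a` and `i + 1` to `f i`. -/
def scons (a : ℕ) (f : ℕ → ℕ) : ℕ → ℕ
  | 0 => a
  | i + 1 => f i

/-- Moves the binder number `d` inside the `d` binders `0, …, d - 1`. -/
def rot (d : ℕ) : ℕ → ℕ :=
  fun i => if i < d then i + 1 else if i = d then 0 else i

/-- Exchanges the two innermost binders. -/
def swap01 : ℕ → ℕ
  | 0 => 1
  | 1 => 0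
  | i + 2 => i + 2

/-- The renaming that leaves out the index `j`. -/
def skip (j : ℕ) : ℕ → ℕ :=
  fun i => if i < j then i else i + 1

/-- Removes the `k` innermost (bound) indices from a set of indices. -/
def lower (k : ℕ) (S : Finset ℕ) : Finset ℕ :=
  (S.filter (fun i => k ≤ i)).image (fun i => i - k)

/-! ## The session pi-calculus with non-deterministic choice -/

/-- Processes; names are de Bruijn indices, labels are natural numbers. -/
inductive Proc : Type
  /-- inaction -/
  | nil : Proc
  /-- forwarder `[x ↔ y]` -/
  | fwd (x y : ℕ) : Proc
  /-- `P ∥ Q` -/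
  | par (P Q : Proc) : Proc
  /-- `(ν x)(P ∥ Q)`; binds the index `0` in `P` and in `Q` -/
  | res (P Q : Proc) : Proc
  /-- non-deterministic choice `P ⊕ Q` -/
  | nd (P Q : Proc) : Proc
  /-- `x.some; P` (available) -/
  | psome (x : ℕ) (P : Proc) : Proc
  /-- `x.none` (unavailable) -/
  | pnone (x : ℕ) : Proc
  /-- `x.some_{ws}; P` (expect) -/
  | gsome (x : ℕ) (ws : Finset ℕ) (P : Proc) : Proc
  /-- output `x[y]; (P ∥ Q)`; binds `0` (that is, `y`) in `P`, which implements `y` -/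
  | out (x : ℕ) (P Q : Proc) : Proc
  /-- input `x(y); P`; binds `0` in `P` -/
  | inp (x : ℕ) (P : Proc) : Proc
  /-- selection of the label `l` on `x` -/
  | sel (x l : ℕ) (P : Proc) : Proc
  /-- branch on `x` over the finite label set `I` -/
  | bra (x : ℕ) (I : Finset ℕ) (P : {i // i ∈ I} → Proc) : Proc
  /-- client request `?x[y]; P`; binds `0` in `P` -/
  | req (x : ℕ) (P : Proc) : Proc
  /-- server `!x(y); P`; binds `0` in `P` -/
  | srv (x : ℕ) (P : Proc) : Proc
  /-- `x[]` -/
  | close (x : ℕ) : Proc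
  /-- `x(); P` -/
  | wait (x : ℕ) (P : Proc) : Proc

namespace Proc

/-- Capture-avoiding renaming of the free names. -/
def rename : (ℕ → ℕ) → Proc → Proc
  | _, nil => nil
  | f, fwd x y => fwd (f x) (f y)
  | f, par P Q => par (rename f P) (rename f Q)
  | f, res P Q => res (rename (up 1 f) P) (rename (up 1 f) Q)
  | f, nd P Q => nd (rename f P) (rename f Q)
  | f, psome x P => psome (f x) (rename f P)
  | f, pnone x => pnone (f x)
  | f, gsome x ws P => gsome (f x) (ws.image f) (rename f P)
  | f, out x P Q => out (f x) (rename (up 1 f) P) (rename f Q)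
  | f, inp x P => inp (f x) (rename (up 1 f) P)
  | f, sel x l P => sel (f x) l (rename f P)
  | f, bra x I P => bra (f x) I (fun i => rename f (P i))
  | f, req x P => req (f x) (rename (up 1 f) P)
  | f, srv x P => srv (f x) (rename (up 1 f) P)
  | f, close x => close (f x)
  | f, wait x P => wait (f x) (rename f P)

/-- `w₁.none ∥ … ∥ wₙ.none` (closed by the unit `0` of parallel composition). -/
def nones : List ℕ → Proc
  | [] => nil
  | w :: ws => par (pnone w) (nones ws)

/-- The n-ary non-deterministic choice (used for non-empty lists only). -/
def bigNd : List Proc → Proc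
  | [] => nil
  | [P] => P
  | P :: Q :: Ps => nd P (bigNd (Q :: Ps))

/-- Structural congruence: the least congruence generated by the listed laws. -/
inductive SC : Proc → Proc → Prop
  | refl (P) : SC P P
  | symm {P Q} : SC P Q → SC Q P
  | trans {P Q R} : SC P Q → SC Q R → SC P R
  | fwd_comm (x y) : SC (fwd x y) (fwd y x)
  | par_nil (P) : SC (par P nil) P
  | par_assoc (P Q R) : SC (par (par P Q) R) (par P (par Q R))
  | par_comm (P Q) : SC (par P Q) (par Q P)
  | res_comm (P Q) : SC (res P Q) (res Q P)
  | nd_idem (P) : SC (nd P P) P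
  | nd_comm (P Q) : SC (nd P Q) (nd Q P)
  | nd_assoc (P Q R) : SC (nd (nd P Q) R) (nd P (nd Q R))
  /-- `(ν x)((P ∥ Q) ∥ R) ≡ (ν x)(P ∥ R) ∥ Q` if `x ∉ fn(Q)` -/
  | res_par (P Q R) : SC (res (par P (rename Nat.succ Q)) R) (par (res P R) Q)
  /-- `(ν x)((ν y)(P ∥ Q) ∥ R) ≡ (ν y)((ν x)(P ∥ R) ∥ Q)` if `x ∉ fn(Q)` and `y ∉ fn(R)` -/
  | res_res (P Q R) :
      SC (res (res P (rename (up 1 Nat.succ) Q)) R)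
        (res (res (rename swap01 P) (rename (up 1 Nat.succ) R)) Q)
  /-- `(ν x)(!x(y); P ∥ Q) ≡ Q` if `x ∉ fn(Q)` -/
  | res_srv (P Q) : SC (res (srv 0 P) (rename Nat.succ Q)) Q
  | par_congr {P P' Q Q'} : SC P P' → SC Q Q' → SC (par P Q) (par P' Q')
  | res_congr {P P' Q Q'} : SC P P' → SC Q Q' → SC (res P Q) (res P' Q')
  | nd_congr {P P' Q Q'} : SC P P' → SC Q Q' → SC (nd P Q) (nd P' Q')
  | psome_congr (x) {P P'} : SC P P' → SC (psome x P) (psome x P')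
  | gsome_congr (x ws) {P P'} : SC P P' → SC (gsome x ws P) (gsome x ws P')
  | out_congr (x) {P P' Q Q'} : SC P P' → SC Q Q' → SC (out x P Q) (out x P' Q')
  | inp_congr (x) {P P'} : SC P P' → SC (inp x P) (inp x P')
  | sel_congr (x l) {P P'} : SC P P' → SC (sel x l P) (sel x l P')
  | bra_congr (x I) {P P' : {i // i ∈ I} → Proc} :
      (∀ i, SC (P i) (P' i)) → SC (bra x I P) (bra x I P')
  | req_congr (x) {P P'} : SC P P' → SC (req x P) (req x P')
  | srv_congr (x) {P P'} : SC P P' → SC (srv x P) (srv x P')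
  | wait_congr (x) {P P'} : SC P P' → SC (wait x P) (wait x P')

end Proc

/-- ND-contexts. -/
inductive NCtx : Type
  | hole : NCtx
  | par (N : NCtx) (P : Proc) : NCtx
  | res (N : NCtx) (P : Proc) : NCtx
  | nd (N : NCtx) (P : Proc) : NCtx

namespace NCtx

/-- `N[P]`. The restrictions of `N` bind in `P`. -/
def fill : NCtx → Proc → Proc
  | hole, P => P
  | par N R, P => Proc.par (fill N P) R
  | res N R, P => Proc.res (fill N P) R
  | nd N R, P => Proc.nd (fill N P) R

/-- Number of restrictions above the hole. -/
def depth : NCtx → ℕ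
  | hole => 0
  | par N _ => depth N
  | res N _ => depth N + 1
  | nd N _ => depth N

/-- The commitment of an ND-context. -/
def commit : NCtx → NCtx
  | hole => hole
  | par N P => par (commit N) P
  | res N P => res (commit N) P
  | nd N _ => commit N

/-- Capture-avoiding renaming of the free names of an ND-context. -/
def rename : (ℕ → ℕ) → NCtx → NCtx
  | _, hole => hole
  | f, par N P => par (rename f N) (P.rename f)
  | f, res N P => res (rename (up 1 f) N) (P.rename (up 1 f))
  | f, nd N P => nd (rename f N) (P.rename f)

end NCtx

namespace Proc

/-- Eager reduction. Under `d` restrictions of an ND-context, the name `x` of the enclosing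
`(ν x)(_ ∥ _)` is the index `d`. When a committed context leaves the scope of `x`, or when this
scope disappears, the premises `N.commit = N₀.rename Nat.succ` say that `x` does not occur in it. -/
inductive Red : Proc → Proc → Prop
  /-- `(ν x)(N[x ↔ y] ∥ Q) ⟶ D(N)[Q{y/x}]` -/
  | id (N N₀ : NCtx) (y : ℕ) (Q : Proc) (hN : N.commit = N₀.rename Nat.succ) :
      Red (res (N.fill (fwd N.depth (up N.depth Nat.succ y))) Q)
        (N₀.fill (Q.rename (scons y (fun i => i + N.depth))))
  /-- `(ν x)(N[x[]] ∥ N'[x(); Q]) ⟶ D(N)[0] ∥ D(N')[Q]` -/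
  | close (N N₀ N' N₀' : NCtx) (Q : Proc) (hN : N.commit = N₀.rename Nat.succ)
      (hN' : N'.commit = N₀'.rename Nat.succ) :
      Red (res (N.fill (close N.depth))
          (N'.fill (wait N'.depth (Q.rename (up N'.depth Nat.succ)))))
        (par (N₀.fill nil) (N₀'.fill Q))
  /-- `(ν x)(N[x[y]; (P ∥ Q)] ∥ N'[x(z); R]) ⟶ D(N)[(ν x)(Q ∥ (ν y)(P ∥ D(N')[R{y/z}]))]` -/
  | comm (N N₀ N' : NCtx) (P Q R : Proc) (hN : N.commit = N₀.rename Nat.succ) :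
      Red (res (N.fill (out N.depth P Q)) (N'.fill (inp N'.depth R)))
        (N₀.fill (res (Q.rename (rot N.depth))
          (res (P.rename (up 1 (rot N.depth)))
            ((N'.commit.rename (scons 1 (fun j => j + N.depth + 2))).fill
              (R.rename (scons N'.depth
                (up N'.depth (scons 1 (fun j => j + N.depth + 2)))))))))
  /-- `(ν x)(N[x.k; P] ∥ N'[x{i : Qᵢ}]) ⟶ (ν x)(D(N)[P] ∥ D(N')[Qₖ])` -/
  | select (N N' : NCtx) (P : Proc) (I : Finset ℕ) (Q : {i // i ∈ I} → Proc) (k : {i // i ∈ I}) :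
      Red (res (N.fill (sel N.depth k.1 P)) (N'.fill (bra N'.depth I Q)))
        (res (N.commit.fill P) (N'.commit.fill (Q k)))
  /-- `(ν x)(N[?x[y]; P] ∥ N'[!x(z); Q]) ⟶ D(N')[(ν x)((ν y)(D(N)[P] ∥ Q{y/z}) ∥ !x(z); Q)]` -/
  | request (N N' N₀' : NCtx) (P Q : Proc) (hN' : N'.commit = N₀'.rename Nat.succ) :
      Red (res (N.fill (req N.depth P)) (N'.fill (srv N'.depth Q)))
        (N₀'.fill (res
          (res
            ((N.commit.rename (scons 1 (fun j => j + N'.depth + 2))).fill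
              (P.rename (scons N.depth
                (up N.depth (scons 1 (fun j => j + N'.depth + 2))))))
            (Q.rename (up 1 (rot N'.depth))))
          (srv 0 (Q.rename (up 1 (rot N'.depth))))))
  /-- `(ν x)(N[x.some; P] ∥ N'[x.some_{ws}; Q]) ⟶ (ν x)(D(N)[P] ∥ D(N')[Q])` -/
  | some (N N' : NCtx) (ws : Finset ℕ) (P Q : Proc) :
      Red (res (N.fill (psome N.depth P)) (N'.fill (gsome N'.depth ws Q)))
        (res (N.commit.fill P) (N'.commit.fill Q))
  /-- `(ν x)(N[x.none] ∥ N'[x.some_{w₁, …, wₙ}; Q]) ⟶ D(N)[0] ∥ D(N')[w₁.none ∥ … ∥ wₙ.none]`,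
  for any enumeration of the set `{w₁, …, wₙ}` -/
  | none (N N₀ N' N₀' : NCtx) (ws : List ℕ) (Q : Proc) (hws : ws.Nodup)
      (hN : N.commit = N₀.rename Nat.succ) (hN' : N'.commit = N₀'.rename Nat.succ) :
      Red (res (N.fill (pnone N.depth))
          (N'.fill (gsome N'.depth (ws.toFinset.image (up N'.depth Nat.succ)) Q)))
        (par (N₀.fill nil) (N₀'.fill (nones ws)))
  | struct {P P' Q' Q : Proc} : SC P P' → Red P' Q' → SC Q' Q → Red P Q
  | res {P P' : Proc} (Q : Proc) : Red P P' → Red (res P Q) (res P' Q)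
  | par {P P' : Proc} (Q : Proc) : Red P P' → Red (par P Q) (par P' Q)
  | nd {P P' : Proc} (Q : Proc) : Red P P' → Red (nd P Q) (nd P' Q)

/-- `P ⟶* Q`: finitely many (possibly zero) eager reductions, modulo structural congruence. -/
def Reds : Proc → Proc → Prop :=
  Relation.ReflTransGen (fun P Q => SC P Q ∨ Red P Q)

/-- The precongruence `P ⪰ Q`: `P` has at least as many non-deterministic branches as `Q`. -/
inductive MoreBranches : Proc → Proc → Prop
  | refl (P) : MoreBranches P P
  | left {P₁ P₁'} (P₂) : MoreBranches P₁ P₁' → MoreBranches (nd P₁ P₂) P₁'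
  | right (P₁) {P₂ P₂'} : MoreBranches P₂ P₂' → MoreBranches (nd P₁ P₂) P₂'
  | par {P P' Q Q'} : MoreBranches P P' → MoreBranches Q Q' → MoreBranches (par P Q) (par P' Q')
  | res {P P' Q Q'} : MoreBranches P P' → MoreBranches Q Q' → MoreBranches (res P Q) (res P' Q')
  | nd {P P' Q Q'} : MoreBranches P P' → MoreBranches Q Q' → MoreBranches (nd P Q) (nd P' Q')

end Proc

/-! ## The resource lambda-calculus -/

mutual
/-- Terms. A variable is a de Bruijn index; it may have linear occurrences, unrestricted
occurrences, and an occurrence as a sharing variable. -/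
inductive Tm : Type
  /-- linear occurrence of `x` -/
  | var (x : ℕ) : Tm
  /-- unrestricted occurrence `x[i]` -/
  | uvar (x i : ℕ) : Tm
  /-- `λ x. M`; binds `0` -/
  | abs (M : Tm) : Tm
  /-- `M (C ⋆ U)` -/
  | app (M : Tm) (C : LBag) (U : UBag) : Tm
  /-- `fail^{xs}` -/
  | fail (xs : List ℕ) : Tm
  /-- sharing `M[x₁, …, xₖ ← x]`; binds `0, …, k - 1` in `M` -/
  | share (k x : ℕ) (M : Tm) : Tm
  /-- intermediate substitution of `C ⋆ U` for the variable `0` bound in `M` -/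
  | esub (M : Tm) (C : LBag) (U : UBag) : Tm
  /-- linear substitution of `C` for the `k` variables `0, …, k - 1` bound in `M` -/
  | lsub (k : ℕ) (M : Tm) (C : LBag) : Tm
  /-- unrestricted substitution of `U` for the variable `0` bound in `M` -/
  | usub (M : Tm) (U : UBag) : Tm
/-- Linear bags. -/
inductive LBag : Type
  | one : LBag
  | cons (M : Tm) (C : LBag) : LBag
/-- Unrestricted bags. -/
inductive UBag : Type
  | one : UBag
  | single (M : Tm) : UBag
  | cat (U V : UBag) : UBag
end

/-- The three ways in which a variable occurs: linearly, as a sharing variable, unrestrictedly.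
They correspond to the three names that a variable gives rise to in processes. -/
inductive Role : Type
  | lin : Role
  | shr : Role
  | un : Role
  deriving DecidableEq

mutual
/-- Capture-avoiding renaming of the free variables. -/
def Tm.rename : (ℕ → ℕ) → Tm → Tm
  | f, .var x => .var (f x)
  | f, .uvar x i => .uvar (f x) i
  | f, .abs M => .abs (M.rename (up 1 f))
  | f, .app M C U => .app (M.rename f) (C.rename f) (U.rename f)
  | f, .fail xs => .fail (xs.map f)
  | f, .share k x M => .share k (f x) (M.rename (up k f))
  | f, .esub M C U => .esub (M.rename (up 1 f)) (C.rename f) (U.rename f)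
  | f, .lsub k M C => .lsub k (M.rename (up k f)) (C.rename f)
  | f, .usub M U => .usub (M.rename (up 1 f)) (U.rename f)
def LBag.rename : (ℕ → ℕ) → LBag → LBag
  | _, .one => .one
  | f, .cons M C => .cons (M.rename f) (C.rename f)
def UBag.rename : (ℕ → ℕ) → UBag → UBag
  | _, .one => .one
  | f, .single M => .single (M.rename f)
  | f, .cat U V => .cat (U.rename f) (V.rename f)
end

mutual
/-- The variables with a free occurrence in the role `r`. -/
def Tm.fv : Tm → Role → Finset ℕ
  | .var x, r => if r = .lin then {x} else ∅
  | .uvar x _, r => if r = .un then {x} else ∅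
  | .abs M, r => lower 1 (M.fv r)
  | .app M C U, r => M.fv r ∪ C.fv r ∪ U.fv r
  | .fail xs, r => if r = .lin then xs.toFinset else ∅
  | .share k x M, r => lower k (M.fv r) ∪ (if r = .shr then {x} else ∅)
  | .esub M C U, r => lower 1 (M.fv r) ∪ C.fv r ∪ U.fv r
  | .lsub k M C, r => lower k (M.fv r) ∪ C.fv r
  | .usub M U, r => lower 1 (M.fv r) ∪ U.fv r
def LBag.fv : LBag → Role → Finset ℕ
  | .one, _ => ∅
  | .cons M C, r => M.fv r ∪ C.fv r
def UBag.fv : UBag → Role → Finset ℕ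
  | .one, _ => ∅
  | .single M, r => M.fv r
  | .cat U V, r => U.fv r ∪ V.fv r
end

/-- A term is closed if it has no free variables. -/
def Tm.Closed (M : Tm) : Prop := ∀ r, M.fv r = ∅

/-- The linear free variables of a term (sharing variables included). -/
def Tm.llfv (M : Tm) : Finset ℕ := M.fv .lin ∪ M.fv .shr

/-- The linear free variables of a linear bag. -/
def LBag.llfv (C : LBag) : Finset ℕ := C.fv .lin ∪ C.fv .shr

/-- The number of elements of a linear bag. -/
def LBag.size : LBag → ℕ
  | .one => 0
  | .cons _ C => C.size + 1

/-- The `i`-th element of a linear bag, counted from `0`. -/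
def LBag.get? : LBag → ℕ → Option Tm
  | .one, _ => none
  | .cons M _, 0 => some M
  | .cons _ C, i + 1 => C.get? i

/-- A linear bag without its `i`-th element, counted from `0`. -/
def LBag.remove : LBag → ℕ → LBag
  | .one, _ => .one
  | .cons _ C, 0 => C
  | .cons M C, i + 1 => .cons M (C.remove i)

/-- The positions of an unrestricted bag: `none` is the empty bag, `some N` the singleton of `N`. -/
def UBag.positions : UBag → List (Option Tm)
  | .one => [none]
  | .single M => [some M]
  | .cat U V => U.positions ++ V.positions

/-- `Uᵢ`, counted from `1`; the empty bag (`none`) if there is no `i`-th position. -/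
def UBag.at : UBag → ℕ → Option Tm
  | _, 0 => none
  | U, i + 1 => (U.positions[i]?).join

/-- Head variables. -/
inductive HeadVar : Type
  | lin (x : ℕ) : HeadVar
  | un (x i : ℕ) : HeadVar

/-- Takes a head variable out of the scope of `k` binders (nothing if it is bound by them). -/
def HeadVar.lower (k : ℕ) : HeadVar → Option HeadVar
  | .lin x => if x < k then none else some (.lin (x - k))
  | .un x i => if x < k then none else some (.un (x - k) i)

/-- The head of a term, if this is a (free) variable. -/
def Tm.head : Tm → Option HeadVar
  | .var x => some (.lin x)
  | .uvar x i => some (.un x i)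
  | .abs _ => none
  | .app M _ _ => M.head
  | .fail _ => none
  | .share k x M =>
    match M.head with
    | some (.lin y) => if y < k then some (.lin x) else some (.lin (y - k))
    | some (.un y i) => HeadVar.lower k (.un y i)
    | none => none
  | .esub _ _ _ => none
  | .lsub k M _ => M.head.bind (HeadVar.lower k)
  | .usub M _ => M.head.bind (HeadVar.lower 1)

/-- Head substitution: the head variable of the term is replaced by `N`. -/
def Tm.headSubst : Tm → Tm → Tm
  | .var _, N => N
  | .uvar _ _, N => N
  | .abs M, _ => .abs M
  | .app M C U, N => .app (M.headSubst N) C U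
  | .fail xs, _ => .fail xs
  | .share k x M, N => .share k x (M.headSubst (N.rename (fun i => i + k)))
  | .esub M C U, _ => .esub M C U
  | .lsub k M C, N => .lsub k (M.headSubst (N.rename (fun i => i + k))) C
  | .usub M U, N => .usub (M.headSubst (N.rename Nat.succ)) U

/-- Reduction of terms. -/
inductive Tm.Red : Tm → Tm → Prop
  | beta (M C U) : Red (.app (.abs M) C U) (.esub M C U)
  | exSub (k M C U) (hC : C.size = k) (hM : ∀ ys, M ≠ .fail ys) :
      Red (.esub (.share k 0 M) C U) (.usub (.lsub k M (C.rename Nat.succ)) U)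
  /-- The equation `h` says that `M''` is `M` with its head `xⱼ` replaced by the `i`-th element of
  `C`, a term in which `xⱼ` does not occur any more. -/
  | fetchLin (k M C) (i j : ℕ) (N M'' : Tm) (hj : j < k + 1) (hM : M.head = some (.lin j))
      (hN : C.get? i = some N)
      (h : M.headSubst (N.rename (fun a => a + (k + 1))) = M''.rename (skip j)) :
      Red (.lsub (k + 1) M C) (.lsub k M'' (C.remove i))
  | failLin (k M C U ys) (hC : C.size ≠ k) (hys : ys.Nodup)
      (h : ys.toFinset = lower (k + 1) M.llfv ∪ C.llfv) :
      Red (.esub (.share k 0 M) C U) (.fail ys)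
  | fetchUn (M U) (i : ℕ) (N : Tm) (hM : M.head = some (.un 0 i)) (hN : U.at i = some N) :
      Red (.usub M U) (.usub (M.headSubst (N.rename Nat.succ)) U)
  | failUn (M U) (i : ℕ) (hM : M.head = some (.un 0 i)) (hN : U.at i = none) :
      Red (.usub M U) (.usub (M.headSubst (.fail [])) U)
  | cons₁ (xs C U zs) (hzs : zs.Nodup) (h : zs.toFinset = xs.toFinset ∪ C.llfv) :
      Red (.app (.fail xs) C U) (.fail zs)
  | cons₂ (k xs C U zs) (hC : C.size = k) (hx : Finset.range k ⊆ xs.toFinset) (hzs : zs.Nodup)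
      (h : zs.toFinset = lower (k + 1) xs.toFinset ∪ C.llfv) :
      Red (.esub (.share k 0 (.fail xs)) C U) (.fail zs)
  | cons₃ (k xs C zs) (hx : Finset.range k ⊆ xs.toFinset) (hzs : zs.Nodup)
      (h : zs.toFinset = lower k xs.toFinset ∪ C.llfv) :
      Red (.lsub k (.fail xs) C) (.fail zs)
  | cons₄ (xs U) : Red (.usub (.fail (xs.map Nat.succ)) U) (.fail xs)
  | appCtx {M M'} (C U) : Red M M' → Red (.app M C U) (.app M' C U)
  | lsubCtx (k) {M M'} (C) : Red M M' → Red (.lsub k M C) (.lsub k M' C)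
  | usubCtx {M M'} (U) : Red M M' → Red (.usub M U) (.usub M' U)
  | shareCtx (k x) {M M'} : Red M M' → Red (.share k x M) (.share k x M')

/-! ### Intersection types and well-formedness -/

mutual
/-- Strict types. -/
inductive STy : Type
  | unit : STy
  /-- `(π, η) → σ` -/
  | arr (π : MTy) (η : LTy) (σ : STy) : STy
/-- Multiset types. -/
inductive MTy : Type
  | omega : MTy
  | and (σ : STy) (π : MTy) : MTy
/-- List types: non-empty lists of strict types. -/
inductive LTy : Type
  | one (σ : STy) : LTy
  | cons (σ : STy) (η : LTy) : LTy
end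

/-- `σ ∧ ⋯ ∧ σ` (`k` times), `ω` for `k = 0`. -/
def MTy.pow (σ : STy) : ℕ → MTy
  | 0 => .omega
  | k + 1 => .and σ (MTy.pow σ k)

/-- The strict types that make up a list type. -/
def LTy.toList : LTy → List STy
  | .one σ => [σ]
  | .cons σ η => σ :: η.toList

/-- Concatenation of list types. -/
def LTy.append : LTy → LTy → LTy
  | .one σ, ε => .cons σ ε
  | .cons σ η, ε => .cons σ (η.append ε)

/-- `ε` embraces `η`. -/
def LTy.Embraced (η ε : LTy) : Prop := η.toList <+: ε.toList

/-- What a linear context assigns to a variable: a strict type or a multiset type. -/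
inductive Asg : Type
  | strict (σ : STy) : Asg
  | multi (π : MTy) : Asg

/-- Linear contexts. -/
abbrev LCtx : Type := ℕ → Option Asg

/-- Unrestricted contexts. -/
abbrev UCtx : Type := ℕ → Option LTy

/-- The empty linear context. -/
def LCtx.empty : LCtx := fun _ => none

/-- `Γ, x : a`, for `x ∉ dom Γ`. -/
def LCtx.add (Γ : LCtx) (x : ℕ) (a : Asg) : LCtx := fun y => if y = x then some a else Γ y

/-- The domains of two linear contexts are disjoint. -/
def LCtx.Disj (Γ Δ : LCtx) : Prop := ∀ x, Γ x = none ∨ Δ x = none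

/-- `Γ, Δ`, for disjoint domains. -/
def LCtx.join (Γ Δ : LCtx) : LCtx := fun x => (Γ x).or (Δ x)

/-- `Γ, x₀ : a, …, xₖ₋₁ : a`, under a binder of these `k` variables. -/
def LCtx.ext (k : ℕ) (a : Asg) (Γ : LCtx) : LCtx :=
  fun i => if i < k then some a else Γ (i - k)

/-- The context `Γ` under `k` binders whose variables it does not mention. -/
def LCtx.lift (k : ℕ) (Γ : LCtx) : LCtx := fun i => if i < k then none else Γ (i - k)

/-- `Θ, x : η`, under a binder of `x`. -/
def UCtx.ext (η : LTy) (Θ : UCtx) : UCtx := fun i => if i < 1 then some η else Θ (i - 1)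

/-- The context `Θ` under `k` binders whose variables it does not mention. -/
def UCtx.lift (k : ℕ) (Θ : UCtx) : UCtx := fun i => if i < k then none else Θ (i - k)

/-- The core context: variables whose type is not `ω`. -/
def LCtx.core (Γ : LCtx) : LCtx := fun x =>
  match Γ x with
  | some (.multi .omega) => none
  | a => a

mutual
/-- Well-formedness of terms, `Θ; Γ ⊨ M : τ`. -/
inductive WfTm : UCtx → LCtx → Tm → STy → Prop
  | var (Θ x σ) : WfTm Θ (LCtx.empty.add x (.strict σ)) (.var x) σ
  | uvar (Θ Δ) (x i : ℕ) (η : LTy) (δ σ : STy) (hη : Θ x = some η)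
      (hi : η.toList[i]? = some δ) (hx : Δ x = none)
      (h : WfTm Θ (LCtx.add Δ x (.strict δ)) (.var x) σ) : WfTm Θ Δ (.uvar x (i + 1)) σ
  | fail (Θ Γ xs τ) (hxs : xs.Nodup) (h : ∀ x, x ∈ xs ↔ LCtx.core Γ x ≠ none) :
      WfTm Θ (LCtx.core Γ) (.fail xs) τ
  | weak {Θ Γ M τ} (x : ℕ) (hx : Γ x = none) (h : WfTm Θ Γ M τ) :
      WfTm Θ (LCtx.add Γ x (.multi .omega)) (.share 0 x M) τ
  | shar {Θ Γ M τ} (k x : ℕ) (σ : STy) (hk : k ≠ 0) (hx : Γ x = none)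
      (h : WfTm (UCtx.lift k Θ) (LCtx.ext k (.strict σ) Γ) M τ) :
      WfTm Θ (LCtx.add Γ x (.multi (.pow σ k))) (.share k x M) τ
  | abs {Θ Γ M τ} (n k : ℕ) (σ : STy) (η : LTy)
      (h : WfTm (UCtx.ext η Θ) (LCtx.ext 1 (.multi (.pow σ k)) Γ) (.share n 0 M) τ) :
      WfTm Θ Γ (.abs (.share n 0 M)) (.arr (.pow σ k) η τ)
  | app {Θ Γ Δ M C U τ} (j k : ℕ) (σ : STy) (η ε : LTy) (hd : LCtx.Disj Γ Δ)
      (hM : WfTm Θ Γ M (.arr (.pow σ j) η τ)) (hC : WfLBag Θ Δ C (.pow σ k))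
      (hU : WfUBag Θ U ε) (he : η.Embraced ε) : WfTm Θ (LCtx.join Γ Δ) (.app M C U) τ
  | usub {Θ Γ M U τ} (η ε : LTy) (hM : WfTm (UCtx.ext η Θ) (LCtx.lift 1 Γ) M τ)
      (hU : WfUBag Θ U ε) (he : η.Embraced ε) : WfTm Θ Γ (.usub M U) τ
  | esub {Θ Γ Δ M C U τ} (n j k : ℕ) (σ : STy) (η ε : LTy) (hd : LCtx.Disj Γ Δ)
      (hM : WfTm (UCtx.ext η Θ) (LCtx.ext 1 (.multi (.pow σ j)) Γ) (.share n 0 M) τ)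
      (hC : WfLBag Θ Δ C (.pow σ k)) (hU : WfUBag Θ U ε) (he : η.Embraced ε) :
      WfTm Θ (LCtx.join Γ Δ) (.esub (.share n 0 M) C U) τ
  | lsub {Θ Γ Δ M C τ} (k : ℕ) (σ : STy) (hd : LCtx.Disj Γ Δ)
      (hM : WfTm (UCtx.lift k Θ) (LCtx.ext k (.strict σ) Γ) M τ)
      (hC : WfLBag Θ Δ C (.pow σ k)) : WfTm Θ (LCtx.join Γ Δ) (.lsub k M C) τ
/-- Well-formedness of linear bags, `Θ; Γ ⊨ C : π`. -/
inductive WfLBag : UCtx → LCtx → LBag → MTy → Prop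
  | one (Θ) : WfLBag Θ LCtx.empty .one .omega
  | cons {Θ Γ Δ M C} (σ : STy) (k : ℕ) (hd : LCtx.Disj Γ Δ) (hM : WfTm Θ Γ M σ)
      (hC : WfLBag Θ Δ C (.pow σ k)) :
      WfLBag Θ (LCtx.join Γ Δ) (.cons M C) (.pow σ (k + 1))
/-- Well-formedness of unrestricted bags, `Θ; - ⊨ U : η`. -/
inductive WfUBag : UCtx → UBag → LTy → Prop
  | one (Θ σ) : WfUBag Θ .one (.one σ)
  | single {Θ M} (σ : STy) (hM : WfTm Θ LCtx.empty M σ) : WfUBag Θ (.single M) (.one σ)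
  | cat {Θ U V} (ε η : LTy) (hU : WfUBag Θ U ε) (hV : WfUBag Θ V η) :
      WfUBag Θ (.cat U V) (ε.append η)
end

/-- A term is well-formed if some judgement about it is derivable. -/
def Tm.WellFormed (M : Tm) : Prop := ∃ Θ Γ τ, WfTm Θ Γ M τ

/-! ## The translation -/

/-- An environment gives the names that stand for a variable `x`: in the role `lin` the name
written `x` in the translation, in the role `shr` the name of its linear bag, in the role `un` the
name of its unrestricted bag. -/
abbrev Env : Type := Role → ℕ → ℕ

/-- The environment under `n` further name binders. -/
def Env.shift (n : ℕ) (ρ : Env) : Env := fun r i => ρ r i + n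

/-- The environment under a binder of one variable, with the three names of that variable. -/
def Env.cons (a : Role → ℕ) (ρ : Env) : Env := fun r => scons (a r) (ρ r)

/-- The environment under a binder of `k` variables; the `j`-th of them has the name `g j`. -/
def Env.consN (k : ℕ) (g : ℕ → ℕ) (ρ : Env) : Env :=
  fun r i => if i < k then g i else ρ r (i - k)

/-- The environment that gives the variable `i` the name `a`. -/
def Env.set (ρ : Env) (i a : ℕ) : Env := fun r j => if j = i then a else ρ r j

/-- The names of the linear free variables (`F r` are the free variables in the role `r`). -/
def Env.names (ρ : Env) (F : Role → Finset ℕ) : Finset ℕ :=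
  (F .lin).image (ρ .lin) ∪ (F .shr).image (ρ .shr)

/-- The translation of a sharing construct `M[xs ← x]` with `n` shared variables `xs`; `body` is the
translation of `M`, `F` are the free variables of `M`, `x` is the linear name of the sharing
variable. The shared variables are received one after the other, in any order. -/
def Proc.share (F : Role → Finset ℕ) (body : Env → ℕ → Proc) :
    (n : ℕ) → (xs : List ℕ) → (ρ : Env) → (x u : ℕ) → Proc
  | 0, _, ρ, x, u =>
    .psome x (.out x
      (.gsome 0 (insert (u + 1) ((ρ.shift 1).names F)) (.wait 0 (body (ρ.shift 1) (u + 1))))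
      (.pnone x))
  | n + 1, xs, ρ, x, u =>
    .psome x (.out x
      (.gsome 0 ∅ (.wait 0 .nil))
      (.psome x (.gsome x (insert u (ρ.names (fun r => F r \ xs.toFinset)))
        (.bigNd (xs.map (fun i =>
          .inp x (Proc.share F body n (xs.erase i) ((ρ.shift 1).set i 0) (x + 1) (u + 1))))))))

/-- `(ν z₁)(Z₁ ∥ (ν z₂)(Z₂ ∥ … (ν zₙ)(Zₙ ∥ P) …))`, where each `Zᵢ` is given by its environment and
the name `zᵢ`. -/
def Proc.chain : List (Env → ℕ → Proc) → Env → Proc → Proc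
  | [], _, P => P
  | Z :: Zs, ρ, P => .res (Z (ρ.shift 1) 0) (Proc.chain Zs (ρ.shift 1) P)

/-- The branch on `x` that offers the positions `1, …, n` of an unrestricted bag, given by their
translations. -/
def Proc.positions (l : List (Env → ℕ → Proc)) (ρ : Env) (x : ℕ) : Proc :=
  .bra x (Finset.Icc 1 l.length) (fun i => l.getD (i.1 - 1) (fun _ _ => .nil) ρ x)

/-- The translation of `C ⋆ U` at `x`; `F` are the free variables of `C`, `tC` is the translation of
`C` and `tU` are those of the positions of `U`. -/
def Proc.bag (F : Role → Finset ℕ) (tC : Env → ℕ → Proc) (tU : List (Env → ℕ → Proc))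
    (ρ : Env) (x : ℕ) : Proc :=
  .gsome x (ρ.names F) (.out x
    (tC (ρ.shift 1) 0)
    (.out x
      (.srv 0 (Proc.positions tU (ρ.shift 2) 0))
      (.close x)))

/-- The three names of a variable once `x`, its linear name and its unrestricted name have been
received in this order. -/
def bagNames : Role → ℕ
  | .lin => 2
  | .shr => 1
  | .un => 0

mutual
/-- The translation of a term at the name `u`. -/
def Tm.tr : Tm → Env → ℕ → Proc
  | .var x, ρ, u => .psome (ρ .lin x) (.fwd (ρ .lin x) u)
  | .uvar x j, ρ, u => .req (ρ .un x) (.sel 0 j (.fwd 0 (u + 1)))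
  | .abs M, ρ, u =>
    .psome u (.inp u (.psome 0 (.inp 0 (.inp 1 (.wait 2
      (M.tr ((ρ.shift 3).cons bagNames) (u + 3)))))))
  | .esub M C U, ρ, u =>
    .res
      (.psome 0 (.inp 0 (.inp 1 (.wait 2 (M.tr ((ρ.shift 3).cons bagNames) (u + 3))))))
      (Proc.bag C.fv C.tr U.trs (ρ.shift 1) 0)
  | .app M C U, ρ, u =>
    .res
      (M.tr (ρ.shift 1) 0)
      (.gsome 0 (insert (u + 1) ((ρ.shift 1).names C.fv))
        (.out 0 (Proc.bag C.fv C.tr U.trs (ρ.shift 2) 0) (.fwd 0 (u + 1))))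
  | .fail xs, ρ, u => .par (.pnone u) (.nones (xs.map (ρ .lin)))
  | .share k x M, ρ, u =>
    Proc.share M.fv M.tr k (List.range k) (ρ.consN k (fun _ => ρ .shr x)) (ρ .shr x) u
  | .lsub k M C, ρ, u =>
    Proc.chain C.trs ρ (.bigNd ((List.range k).permutations'.map (fun p =>
      M.tr ((ρ.shift C.size).consN k (fun j => C.size - 1 - p.idxOf j)) (u + C.size))))
  | .usub M U, ρ, u =>
    .res
      (M.tr ((ρ.shift 1).cons (fun _ => 0)) (u + 1))
      (.srv 0 (Proc.positions U.trs (ρ.shift 2) 0))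
/-- The translation of a linear bag at the name `x`. -/
def LBag.tr : LBag → Env → ℕ → Proc
  | .one, _, x =>
    .gsome x ∅ (.inp x (.par (.psome 0 (.close 0)) (.gsome (x + 1) ∅ (.pnone (x + 1)))))
  | .cons M C, ρ, x =>
    .gsome x (ρ.names (fun r => M.fv r ∪ C.fv r)) (.inp x
      (.gsome (x + 1) (insert 0 ((ρ.shift 1).names (fun r => M.fv r ∪ C.fv r)))
        (.psome (x + 1) (.out (x + 1)
          (.gsome 0 ((ρ.shift 2).names M.fv) (M.tr (ρ.shift 2) 0))
          (.par (C.tr (ρ.shift 1) (x + 1)) (.pnone 0))))))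
/-- The processes `zᵢ.some_{…}; ⟦Mᵢ⟧` at `zᵢ` for the elements `Mᵢ` of a linear bag. -/
def LBag.trs : LBag → List (Env → ℕ → Proc)
  | .one => []
  | .cons M C => (fun ρ z => .gsome z (ρ.names M.fv) (M.tr ρ z)) :: C.trs
/-- The translations of the positions of an unrestricted bag. -/
def UBag.trs : UBag → List (Env → ℕ → Proc)
  | .one => [fun _ x => .pnone x]
  | .single N => [fun ρ x => N.tr ρ x]
  | .cat U V => U.trs ++ V.trs
end

-- The proof is an induction on the reduction `N → M`, with one simulation for each rule. Closedness
-- is lost under reduction contexts, so the statement carried through the induction,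
-- `WfTm.exists_moreBranches`, concerns open terms whose linear context is strict (it assigns no
-- multiset type) and environments that give the linear variables pairwise distinct names, all
-- different from `u`. Strictness passes to the subterms in which reduction takes place, and it
-- excludes free sharing variables. Hence reduction under a sharing construct cannot occur, and no
-- sharing construct separates a term from its head. Typing provides three more facts: linear bags
-- fit the linear substitutions they belong to (`WfTm.sized`), the domain of the context is the set
-- of linear and sharing free variables (`WfTm.types`), and a head `x[i]` has an index within the
-- list type of `x` (`WfTm.head_un`).
--
-- Three mechanisms carry the simulations.
--
-- Bags against sharing: in each round the bag sends one element, and the sharing construct chooses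
-- which shared variable receives it. The simulation always lets the first remaining variable take
-- it. If the numbers agree, what is left is a single summand, the identity permutation, of the
-- translated linear substitution (`tr_share_eq_size`). This is where the target may have more
-- branches than the process reached. If the numbers differ, one side runs out first and everything
-- collapses to unavailable names (`tr_share_ne_size`).
--
-- Fetching at the head: a translation is, up to congruence, a context of restrictions and choices
-- around the translation of its head variable, and the commitment of this context is covered by the
-- translation of the head substitution (`tr_head`). For a linear fetch of the `i`-th element for
-- `x_j`, the summand to commit to is a permutation that sends `x_j` to position `i` and preserves
-- the order of the rest (`exists_perm_range`). An unrestricted fetch is a request, a selection and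
-- a forwarding.
--
-- Failure: a name that is unavailable discards the process that waits on it and makes the names
-- listed there unavailable too (`NonesTo.kill`, `chain_nones`). Linearity of typing makes the sets
-- of names involved disjoint, so each name is announced once and the outcome is the translated
-- failure term up to order.
--
-- The bookkeeping of indices rests on naturality (`Tm.tr_natural`): translation commutes with a
-- simultaneous renaming of variables and names. Every freshness condition is derived from it.

-- Renaming of names in processes

theorem up_lt {k i : ℕ} (f : ℕ → ℕ) (h : i < k) : up k f i = i := if_pos h

@[simp] theorem up_add (k i : ℕ) (f : ℕ → ℕ) : up k f (i + k) = f i + k := by simp [up]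

@[simp] theorem up_one_zero (f : ℕ → ℕ) : up 1 f 0 = 0 := rfl

@[simp] theorem up_one_succ (f : ℕ → ℕ) (i : ℕ) : up 1 f (i + 1) = f i + 1 := by simp [up]

@[simp] theorem up_zero (f : ℕ → ℕ) : up 0 f = f := by ext i; simp [up]

theorem up_up (k l : ℕ) (f : ℕ → ℕ) : up k (up l f) = up (k + l) f := by
  ext i
  unfold up
  split_ifs <;> first | omega | skip
  rw [show i - k - l = i - (k + l) by omega]; omega

@[simp] theorem up_id (k : ℕ) : up k id = id := by
  ext i; unfold up; split_ifs <;> simp; omega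

theorem up_comp (k : ℕ) (f g : ℕ → ℕ) : up k f ∘ up k g = up k (f ∘ g) := by
  ext i
  by_cases h : i < k
  · simp [up_lt _ h]
  · obtain ⟨j, rfl⟩ := Nat.exists_eq_add_of_le (not_lt.1 h)
    simp [Nat.add_comm k j]

theorem skip_eq_up (k : ℕ) : skip k = up k Nat.succ := by
  ext i; unfold skip up; split_ifs <;> simp; omega

@[simp] theorem rot_zero : rot 0 = id := by
  ext i; unfold rot; split_ifs <;> simp_all

namespace Proc

@[simp] theorem rename_id : ∀ P : Proc, rename id P = P
  | nil => rfl
  | fwd _ _ => rfl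
  | par P Q => by simp [rename, rename_id P, rename_id Q]
  | res P Q => by simp [rename, rename_id P, rename_id Q]
  | nd P Q => by simp [rename, rename_id P, rename_id Q]
  | psome _ P => by simp [rename, rename_id P]
  | pnone _ => rfl
  | gsome _ _ P => by simp [rename, rename_id P]
  | out _ P Q => by simp [rename, rename_id P, rename_id Q]
  | inp _ P => by simp [rename, rename_id P]
  | sel _ _ P => by simp [rename, rename_id P]
  | bra _ _ P => by simp [rename, fun i => rename_id (P i)]
  | req _ P => by simp [rename, rename_id P]
  | srv _ P => by simp [rename, rename_id P]
  | close _ => rfl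
  | wait _ P => by simp [rename, rename_id P]

theorem rename_rename : ∀ (f g : ℕ → ℕ) (P : Proc), rename f (rename g P) = rename (f ∘ g) P
  | _, _, nil => rfl
  | _, _, fwd _ _ => rfl
  | f, g, par P Q => by simp [rename, rename_rename f g]
  | f, g, res P Q => by simp [rename, rename_rename (up 1 f) (up 1 g), up_comp]
  | f, g, nd P Q => by simp [rename, rename_rename f g]
  | f, g, psome _ P => by simp [rename, rename_rename f g]
  | _, _, pnone _ => rfl
  | f, g, gsome _ _ P => by simp [rename, rename_rename f g, Finset.image_image]
  | f, g, out _ P Q => by simp [rename, rename_rename f g, rename_rename (up 1 f) (up 1 g), up_comp]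
  | f, g, inp _ P => by simp [rename, rename_rename (up 1 f) (up 1 g), up_comp]
  | f, g, sel _ _ P => by simp [rename, rename_rename f g]
  | f, g, bra _ _ P => by simp [rename, fun i => rename_rename f g (P i)]
  | f, g, req _ P => by simp [rename, rename_rename (up 1 f) (up 1 g), up_comp]
  | f, g, srv _ P => by simp [rename, rename_rename (up 1 f) (up 1 g), up_comp]
  | _, _, close _ => rfl
  | f, g, wait _ P => by simp [rename, rename_rename f g]

theorem rename_injective {f : ℕ → ℕ} (hf : f.Injective) : (rename f).Injective := by
  intro P Q h
  have := congrArg (rename (Function.invFun f)) h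
  simpa [rename_rename, Function.invFun_comp hf] using this

@[simp] theorem rename_nones (f : ℕ → ℕ) : ∀ l, rename f (nones l) = nones (l.map f)
  | [] => rfl
  | a :: l => by simp [nones, rename, rename_nones f l]

@[simp] theorem rename_bigNd (f : ℕ → ℕ) :
    ∀ l, rename f (bigNd l) = bigNd (l.map (rename f))
  | [] => rfl
  | [P] => rfl
  | P :: Q :: l => by
    have := rename_bigNd f (Q :: l)
    simp only [List.map_cons] at this
    simp [bigNd, rename, this]

/-! ### Structural congruence -/

theorem SC.nil_par (P : Proc) : SC (par nil P) P := (SC.par_comm _ _).trans (SC.par_nil P)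

/-- Idempotence duplicates the chosen summand before it is pulled to the front. The whole sum stays
beside it, so the sum without this summand never has to be described. -/
theorem SC.bigNd_mem {P : Proc} : ∀ {l : List Proc}, P ∈ l → SC (bigNd l) (nd P (bigNd l))
  | [Q], h => by
    obtain rfl : P = Q := by simpa using h
    exact (SC.nd_idem P).symm
  | Q :: R :: l, h => by
    rcases List.mem_cons.1 h with rfl | h
    · exact (SC.nd_congr (SC.nd_idem _).symm (SC.refl _)).trans (SC.nd_assoc _ _ _)
    · refine (SC.nd_congr (SC.refl Q) (SC.bigNd_mem h)).trans ?_
      exact (SC.nd_assoc _ _ _).symm.trans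
        ((SC.nd_congr (SC.nd_comm _ _) (SC.refl _)).trans (SC.nd_assoc _ _ _))

theorem SC.bigNd_const {P : Proc} :
    ∀ {l : List Proc}, l ≠ [] → (∀ Q ∈ l, SC Q P) → SC (bigNd l) P
  | [Q], _, h => h Q (by simp)
  | Q :: R :: l, _, h =>
    (SC.nd_congr (h Q (by simp)) (SC.bigNd_const (by simp) fun S hS => h S (by simp_all))).trans
      (SC.nd_idem P)

theorem SC.nones_perm {l l' : List ℕ} (h : l.Perm l') : SC (nones l) (nones l') := by
  induction h with
  | nil => exact SC.refl _
  | cons x _ ih => exact SC.par_congr (SC.refl _) ih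
  | swap x y l =>
    exact (SC.par_assoc _ _ _).symm.trans
      ((SC.par_congr (SC.par_comm _ _) (SC.refl _)).trans (SC.par_assoc _ _ _))
  | trans _ _ ih₁ ih₂ => exact ih₁.trans ih₂

theorem SC.nones_append : ∀ l l' : List ℕ, SC (nones (l ++ l')) (par (nones l) (nones l'))
  | [], _ => (SC.nil_par _).symm
  | _ :: l, l' =>
    (SC.par_congr (SC.refl _) (SC.nones_append l l')).trans (SC.par_assoc _ _ _).symm

/-! ### Sequences of reductions -/

theorem Reds.refl (P : Proc) : Reds P P := Relation.ReflTransGen.refl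

theorem Reds.trans {P Q R : Proc} : Reds P Q → Reds Q R → Reds P R :=
  Relation.ReflTransGen.trans

theorem SC.reds {P Q : Proc} (h : SC P Q) : Reds P Q := Relation.ReflTransGen.single (Or.inl h)

theorem Red.reds {P Q : Proc} (h : Red P Q) : Reds P Q := Relation.ReflTransGen.single (Or.inr h)

theorem Reds.congr {K : Proc → Proc} (hs : ∀ {P Q}, SC P Q → SC (K P) (K Q))
    (hr : ∀ {P Q}, Red P Q → Red (K P) (K Q)) {P Q : Proc} (h : Reds P Q) :
    Reds (K P) (K Q) := by
  induction h with
  | refl => exact Reds.refl _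
  | tail _ h ih => exact ih.tail (h.imp hs hr)

theorem Reds.res_left {P P' : Proc} (Q : Proc) : Reds P P' → Reds (res P Q) (res P' Q) :=
  Reds.congr (K := fun P => Proc.res P Q) (fun h => SC.res_congr h (SC.refl _)) (Red.res Q)

theorem Reds.res_right (P : Proc) {Q Q' : Proc} (h : Reds Q Q') : Reds (res P Q) (res P Q') :=
  ((SC.res_comm _ _).reds.trans (h.res_left P)).trans (SC.res_comm _ _).reds

theorem Reds.nd {P P' Q Q' : Proc} (h : Reds P P') (h' : Reds Q Q') :
    Reds (nd P Q) (nd P' Q') := by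
  have key : ∀ {P P' : Proc} (Q : Proc), Reds P P' → Reds (Proc.nd P Q) (Proc.nd P' Q) :=
    fun Q => Reds.congr (K := fun P => Proc.nd P Q)
      (fun h => SC.nd_congr h (SC.refl _)) (Red.nd Q)
  exact (key Q h).trans (((SC.nd_comm _ _).reds.trans (key P' h')).trans (SC.nd_comm _ _).reds)

theorem Reds.bigNd {α : Type*} {p q : α → Proc} :
    ∀ {l : List α}, (∀ a ∈ l, Reds (p a) (q a)) → Reds (bigNd (l.map p)) (bigNd (l.map q))
  | [], _ => Reds.refl _
  | [a], h => h a (by simp)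
  | a :: b :: l, h =>
    Reds.nd (h a (by simp)) (Reds.bigNd (l := b :: l) fun c hc => h c (by simp_all))

theorem Reds.chain {P Q : Proc} (h : Reds P Q) :
    ∀ (Zs : List (Env → ℕ → Proc)) (ρ : Env), Reds (Proc.chain Zs ρ P) (Proc.chain Zs ρ Q)
  | [], _ => h
  | _ :: Zs, ρ => (Reds.chain h Zs (ρ.shift 1)).res_right _

/-! ### The precongruence on branches -/

theorem MoreBranches.bigNd {α : Type*} {p q : α → Proc} :
    ∀ {l : List α}, (∀ a ∈ l, MoreBranches (p a) (q a)) →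
      MoreBranches (bigNd (l.map p)) (bigNd (l.map q))
  | [], _ => .refl _
  | [a], h => h a (by simp)
  | a :: b :: l, h =>
    .nd (h a (by simp)) (MoreBranches.bigNd (l := b :: l) fun c hc => h c (by simp_all))

theorem MoreBranches.bigNd_mem {P Q : Proc} :
    ∀ {l : List Proc}, P ∈ l → MoreBranches P Q → MoreBranches (Proc.bigNd l) Q
  | [R], h, hQ => by
    obtain rfl : P = R := by simpa using h
    exact hQ
  | R :: S :: l, h, hQ => by
    rcases List.mem_cons.1 h with rfl | h
    · exact .left _ hQ
    · exact .right _ (MoreBranches.bigNd_mem h hQ)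

theorem MoreBranches.chain {P Q : Proc} (h : MoreBranches P Q) :
    ∀ (Zs : List (Env → ℕ → Proc)) (ρ : Env),
      MoreBranches (Proc.chain Zs ρ P) (Proc.chain Zs ρ Q)
  | [], _ => h
  | _ :: Zs, ρ => .res (.refl _) (MoreBranches.chain h Zs (ρ.shift 1))

/-- Passing to fewer branches only deletes subprocesses, so a name avoided by the larger process is
avoided by the smaller one. With `f = Nat.succ` this yields the side condition of forwarding without
inspecting the committed context. -/
theorem MoreBranches.exists_of_rename {P Q : Proc} {f : ℕ → ℕ}
    (h : MoreBranches (rename f P) Q) : ∃ Q₀, Q = rename f Q₀ ∧ MoreBranches P Q₀ := by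
  generalize hP' : rename f P = P' at h
  induction h generalizing P f with
  | refl => exact ⟨P, hP'.symm, .refl _⟩
  | left P₂ _ ih =>
    cases P <;> simp [rename] at hP'
    obtain ⟨Q₀, rfl, h⟩ := ih hP'.1
    exact ⟨Q₀, rfl, .left _ h⟩
  | right P₁ _ ih =>
    cases P <;> simp [rename] at hP'
    obtain ⟨Q₀, rfl, h⟩ := ih hP'.2
    exact ⟨Q₀, rfl, .right _ h⟩
  | par _ _ ih₁ ih₂ =>
    cases P <;> simp [rename] at hP'
    obtain ⟨Q₁, rfl, h₁⟩ := ih₁ hP'.1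
    obtain ⟨Q₂, rfl, h₂⟩ := ih₂ hP'.2
    exact ⟨_, rfl, .par h₁ h₂⟩
  | res _ _ ih₁ ih₂ =>
    cases P <;> simp [rename] at hP'
    obtain ⟨Q₁, rfl, h₁⟩ := ih₁ hP'.1
    obtain ⟨Q₂, rfl, h₂⟩ := ih₂ hP'.2
    exact ⟨_, rfl, .res h₁ h₂⟩
  | nd _ _ ih₁ ih₂ =>
    cases P <;> simp [rename] at hP'
    obtain ⟨Q₁, rfl, h₁⟩ := ih₁ hP'.1
    obtain ⟨Q₂, rfl, h₂⟩ := ih₂ hP'.2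
    exact ⟨_, rfl, .nd h₁ h₂⟩

end Proc

-- Free variables and sizes under renaming of terms

theorem mem_lower {k i : ℕ} {S : Finset ℕ} : i ∈ lower k S ↔ i + k ∈ S := by
  simp only [lower, Finset.mem_image, Finset.mem_filter]
  constructor
  · rintro ⟨a, ⟨ha, hk⟩, rfl⟩
    rwa [Nat.sub_add_cancel hk]
  · exact fun h => ⟨i + k, ⟨h, by omega⟩, by omega⟩

theorem lower_image_up (k : ℕ) (g : ℕ → ℕ) (S : Finset ℕ) :
    lower k (S.image (up k g)) = (lower k S).image g := by
  ext i
  simp only [mem_lower, Finset.mem_image]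
  constructor
  · rintro ⟨a, ha, h⟩
    by_cases hk : a < k
    · rw [up_lt _ hk] at h; omega
    · obtain ⟨b, rfl⟩ := Nat.exists_eq_add_of_le' (not_lt.1 hk)
      rw [up_add] at h
      exact ⟨b, ha, by omega⟩
  · rintro ⟨b, hb, rfl⟩
    exact ⟨b + k, hb, by simp⟩

mutual
theorem Tm.rename_id : ∀ M : Tm, M.rename id = M
  | .var _ => rfl
  | .uvar _ _ => rfl
  | .abs M => by simp [Tm.rename, Tm.rename_id M]
  | .app M C U => by simp [Tm.rename, Tm.rename_id M, LBag.rename_id C, UBag.rename_id U]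
  | .fail _ => by simp [Tm.rename]
  | .share _ _ M => by simp [Tm.rename, Tm.rename_id M]
  | .esub M C U => by simp [Tm.rename, Tm.rename_id M, LBag.rename_id C, UBag.rename_id U]
  | .lsub _ M C => by simp [Tm.rename, Tm.rename_id M, LBag.rename_id C]
  | .usub M U => by simp [Tm.rename, Tm.rename_id M, UBag.rename_id U]
theorem LBag.rename_id : ∀ C : LBag, C.rename id = C
  | .one => rfl
  | .cons M C => by simp [LBag.rename, Tm.rename_id M, LBag.rename_id C]
theorem UBag.rename_id : ∀ U : UBag, U.rename id = U
  | .one => rfl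
  | .single M => by simp [UBag.rename, Tm.rename_id M]
  | .cat U V => by simp [UBag.rename, UBag.rename_id U, UBag.rename_id V]
end

mutual
theorem Tm.fv_rename : ∀ (g : ℕ → ℕ) (M : Tm) (r : Role), (M.rename g).fv r = (M.fv r).image g
  | _, .var _, r => by by_cases h : r = .lin <;> simp [Tm.rename, Tm.fv, h]
  | _, .uvar _ _, r => by by_cases h : r = .un <;> simp [Tm.rename, Tm.fv, h]
  | g, .abs M, r => by simp [Tm.rename, Tm.fv, Tm.fv_rename _ M, lower_image_up]
  | g, .app M C U, r => by
    simp [Tm.rename, Tm.fv, Tm.fv_rename g M, LBag.fv_rename g C, UBag.fv_rename g U,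
      Finset.image_union]
  | _, .fail xs, r => by
    by_cases h : r = .lin
    · simp only [Tm.rename, Tm.fv, h, if_true]
      ext
      simp
    · simp [Tm.rename, Tm.fv, h]
  | g, .share k x M, r => by
    by_cases h : r = .shr <;>
      simp [Tm.rename, Tm.fv, Tm.fv_rename _ M, lower_image_up, h, Finset.image_insert]
  | g, .esub M C U, r => by
    simp [Tm.rename, Tm.fv, Tm.fv_rename _ M, LBag.fv_rename g C, UBag.fv_rename g U,
      Finset.image_union, lower_image_up]
  | g, .lsub k M C, r => by
    simp [Tm.rename, Tm.fv, Tm.fv_rename _ M, LBag.fv_rename g C, Finset.image_union,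
      lower_image_up]
  | g, .usub M U, r => by
    simp [Tm.rename, Tm.fv, Tm.fv_rename _ M, UBag.fv_rename g U, Finset.image_union,
      lower_image_up]
theorem LBag.fv_rename :
    ∀ (g : ℕ → ℕ) (C : LBag) (r : Role), (C.rename g).fv r = (C.fv r).image g
  | _, .one, _ => rfl
  | g, .cons M C, r => by
    simp [LBag.rename, LBag.fv, Tm.fv_rename g M, LBag.fv_rename g C, Finset.image_union]
theorem UBag.fv_rename :
    ∀ (g : ℕ → ℕ) (U : UBag) (r : Role), (U.rename g).fv r = (U.fv r).image g
  | _, .one, _ => rfl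
  | g, .single M, r => by simp [UBag.rename, UBag.fv, Tm.fv_rename g M]
  | g, .cat U V, r => by
    simp [UBag.rename, UBag.fv, UBag.fv_rename g U, UBag.fv_rename g V, Finset.image_union]
end

@[simp] theorem LBag.size_rename (g : ℕ → ℕ) : ∀ C : LBag, (C.rename g).size = C.size
  | .one => rfl
  | .cons M C => by simp [LBag.rename, LBag.size, LBag.size_rename g C]

theorem LBag.length_trs : ∀ C : LBag, C.trs.length = C.size
  | .one => rfl
  | .cons M C => by simp [LBag.trs, LBag.size, C.length_trs]

theorem UBag.length_trs : ∀ U : UBag, U.trs.length = U.positions.length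
  | .one => rfl
  | .single _ => rfl
  | .cat U V => by simp [UBag.trs, UBag.positions, U.length_trs, V.length_trs]

mutual
/-- Every linear substitution has as many elements as it binds variables. -/
def Tm.Sized : Tm → Prop
  | .var _ => True
  | .uvar _ _ => True
  | .abs M => M.Sized
  | .app M C U => M.Sized ∧ C.Sized ∧ U.Sized
  | .fail _ => True
  | .share _ _ M => M.Sized
  | .esub M C U => M.Sized ∧ C.Sized ∧ U.Sized
  | .lsub k M C => C.size = k ∧ M.Sized ∧ C.Sized
  | .usub M U => M.Sized ∧ U.Sized
/-- Every linear substitution has as many elements as it binds variables. -/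
def LBag.Sized : LBag → Prop
  | .one => True
  | .cons M C => M.Sized ∧ C.Sized
/-- Every linear substitution has as many elements as it binds variables. -/
def UBag.Sized : UBag → Prop
  | .one => True
  | .single M => M.Sized
  | .cat U V => U.Sized ∧ V.Sized
end

mutual
theorem Tm.sized_rename : ∀ (g : ℕ → ℕ) (M : Tm), (M.rename g).Sized ↔ M.Sized
  | _, .var _ => Iff.rfl
  | _, .uvar _ _ => Iff.rfl
  | g, .abs M => by simp [Tm.rename, Tm.Sized, Tm.sized_rename _ M]
  | g, .app M C U => by
    simp [Tm.rename, Tm.Sized, Tm.sized_rename _ M, LBag.sized_rename _ C, UBag.sized_rename _ U]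
  | _, .fail _ => Iff.rfl
  | g, .share _ _ M => by simp [Tm.rename, Tm.Sized, Tm.sized_rename _ M]
  | g, .esub M C U => by
    simp [Tm.rename, Tm.Sized, Tm.sized_rename _ M, LBag.sized_rename _ C, UBag.sized_rename _ U]
  | g, .lsub k M C => by
    simp [Tm.rename, Tm.Sized, Tm.sized_rename _ M, LBag.sized_rename _ C]
  | g, .usub M U => by
    simp [Tm.rename, Tm.Sized, Tm.sized_rename _ M, UBag.sized_rename _ U]
theorem LBag.sized_rename : ∀ (g : ℕ → ℕ) (C : LBag), (C.rename g).Sized ↔ C.Sized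
  | _, .one => Iff.rfl
  | g, .cons M C => by simp [LBag.rename, LBag.Sized, Tm.sized_rename _ M, LBag.sized_rename _ C]
theorem UBag.sized_rename : ∀ (g : ℕ → ℕ) (U : UBag), (U.rename g).Sized ↔ U.Sized
  | _, .one => Iff.rfl
  | g, .single M => by simp [UBag.rename, UBag.Sized, Tm.sized_rename _ M]
  | g, .cat U V => by
    simp [UBag.rename, UBag.Sized, UBag.sized_rename _ U, UBag.sized_rename _ V]
end

/-! ### Naturality of the translation -/

@[simp] theorem Env.shift_apply (n : ℕ) (ρ : Env) (r : Role) (i : ℕ) :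
    ρ.shift n r i = ρ r i + n := rfl

@[simp] theorem Env.shift_shift (m n : ℕ) (ρ : Env) : (ρ.shift m).shift n = ρ.shift (m + n) := by
  funext r i; simp [Nat.add_assoc]

@[simp] theorem Env.cons_zero (a : Role → ℕ) (ρ : Env) (r : Role) : ρ.cons a r 0 = a r := rfl

@[simp] theorem Env.cons_succ (a : Role → ℕ) (ρ : Env) (r : Role) (i : ℕ) :
    ρ.cons a r (i + 1) = ρ r i := rfl

theorem Env.consN_lt {k i : ℕ} (g : ℕ → ℕ) (ρ : Env) (r : Role) (h : i < k) :
    ρ.consN k g r i = g i := if_pos h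

@[simp] theorem Env.consN_add (k i : ℕ) (g : ℕ → ℕ) (ρ : Env) (r : Role) :
    ρ.consN k g r (i + k) = ρ r i := by simp [Env.consN]

/-- `ρ'` names the variable `g i` by the `f`-image of the name that `ρ` gives to `i`, for the
variables `i` in `F`. -/
def Env.Rel (f g : ℕ → ℕ) (F : Role → Finset ℕ) (ρ ρ' : Env) : Prop :=
  ∀ r, ∀ i ∈ F r, ρ' r (g i) = f (ρ r i)

theorem Env.Rel.mono {f g : ℕ → ℕ} {F F' : Role → Finset ℕ} {ρ ρ' : Env}
    (h : Env.Rel f g F ρ ρ') (hF : ∀ r, F' r ⊆ F r) : Env.Rel f g F' ρ ρ' :=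
  fun r i hi => h r i (hF r hi)

theorem Env.Rel.shift {f g : ℕ → ℕ} {F : Role → Finset ℕ} {ρ ρ' : Env}
    (h : Env.Rel f g F ρ ρ') (n : ℕ) : Env.Rel (up n f) g F (ρ.shift n) (ρ'.shift n) :=
  fun r i hi => by simp [h r i hi]

theorem Env.Rel.cons {f g : ℕ → ℕ} {F : Role → Finset ℕ} {ρ ρ' : Env} {a a' : Role → ℕ}
    (h : Env.Rel f g (fun r => lower 1 (F r)) ρ ρ') (ha : ∀ r, a' r = f (a r)) :
    Env.Rel f (up 1 g) F (ρ.cons a) (ρ'.cons a') := by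
  rintro r (_ | i) hi
  · exact ha r
  · simpa using h r i (mem_lower.2 hi)

theorem Env.Rel.consN {f g : ℕ → ℕ} {F : Role → Finset ℕ} {ρ ρ' : Env} {k : ℕ} {a a' : ℕ → ℕ}
    (h : Env.Rel f g (fun r => lower k (F r)) ρ ρ') (ha : ∀ i < k, a' i = f (a i)) :
    Env.Rel f (up k g) F (ρ.consN k a) (ρ'.consN k a') := by
  intro r i hi
  by_cases hk : i < k
  · rw [up_lt _ hk, Env.consN_lt _ _ _ hk, Env.consN_lt _ _ _ hk, ha i hk]
  · obtain ⟨j, rfl⟩ := Nat.exists_eq_add_of_le' (not_lt.1 hk)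
    simpa using h r j (mem_lower.2 hi)

theorem Env.Rel.names {f g : ℕ → ℕ} {F F' : Role → Finset ℕ} {ρ ρ' : Env}
    (h : Env.Rel f g F ρ ρ') (hF : ∀ r, F' r = (F r).image g) :
    ρ'.names F' = (ρ.names F).image f := by
  unfold Env.names
  rw [hF, hF, Finset.image_union, Finset.image_image, Finset.image_image, Finset.image_image,
    Finset.image_image]
  exact congrArg₂ _ (Finset.image_congr (h .lin)) (Finset.image_congr (h .shr))

namespace Proc

/-- The branch on `x` that offers the processes of a list, under the labels `1, 2, …`. -/
def branches (x : ℕ) (ps : List Proc) : Proc :=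
  .bra x (Finset.Icc 1 ps.length) (fun i => ps.getD (i.1 - 1) .nil)

/-- The branches are indexed by a subtype of the label set, so equality of label sets has to be
substituted before the families can be compared. -/
theorem bra_congr_set {x : ℕ} {I J : Finset ℕ} (h : I = J) {P : {i // i ∈ I} → Proc}
    {Q : {i // i ∈ J} → Proc} (hPQ : ∀ i hI hJ, P ⟨i, hI⟩ = Q ⟨i, hJ⟩) :
    bra x I P = bra x J Q := by
  subst h
  congr 1
  funext i
  exact hPQ i.1 i.2 i.2

theorem positions_eq (l : List (Env → ℕ → Proc)) (ρ : Env) (x : ℕ) :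
    positions l ρ x = branches x (l.map fun Z => Z ρ x) := by
  refine bra_congr_set (by simp) fun i _ _ => ?_
  simp only [List.getD_eq_getElem?_getD, List.getElem?_map]
  cases l[i - 1]? <;> rfl

theorem rename_branches (f : ℕ → ℕ) (x : ℕ) (ps : List Proc) :
    rename f (branches x ps) = branches (f x) (ps.map (rename f)) := by
  refine bra_congr_set (by simp) fun i _ _ => ?_
  simp only [List.getD_eq_getElem?_getD, List.getElem?_map]
  cases ps[i - 1]? <;> rfl

/-- Naturality of a family of processes with the free variables `F`, against that of the family
with the variables renamed by `g`. -/
def Natural (g : ℕ → ℕ) (F : Role → Finset ℕ) (t t' : Env → ℕ → Proc) : Prop :=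
  ∀ (f : ℕ → ℕ) (ρ ρ' : Env) (u : ℕ), Env.Rel f g F ρ ρ' → t' ρ' (f u) = rename f (t ρ u)

theorem Natural.eq {g f : ℕ → ℕ} {F : Role → Finset ℕ} {t t' : Env → ℕ → Proc}
    (h : Natural g F t t') {ρ ρ' : Env} (u : ℕ) {v : ℕ} (hρ : Env.Rel f g F ρ ρ') (hv : v = f u) :
    t' ρ' v = rename f (t ρ u) := hv ▸ h f ρ ρ' u hρ

/-- The environments need to agree only outside `xs`: the names of the variables still to be
received are overwritten on reception. -/
theorem share_natural {F F' : Role → Finset ℕ} {body body' : Env → ℕ → Proc} {k : ℕ}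
    {g : ℕ → ℕ} (hF : ∀ r, F' r = (F r).image (up k g)) (hb : Natural (up k g) F body body') :
    ∀ (n : ℕ) (xs : List ℕ), xs.length = n → (∀ i ∈ xs, i < k) →
      ∀ (f : ℕ → ℕ) (ρ ρ' : Env) (x u : ℕ),
        Env.Rel f (up k g) (fun r => F r \ xs.toFinset) ρ ρ' →
        share F' body' n xs ρ' (f x) (f u) = rename f (share F body n xs ρ x u)
  | 0, xs, hn, hk, f, ρ, ρ', x, u, hρ => by
    obtain rfl := List.length_eq_zero_iff.1 hn
    have hρ : Env.Rel f (up k g) F ρ ρ' := hρ.mono (by simp)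
    simp only [share, rename]
    rw [(hρ.shift 1).names hF, hb.eq (u + 1) (hρ.shift 1) (by simp), Finset.image_insert]
    simp
  | n + 1, xs, hn, hk, f, ρ, ρ', x, u, hρ => by
    simp only [share, rename, up_one_zero, Finset.image_empty, rename_bigNd, List.map_map]
    -- The shared variables lie below `k`, where `up k g` is the identity, and no index from `k` on
    -- is sent below `k`.
    have hmem : ∀ a, up k g a ∈ xs ↔ a ∈ xs := by
      intro a
      by_cases ha : a < k
      · rw [up_lt _ ha]
      · have h1 : a ∉ xs := fun h => ha (hk a h)
        have h2 : up k g a ∉ xs := fun h => by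
          have := hk _ h
          obtain ⟨b, rfl⟩ := Nat.exists_eq_add_of_le' (not_lt.1 ha)
          simp at this
        simp [h1, h2]
    have hF' : ∀ r, F' r \ xs.toFinset = (F r \ xs.toFinset).image (up k g) := by
      intro r
      ext a
      simp only [hF, Finset.mem_sdiff, Finset.mem_image, List.mem_toFinset]
      constructor
      · rintro ⟨⟨b, hb, rfl⟩, h⟩
        exact ⟨b, ⟨hb, fun hb' => h ((hmem b).2 hb')⟩, rfl⟩
      · rintro ⟨b, ⟨hb, h⟩, rfl⟩
        exact ⟨⟨b, hb, rfl⟩, fun hb' => h ((hmem b).1 hb')⟩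
    rw [hρ.names hF', Finset.image_insert]
    congr 5
    refine List.map_congr_left fun i hi => ?_
    simp only [Function.comp_apply, rename]
    rw [← share_natural hF hb n (xs.erase i) (by rw [List.length_erase_of_mem hi, hn]; rfl)
      (fun j hj => hk j (List.mem_of_mem_erase hj)) (up 1 f) ((ρ.shift 1).set i 0)
      ((ρ'.shift 1).set i 0) (x + 1) (u + 1)]
    · simp
    · intro r a ha
      simp only [Finset.mem_sdiff, List.mem_toFinset] at ha
      by_cases hai : a = i
      · subst hai
        simp [Env.set, up_lt _ (hk _ hi)]
      · have hax : a ∉ xs := fun h => ha.2 ((List.mem_erase_of_ne hai).2 h)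
        have : up k g a ≠ i := fun h => hax ((hmem a).1 (h ▸ hi))
        simp [Env.set, this, hai, hρ r a (by simp [ha.1, hax])]

theorem bag_natural {F F' : Role → Finset ℕ} {tC tC' : Env → ℕ → Proc}
    {tU tU' : List (Env → ℕ → Proc)} {f g : ℕ → ℕ} {ρ ρ' : Env} (x : ℕ)
    (hρ : Env.Rel f g F ρ ρ') (hF : ∀ r, F' r = (F r).image g) (hC : Natural g F tC tC')
    (hU : tU'.map (fun Z => Z (ρ'.shift 2) 0) =
      (tU.map fun Z => Z (ρ.shift 2) 0).map (rename (up 2 f))) :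
    bag F' tC' tU' ρ' (f x) = rename f (bag F tC tU ρ x) := by
  simp only [bag, rename, hρ.names hF, positions_eq, hU, up_one_zero, up_up, rename_branches,
    Nat.reduceAdd, up_lt f (by norm_num : 0 < 2)]
  rw [hC.eq 0 (hρ.shift 1) (by simp)]

end Proc

open Proc in
mutual
theorem Tm.tr_natural : ∀ (g : ℕ → ℕ) (M : Tm), M.Sized → Natural g M.fv M.tr (M.rename g).tr
  | g, .var x, _ => fun f ρ ρ' u h => by
    have := h .lin x (by simp [Tm.fv])
    simp [Tm.tr, Tm.rename, Proc.rename, this]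
  | g, .uvar x j, _ => fun f ρ ρ' u h => by
    have := h .un x (by simp [Tm.fv])
    simp [Tm.tr, Tm.rename, Proc.rename, this]
  | g, .abs M, hs => fun f ρ ρ' u h => by
    simp only [Tm.tr, Tm.rename, Proc.rename, up_one_zero, up_up, Nat.reduceAdd]
    rw [(Tm.tr_natural (up 1 g) M hs).eq (u + 3)
      (Env.Rel.cons (h.shift 3) (a := bagNames) (a' := bagNames) (by rintro (_ | _ | _) <;> rfl))
      (up_add 3 u f).symm]
    rfl
  | g, .app M C U, ⟨hsM, hsC, hsU⟩ => fun f ρ ρ' u h => by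
    have hM : Env.Rel f g M.fv ρ ρ' := h.mono fun r => by
      simp only [Tm.fv, Finset.union_assoc]; exact Finset.subset_union_left
    have hC : Env.Rel f g C.fv ρ ρ' := h.mono fun r => by
      simp only [Tm.fv]; exact Finset.subset_union_right.trans Finset.subset_union_left
    have hU : Env.Rel f g U.fv ρ ρ' := h.mono fun r => by
      simp only [Tm.fv]; exact Finset.subset_union_right
    simp only [Tm.tr, Tm.rename, Proc.rename, up_one_zero, up_up, Nat.reduceAdd, up_one_succ]
    rw [(Tm.tr_natural g M hsM).eq 0 (hM.shift 1) (up_one_zero f).symm,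
      (hC.shift 1).names (LBag.fv_rename g C), Finset.image_insert, up_one_succ,
      ← bag_natural 0 (hC.shift 2) (LBag.fv_rename g C) (LBag.tr_natural g C hsC)
        (UBag.trs_natural g U _ _ _ 0 hsU ((hU.shift 2).shift 2) (by simp [up]))]
    rfl
  | g, .fail xs, _ => fun f ρ ρ' u h => by
    simp only [Tm.tr, Tm.rename, Proc.rename, rename_nones, List.map_map]
    congr 2
    exact List.map_congr_left fun x hx => h .lin x (by simpa [Tm.fv] using hx)
  | g, .share k x M, hs => fun f ρ ρ' u h => by
    have hx := h .shr x (by simp [Tm.fv])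
    have hM : Env.Rel f g (fun r => lower k (M.fv r)) ρ ρ' := h.mono fun r => by
      simp only [Tm.fv]; exact Finset.subset_union_left
    simp only [Tm.tr, Tm.rename, hx]
    refine share_natural (Tm.fv_rename _ M) (Tm.tr_natural _ M hs) k _ (by simp) (by simp) f _ _ _ _
      ((hM.consN (by simp)).mono fun r => Finset.sdiff_subset)
  | g, .esub M C U, ⟨hsM, hsC, hsU⟩ => fun f ρ ρ' u h => by
    have hM : Env.Rel f g (fun r => lower 1 (M.fv r)) ρ ρ' := h.mono fun r => by
      simp only [Tm.fv, Finset.union_assoc]; exact Finset.subset_union_left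
    have hC : Env.Rel f g C.fv ρ ρ' := h.mono fun r => by
      simp only [Tm.fv]; exact Finset.subset_union_right.trans Finset.subset_union_left
    have hU : Env.Rel f g U.fv ρ ρ' := h.mono fun r => by
      simp only [Tm.fv]; exact Finset.subset_union_right
    simp only [Tm.tr, Tm.rename, Proc.rename, up_one_zero, up_up, Nat.reduceAdd]
    rw [(Tm.tr_natural (up 1 g) M hsM).eq (u + 3)
      (Env.Rel.cons (hM.shift 3) (a := bagNames) (a' := bagNames) (by rintro (_ | _ | _) <;> rfl))
      (up_add 3 u f).symm,
      ← bag_natural 0 (hC.shift 1) (LBag.fv_rename g C) (LBag.tr_natural g C hsC)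
        (UBag.trs_natural g U _ _ _ 0 hsU ((hU.shift 1).shift 2) (by simp [up]))]
    rfl
  | g, .lsub k M C, ⟨hk, hsM, hsC⟩ => fun f ρ ρ' u h => by
    have hM : Env.Rel f g (fun r => lower k (M.fv r)) ρ ρ' := h.mono fun r => by
      simp only [Tm.fv]; exact Finset.subset_union_left
    have hC : Env.Rel f g C.fv ρ ρ' := h.mono fun r => by
      simp only [Tm.fv]; exact Finset.subset_union_right
    simp only [Tm.tr, Tm.rename, LBag.size_rename]
    rw [← LBag.chain_natural g C f ρ ρ' _ hsC hC, rename_bigNd, List.map_map]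
    congr 2
    refine List.map_congr_left fun p hp => ?_
    exact (Tm.tr_natural (up k g) M hsM).eq (u + C.size)
      ((hM.shift C.size).consN fun i hi => by
        -- The name `C.size - 1 - p.idxOf i` lies below `C.size`, so `up C.size f` fixes it; here
        -- `C.size = k > i` is used.
        rw [List.mem_permutations'] at hp
        have : p.idxOf i < p.length := List.idxOf_lt_length_of_mem (hp.mem_iff.2 (by simpa))
        have : p.length = k := by simpa using hp.length_eq
        rw [up_lt]; omega) (up_add _ _ _).symm
  | g, .usub M U, ⟨hsM, hsU⟩ => fun f ρ ρ' u h => by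
    have hM : Env.Rel f g (fun r => lower 1 (M.fv r)) ρ ρ' := h.mono fun r => by
      simp only [Tm.fv]; exact Finset.subset_union_left
    have hU : Env.Rel f g U.fv ρ ρ' := h.mono fun r => by
      simp only [Tm.fv]; exact Finset.subset_union_right
    simp only [Tm.tr, Tm.rename, Proc.rename, up_one_zero, up_up, Nat.reduceAdd]
    rw [(Tm.tr_natural (up 1 g) M hsM).eq (u + 1)
      (Env.Rel.cons (hM.shift 1) (a := fun _ => 0) (a' := fun _ => 0) (by simp))
      (up_add 1 u f).symm,
      positions_eq, positions_eq, UBag.trs_natural g U _ _ _ 0 hsU (hU.shift 2) (by simp [up]),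
      rename_branches, up_lt f (by norm_num : 0 < 2)]
theorem LBag.tr_natural : ∀ (g : ℕ → ℕ) (C : LBag), C.Sized → Natural g C.fv C.tr (C.rename g).tr
  | g, .one, _ => fun f ρ ρ' u h => by
    simp [LBag.tr, LBag.rename, Proc.rename]
  | g, .cons M C, ⟨hsM, hsC⟩ => fun f ρ ρ' u h => by
    have hM : Env.Rel f g M.fv ρ ρ' := h.mono fun r => by
      simp only [LBag.fv]; exact Finset.subset_union_left
    have hC : Env.Rel f g C.fv ρ ρ' := h.mono fun r => by
      simp only [LBag.fv]; exact Finset.subset_union_right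
    have hF : ∀ r, (fun r => (M.rename g).fv r ∪ (C.rename g).fv r) r
        = ((fun r => M.fv r ∪ C.fv r) r).image g := fun r => by
      simp [Tm.fv_rename, LBag.fv_rename, Finset.image_union]
    have h' : Env.Rel f g (fun r => M.fv r ∪ C.fv r) ρ ρ' := h
    simp only [LBag.tr, LBag.rename, Proc.rename, up_one_zero, up_up, Nat.reduceAdd, up_one_succ]
    rw [h'.names hF, (h'.shift 1).names hF, (hM.shift 2).names (Tm.fv_rename g M),
      (Tm.tr_natural g M hsM).eq 0 (hM.shift 2) (by simp [up]),
      (LBag.tr_natural g C hsC).eq (u + 1) (hC.shift 1) (up_one_succ f u).symm,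
      Finset.image_insert]
    rfl
theorem LBag.chain_natural : ∀ (g : ℕ → ℕ) (C : LBag) (f : ℕ → ℕ) (ρ ρ' : Env) (P : Proc),
    C.Sized → Env.Rel f g C.fv ρ ρ' →
    Proc.chain (C.rename g).trs ρ' (P.rename (up C.size f)) = (Proc.chain C.trs ρ P).rename f
  | g, .one, f, ρ, ρ', P, _, h => by simp [LBag.rename, LBag.trs, Proc.chain, LBag.size]
  | g, .cons M C, f, ρ, ρ', P, ⟨hsM, hsC⟩, h => by
    have hM : Env.Rel f g M.fv ρ ρ' := h.mono fun r => by
      simp only [LBag.fv]; exact Finset.subset_union_left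
    have hC : Env.Rel f g C.fv ρ ρ' := h.mono fun r => by
      simp only [LBag.fv]; exact Finset.subset_union_right
    simp only [LBag.rename, LBag.trs, Proc.chain, LBag.size, Proc.rename, up_one_zero]
    rw [(hM.shift 1).names (Tm.fv_rename g M), (Tm.tr_natural g M hsM).eq 0 (hM.shift 1) (by simp [up]),
      ← LBag.chain_natural g C (up 1 f) _ _ P hsC (hC.shift 1), up_up]
theorem UBag.trs_natural : ∀ (g : ℕ → ℕ) (U : UBag) (f : ℕ → ℕ) (ρ ρ' : Env) (x : ℕ) {x' : ℕ},
    U.Sized → Env.Rel f g U.fv ρ ρ' → x' = f x →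
    (U.rename g).trs.map (fun Z => Z ρ' x') = (U.trs.map fun Z => Z ρ x).map (rename f)
  | g, .one, f, ρ, ρ', x, _, _, h, hx => by simp [UBag.rename, UBag.trs, Proc.rename, hx]
  | g, .single M, f, ρ, ρ', x, _, hsM, h, hx => by
    have h : Env.Rel f g M.fv ρ ρ' := h
    simp [UBag.rename, UBag.trs, (Tm.tr_natural g M hsM).eq x h hx]
  | g, .cat U V, f, ρ, ρ', x, _, ⟨hsU, hsV⟩, h, hx => by
    have hU : Env.Rel f g U.fv ρ ρ' := h.mono fun r => by
      simp only [UBag.fv]; exact Finset.subset_union_left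
    have hV : Env.Rel f g V.fv ρ ρ' := h.mono fun r => by
      simp only [UBag.fv]; exact Finset.subset_union_right
    simp only [UBag.rename, UBag.trs, List.map_append]
    rw [UBag.trs_natural g U f ρ ρ' x hsU hU hx, UBag.trs_natural g V f ρ ρ' x hsV hV hx]
end

namespace Proc

/-! ### Reductions at the hole -/

theorem rename_eq_self {f : ℕ → ℕ} (h : ∀ i, f i = i) (P : Proc) : rename f P = P := by
  rw [show f = id from funext h, rename_id]

theorem red_psome_gsome (ws : Finset ℕ) (P Q : Proc) :
    Red (res (psome 0 P) (gsome 0 ws Q)) (res P Q) :=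
  Red.some .hole .hole ws P Q

theorem red_close_wait (Q : Proc) : Red (res (close 0) (wait 0 (rename Nat.succ Q))) (par nil Q) := by
  have := Red.close .hole .hole .hole .hole Q rfl rfl
  simpa [NCtx.fill, NCtx.depth] using this

theorem red_out_nd_inp {P Q R : Proc} (S : Proc) :
    Red (res (out 0 P Q) (nd (inp 0 R) S)) (res Q (res P R)) := by
  have := Red.comm .hole .hole (.nd .hole S) P Q R rfl
  simp only [NCtx.fill, NCtx.depth, NCtx.commit, NCtx.rename, rot_zero, up_id, rename_id] at this
  rwa [rename_eq_self (P := R)] at this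
  rintro (_ | _ | i) <;> rfl

theorem red_fwd (y : ℕ) (Q : Proc) : Red (res (fwd 0 (y + 1)) Q) (rename (scons y id) Q) := by
  have := Red.id .hole .hole y Q rfl
  simp only [NCtx.fill, NCtx.depth, up_zero] at this
  exact this

theorem red_pnone_gsome (K : Proc) (ws : List ℕ) (hws : ws.Nodup) (Q : Proc) :
    Red (Proc.res (Proc.par (pnone 0) (rename Nat.succ K)) (gsome 0 (ws.toFinset.image Nat.succ) Q))
      (Proc.par (Proc.par nil K) (nones ws)) := by
  have := Red.none (.par .hole (rename Nat.succ K)) (.par .hole K) .hole .hole ws Q hws rfl rfl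
  simpa [NCtx.fill, NCtx.depth] using this

/-- After an output, `P` implements the new name and does not mention the session name. Scope
extrusion therefore moves the session inwards, between the two continuations, and leaves `P` outside
as the partner of the new name. -/
theorem res_rotate (P Q R : Proc) :
    SC (res Q (res (rename (up 1 Nat.succ) P) R))
      (res (res (rename swap01 R) (rename (up 1 Nat.succ) Q)) P) :=
  (SC.res_comm _ _).trans
    ((SC.res_congr (SC.res_comm _ _) (SC.refl _)).trans (SC.res_res _ _ _))

theorem reds_out_bigNd {P Q R : Proc} {l : List Proc} (h : inp 0 R ∈ l) :
    Reds (res (out 0 (rename (up 1 Nat.succ) P) Q) (bigNd l))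
      (res (res (rename swap01 R) (rename (up 1 Nat.succ) Q)) P) :=
  ((SC.res_congr (SC.refl _) (SC.bigNd_mem h)).reds.trans (red_out_nd_inp _).reds).trans
    (res_rotate P Q R).reds

theorem reds_out_inp (P Q R : Proc) :
    Reds (res (out 0 (rename (up 1 Nat.succ) P) Q) (inp 0 R))
      (res (res (rename swap01 R) (rename (up 1 Nat.succ) Q)) P) :=
  reds_out_bigNd (l := [inp 0 R]) (by simp)

theorem reds_gsome_psome (ws : Finset ℕ) (P Q : Proc) :
    Reds (res (gsome 0 ws P) (psome 0 Q)) (res P Q) :=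
  ((SC.res_comm _ _).reds.trans (red_psome_gsome ws Q P).reds).trans (SC.res_comm _ _).reds

theorem reds_inp_out (P Q R : Proc) :
    Reds (res (inp 0 R) (out 0 (rename (up 1 Nat.succ) P) Q))
      (res (res (rename swap01 R) (rename (up 1 Nat.succ) Q)) P) :=
  (SC.res_comm _ _).reds.trans (reds_out_inp P Q R)

theorem reds_close_wait (Q : Proc) : Reds (res (close 0) (wait 0 (rename Nat.succ Q))) Q :=
  (red_close_wait Q).reds.trans (SC.nil_par Q).reds

/-! ### Processes that reduce to unavailable names -/

/-- The process `P` reduces to the parallel composition of `w.none` for the names `w` in `S`. -/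
def NonesTo (P : Proc) (S : Finset ℕ) : Prop :=
  ∃ L : List ℕ, L.Nodup ∧ L.toFinset = S ∧ Reds P (nones L)

theorem NonesTo.of_reds {P Q : Proc} {S : Finset ℕ} (h : Reds P Q) : NonesTo Q S → NonesTo P S
  | ⟨L, hL, hS, hQ⟩ => ⟨L, hL, hS, h.trans hQ⟩

theorem NonesTo.reds {P : Proc} {L : List ℕ} (h : NonesTo P L.toFinset) (hL : L.Nodup) :
    Reds P (nones L) := by
  obtain ⟨L', hL', hS, hP⟩ := h
  exact hP.trans (SC.nones_perm (List.perm_of_nodup_nodup_toFinset_eq hL' hL hS)).reds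

theorem NonesTo.nones {L : List ℕ} (hL : L.Nodup) : NonesTo (nones L) L.toFinset :=
  ⟨L, hL, rfl, Reds.refl _⟩

theorem NonesTo.pnone (x : ℕ) : NonesTo (pnone x) {x} :=
  ⟨[x], by simp, by simp, (SC.par_nil _).symm.reds⟩

/-- The message `0.none` of `P` discards `Q` and releases the names in `ws`. Disjointness keeps the
resulting enumeration free of repetitions. -/
theorem NonesTo.kill {P : Proc} {S ws : Finset ℕ} (h : NonesTo P (insert 0 (S.image Nat.succ)))
    (hd : Disjoint S ws) (Q : Proc) :
    NonesTo (Proc.res P (gsome 0 (ws.image Nat.succ) Q)) (S ∪ ws) := by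
  have hP : Reds P (Proc.nones (0 :: S.toList.map Nat.succ)) := by
    refine NonesTo.reds ?_ ?_
    · convert h using 1
      ext a
      simp
    · simp [Finset.nodup_toList, List.nodup_map_iff Nat.succ_injective]
  refine ⟨S.toList ++ ws.toList, ?_, by ext; simp, ?_⟩
  · refine List.Nodup.append S.nodup_toList ws.nodup_toList ?_
    intro a ha hb
    exact Finset.disjoint_left.1 hd (by simpa using ha) (by simpa using hb)
  · refine (hP.res_left _).trans ?_
    have := red_pnone_gsome (Proc.nones S.toList) ws.toList ws.nodup_toList Q
    rw [Finset.toList_toFinset, rename_nones] at this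
    refine this.reds.trans ?_
    exact ((SC.par_congr (SC.nil_par _) (SC.refl _)).trans (SC.nones_append _ _).symm).reds

/-! ### The protocol between linear bags and sharing -/

/-- The receiver obtains the linear name, the unrestricted name and the closing signal, in this
order. The hypothesis on `B` states that the session name, index 2, is not used in it; `B'` is the
same process with the linear name innermost and the unrestricted name next. -/
theorem bag_open {B B' tC S : Proc} (ws : Finset ℕ)
    (hB : B = rename (scons 1 (scons 0 (fun i => i + 3))) B') :
    Reds
      (res (psome 0 (inp 0 (inp 1 (wait 2 B))))
        (gsome 0 ws (out 0 (rename (up 1 Nat.succ) tC)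
          (out 0 (rename (up 1 Nat.succ) S) (close 0)))))
      (res (res (rename (up 1 Nat.succ) tC) B') S) := by
  refine (red_psome_gsome _ _ _).reds.trans ((reds_inp_out _ _ _).trans ?_)
  have h1 : rename (up 1 Nat.succ) (out 0 (rename (up 1 Nat.succ) S) (close 0))
      = out 0 (rename (up 1 Nat.succ) (rename (up 1 Nat.succ) S)) (close 0) := by
    simp only [rename, rename_rename, up_comp, up_one_zero]
    rfl
  have h2 : rename swap01 (inp 1 (wait 2 B)) = inp 0 (wait 1 (rename (up 1 swap01) B)) := rfl
  have h3 : rename swap01 (wait 1 (rename (up 1 swap01) B))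
      = wait 0 (rename Nat.succ (rename swap01 B')) := by
    subst hB
    simp only [rename, rename_rename]
    congr 2
    funext i
    rcases i with _ | _ | i <;> rfl
  rw [h1, h2]
  refine ((reds_inp_out _ _ _).res_left _).trans ?_
  rw [h3]
  refine ((((SC.res_comm _ _).reds.trans (reds_close_wait _)).res_left _).res_left _).trans ?_
  refine (SC.res_res _ _ _).reds.trans ?_
  rw [rename_rename, rename_eq_self (P := B') (by rintro (_ | _ | i) <;> rfl)]
  exact (SC.res_congr (SC.res_comm _ _) (SC.refl _)).reds

/-- One round of the protocol: an auxiliary name is exchanged, the element `Z` becomes reachable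
under a new name, and the chosen summand `R` goes on with the rest `C` of the bag. -/
theorem share_step {Z C R : Proc} {l : List Proc} (ws₁ ws₂ ws₃ : Finset ℕ) (hR : inp 0 R ∈ l) :
    Reds
      (res
        (gsome 0 ws₁ (inp 0 (gsome 1 ws₂ (psome 1 (out 1 (rename (up 1 (fun i => i + 2)) Z)
          (par (rename Nat.succ C) (pnone 0)))))))
        (psome 0 (out 0 (gsome 0 ∅ (wait 0 nil)) (psome 0 (gsome 0 ws₃ (bigNd l))))))
      (res Z (res (rename (up 1 Nat.succ) C) (rename swap01 R))) := by
  refine (reds_gsome_psome _ _ _).trans ((reds_inp_out (gsome 0 ∅ (wait 0 nil)) _ _).trans ?_)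
  have h1 : rename swap01 (gsome 1 ws₂ (psome 1 (out 1 (rename (up 1 (fun i => i + 2)) Z)
      (par (rename Nat.succ C) (pnone 0))))) = gsome 0 (ws₂.image swap01) (psome 0 (out 0
        (rename (up 1 Nat.succ) (rename (up 1 Nat.succ) Z))
          (par (rename (up 1 Nat.succ) C) (pnone 1)))) := by
    simp only [rename, rename_rename, up_comp]
    congr 5
    funext i
    rcases i with _ | i <;> rfl
  have h2 : rename (up 1 Nat.succ) (psome 0 (gsome 0 ws₃ (bigNd l)))
      = psome 0 (gsome 0 (ws₃.image (up 1 Nat.succ))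
          (bigNd (l.map (rename (up 1 Nat.succ))))) := by
    simp [rename]
  have hR' : inp 0 (rename (up 2 Nat.succ) R) ∈ l.map (rename (up 1 Nat.succ)) :=
    List.mem_map.2 ⟨_, hR, by simp [rename, up_up]⟩
  rw [h1, h2]
  refine (((reds_gsome_psome _ _ _).trans
    ((red_psome_gsome _ _ _).reds.trans (reds_out_bigNd hR'))).res_left _).trans ?_
  set R' := rename swap01 R
  have h3 : rename swap01 (rename (up 2 Nat.succ) R) = rename (up 2 Nat.succ) R' := by
    simp only [R', rename_rename]
    congr 1
    funext i
    rcases i with _ | _ | i <;> rfl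
  have h4 : rename (up 1 Nat.succ) (par (rename (up 1 Nat.succ) C) (pnone 1))
      = par (rename (up 2 Nat.succ) (rename (up 1 Nat.succ) C)) (rename Nat.succ (pnone 1)) := by
    simp only [rename, rename_rename]
    congr 2
    funext i
    rcases i with _ | i <;> rfl
  rw [h3, h4]
  have h5 : SC (res (rename (up 2 Nat.succ) R')
      (par (rename (up 2 Nat.succ) (rename (up 1 Nat.succ) C)) (rename Nat.succ (pnone 1))))
      (par (rename (up 1 Nat.succ) (res (rename (up 1 Nat.succ) C) R'))
        (rename Nat.succ (pnone 0))) := by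
    refine (SC.res_comm _ _).trans ((SC.res_par _ _ _).trans ?_)
    simp only [rename, up_up]
    exact SC.refl _
  have h6 : SC (res (res (rename (up 2 Nat.succ) R')
      (par (rename (up 2 Nat.succ) (rename (up 1 Nat.succ) C)) (rename Nat.succ (pnone 1))))
      (rename (up 1 Nat.succ) Z))
      (par (pnone 0) (rename Nat.succ (res (res (rename (up 1 Nat.succ) C) R') Z))) :=
    (SC.res_congr h5 (SC.refl _)).trans ((SC.res_par _ _ _).trans (SC.par_comm _ _))
  refine (SC.res_congr h6 (SC.refl _)).reds.trans ?_
  -- The auxiliary name is dismissed: its `none` meets an expectation with no dependencies and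
  -- leaves nothing behind.
  have := red_pnone_gsome (res (res (rename (up 1 Nat.succ) C) R') Z) [] List.nodup_nil (wait 0 nil)
  refine this.reds.trans ?_
  exact ((SC.par_nil _).trans ((SC.nil_par _).trans (SC.res_comm _ _))).reds

/-- Bag and variables are exhausted together: `none` on the linear name discards what remains of the
bag, and the auxiliary name is closed, which starts `B`. -/
theorem share_zero_one (B : Proc) (ws : Finset ℕ) :
    Reds
      (res
        (gsome 0 ∅ (inp 0 (par (psome 0 (close 0)) (gsome 1 ∅ (pnone 1)))))
        (psome 0 (out 0 (gsome 0 (ws.image (up 1 Nat.succ)) (wait 0 (rename (fun i => i + 2) B)))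
          (pnone 0))))
      B := by
  have h1 : gsome 0 (ws.image (up 1 Nat.succ)) (wait 0 (rename (fun i => i + 2) B))
      = rename (up 1 Nat.succ) (gsome 0 ws (wait 0 (rename Nat.succ B))) := by
    simp only [rename, rename_rename]
    rfl
  rw [h1]
  refine (reds_gsome_psome _ _ _).trans ((reds_inp_out _ _ _).trans ?_)
  have h2 : Reds (res (rename swap01 (par (psome 0 (close 0)) (gsome 1 ∅ (pnone 1))))
      (rename (up 1 Nat.succ) (pnone 0))) (psome 0 (close 0)) := by
    have h3 : SC (res (rename swap01 (par (psome 0 (close 0)) (gsome 1 ∅ (pnone 1))))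
      (rename (up 1 Nat.succ) (pnone 0)))
      (par (res (par (pnone 0) (rename Nat.succ nil)) (gsome 0 ∅ (pnone 0)))
        (psome 0 (close 0))) := by
      refine SC.trans (SC.res_congr (SC.par_comm _ _) (SC.refl _))
        ((SC.res_par (gsome 0 ∅ (pnone 0)) (psome 0 (close 0)) (pnone 0)).trans ?_)
      exact SC.par_congr ((SC.res_comm _ _).trans
        (SC.res_congr (SC.par_nil _).symm (SC.refl _))) (SC.refl _)
    refine h3.reds.trans ?_
    refine (Red.par _ (red_pnone_gsome nil [] List.nodup_nil (pnone 0))).reds.trans ?_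
    exact ((SC.par_congr ((SC.par_nil _).trans (SC.par_nil _)) (SC.refl _)).trans
      (SC.nil_par _)).reds
  exact (h2.res_left _).trans ((red_psome_gsome _ _ _).reds.trans (reds_close_wait B))

/-- The bag is exhausted first. It answers the request for one more element with `none` on the
linear name, which discards the sharing construct and releases `ws`; the auxiliary session just
closes. -/
theorem share_succ_one (X : Proc) (ws : Finset ℕ) :
    NonesTo
      (res
        (gsome 0 ∅ (inp 0 (par (psome 0 (close 0)) (gsome 1 ∅ (pnone 1)))))
        (psome 0 (out 0 (gsome 0 ∅ (wait 0 nil)) (psome 0 (gsome 0 (ws.image Nat.succ) X)))))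
      ws := by
  refine .of_reds ((reds_gsome_psome _ _ _).trans
    (reds_inp_out (gsome 0 ∅ (wait 0 nil)) _ _)) ?_
  set Y := rename (up 1 Nat.succ) X with hY
  have h0 : SC (res (rename swap01 (par (psome 0 (close 0)) (gsome 1 ∅ (pnone 1))))
      (rename (up 1 Nat.succ) (psome 0 (gsome 0 (ws.image Nat.succ) X))))
      (par (res (gsome 0 ∅ (pnone 0)) (psome 0 (gsome 0 ((ws.image Nat.succ).image Nat.succ) Y)))
        (psome 0 (close 0))) := by
    have : rename (up 1 Nat.succ) (psome 0 (gsome 0 (ws.image Nat.succ) X))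
        = psome 0 (gsome 0 ((ws.image Nat.succ).image Nat.succ) Y) := by
      simp only [rename, Finset.image_image]
      rfl
    rw [this]
    exact SC.trans (SC.res_congr (SC.par_comm _ _) (SC.refl _))
      (SC.res_par (gsome 0 ∅ (pnone 0)) (psome 0 (close 0)) _)
  have h1 : NonesTo (res (pnone 0) (gsome 0 ((ws.image Nat.succ).image Nat.succ) Y))
      (ws.image Nat.succ) := by
    simpa using (NonesTo.pnone 0).kill (S := ∅) (ws := ws.image Nat.succ) (by simp) Y
  have h2 : Reds (res (pnone 0) (gsome 0 ((ws.image Nat.succ).image Nat.succ) Y))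
      (rename Nat.succ (nones ws.toList)) := by
    rw [rename_nones]
    refine NonesTo.reds ?_ (by simp [Finset.nodup_toList, List.nodup_map_iff Nat.succ_injective])
    convert h1 using 1
    ext
    simp
  have h3 : Reds (par (res (gsome 0 ∅ (pnone 0))
      (psome 0 (gsome 0 ((ws.image Nat.succ).image Nat.succ) Y))) (psome 0 (close 0)))
      (par (psome 0 (close 0)) (rename Nat.succ (nones ws.toList))) :=
    (Reds.congr (K := fun P => par P (psome 0 (close 0)))
      (fun h => SC.par_congr h (SC.refl _)) (Red.par _)
      ((reds_gsome_psome _ _ _).trans h2)).trans (SC.par_comm _ _).reds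
  refine ⟨ws.toList, ws.nodup_toList, by simp, ?_⟩
  refine ((h0.reds.trans h3).res_left _).trans ((SC.res_par _ _ _).reds.trans ?_)
  have h4 : Reds (res (psome 0 (close 0)) (gsome 0 ∅ (wait 0 nil))) nil :=
    (red_psome_gsome _ _ _).reds.trans (reds_close_wait nil)
  exact (Reds.congr (K := fun P => par P (nones ws.toList))
      (fun h => SC.par_congr h (SC.refl _)) (Red.par _) h4).trans (SC.nil_par _).reds

/-- The variables are exhausted first. Their `none` discards the remaining bag, which releases `W`
and the auxiliary name; the latter in turn discards the body and releases `V`. -/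
theorem share_zero_cons (X B : Proc) (ws V W : Finset ℕ) (hd : Disjoint W V) :
    NonesTo
      (res
        (gsome 0 ws (inp 0 (gsome 1 (insert 0 (W.image (fun i => i + 2))) X)))
        (psome 0 (out 0 (gsome 0 (V.image (fun i => i + 2)) (rename (up 1 Nat.succ) B)) (pnone 0))))
      (W ∪ V) := by
  have h1 : gsome 0 (V.image (fun i => i + 2)) (rename (up 1 Nat.succ) B)
      = rename (up 1 Nat.succ) (gsome 0 (V.image Nat.succ) B) := by
    simp only [rename, Finset.image_image]
    rfl
  rw [h1]
  refine .of_reds ((reds_gsome_psome _ _ _).trans (reds_inp_out _ _ _)) ?_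
  refine NonesTo.kill ?_ hd B
  refine .of_reds (SC.res_comm _ _).reds ?_
  have h2 : rename swap01 (gsome 1 (insert 0 (W.image (fun i => i + 2))) X)
      = gsome 0 ((insert 0 (W.image Nat.succ)).image Nat.succ) (rename swap01 X) := by
    simp only [rename, Finset.image_image, Finset.image_insert]
    rfl
  rw [h2]
  have := (NonesTo.pnone 0).kill (S := ∅) (ws := insert 0 (W.image Nat.succ)) (by simp)
    (rename swap01 X)
  simpa [rename] using this

end Proc

-- Translations under a change of environment

open Proc

theorem Tm.tr_natural_id {M : Tm} (hM : M.Sized) : Natural id M.fv M.tr M.tr := by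
  simpa only [Tm.rename_id] using Tm.tr_natural id M hM

theorem LBag.tr_natural_id {C : LBag} (hC : C.Sized) : Natural id C.fv C.tr C.tr := by
  simpa only [LBag.rename_id] using LBag.tr_natural id C hC

theorem Env.names_shift (n : ℕ) (ρ : Env) (F : Role → Finset ℕ) :
    (ρ.shift n).names F = (ρ.names F).image (fun i => i + n) :=
  Env.Rel.names (f := fun i => i + n) (g := id) (fun _ _ _ => rfl) (by simp)

theorem positions_shift {U : UBag} (hU : U.Sized) (n m : ℕ) (f : ℕ → ℕ) (ρ : Env)
    (hf : ∀ i, f (i + n) = i + m) (h0 : f 0 = 0) :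
    rename f (positions U.trs (ρ.shift n) 0) = positions U.trs (ρ.shift m) 0 := by
  have := UBag.trs_natural id U f (ρ.shift n) (ρ.shift m) 0 (x' := 0) hU
    (fun r i _ => (hf _).symm) h0.symm
  rw [UBag.rename_id] at this
  rw [positions_eq, positions_eq, rename_branches, this, h0]

/-! ### Beta reduction -/

/-- The abstraction and the application synchronise on `v`, exchange the name `x`, and the forwarder
then replaces `v` by `u`. No branch is lost here. -/
theorem tr_beta {M : Tm} {C : LBag} {U : UBag} (hM : M.Sized) (hC : C.Sized) (hU : U.Sized)
    (ρ : Env) (u : ℕ) : Reds ((Tm.app (.abs M) C U).tr ρ u) ((Tm.esub M C U).tr ρ u) := by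
  simp only [Tm.tr]
  refine (red_psome_gsome _ _ _).reds.trans ((SC.res_comm _ _).reds.trans ?_)
  -- The input is doubled to match the shape of `red_out_nd_inp`; the copy is dropped by the
  -- commitment.
  refine (SC.res_congr (SC.refl _) (SC.nd_idem _).symm).reds.trans ?_
  refine (red_out_nd_inp _).reds.trans ((red_fwd _ _).reds.trans ?_)
  have h1 : rename (up 1 (scons u id)) (bag C.fv C.tr U.trs (ρ.shift 2) 0)
      = bag C.fv C.tr U.trs (ρ.shift 1) 0 :=
    (bag_natural (g := id) (f := up 1 (scons u id)) 0 (ρ := ρ.shift 2) (ρ' := ρ.shift 1)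
      (fun _ _ _ => by simp [up, scons]) (by simp) (LBag.tr_natural_id hC) (by
        have := UBag.trs_natural id U (up 2 (up 1 (scons u id))) ((ρ.shift 2).shift 2)
          ((ρ.shift 1).shift 2) 0 hU (fun _ _ _ => by simp [up, scons]) rfl
        rwa [UBag.rename_id] at this)).symm
  have h2 : rename (up 3 (scons u id)) (M.tr (((ρ.shift 1).shift 3).cons bagNames) (0 + 3))
      = M.tr ((ρ.shift 3).cons bagNames) (u + 3) := by
    refine ((Tm.tr_natural_id hM).eq _ ?_ (by simp [up, scons])).symm
    rintro r (_ | i) _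
    · cases r <;> simp [bagNames, up]
    · simp [up, scons]
  simp only [rename, up_up, up_one_zero, h1]
  rw [← h2]
  exact (SC.res_comm _ _).reds

/-! ### Linear bags and sharing -/

namespace Proc

variable {F : Role → Finset ℕ} {body : Env → ℕ → Proc}

theorem share_natural_id (hb : Natural id F body body) (xs : List ℕ) {f : ℕ → ℕ}
    {ρ ρ' : Env} {x x' u u' : ℕ}
    (hρ : ∀ r, ∀ i ∈ F r, i ∉ xs → ρ' r i = f (ρ r i)) (hx : x' = f x) (hu : u' = f u) :
    share F body xs.length xs ρ' x' u' = rename f (share F body xs.length xs ρ x u) := by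
  subst hx hu
  -- Any strict upper bound of `xs` serves, since the variables are renamed by the identity.
  obtain ⟨k, hk⟩ : ∃ k, ∀ i ∈ xs, i < k :=
    ⟨xs.sum + 1, fun i hi => Nat.lt_succ_of_le (List.le_sum_of_mem hi)⟩
  refine share_natural (k := k) (g := id) (by simp) (by simpa using hb) _ xs rfl hk f ρ ρ' x u ?_
  intro r i hi
  simp only [Finset.mem_sdiff, List.mem_toFinset] at hi
  simpa using hρ r i hi.1 hi.2

/-- A round of `share_step` in which the first remaining variable `i` receives the first element.
The received name is innermost at first and gets exchanged with the linear name of the bag, hence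
the order of `set` and `shift`. -/
theorem tr_cons_share {N : Tm} {C : LBag} (hN : N.Sized) (hC : C.Sized)
    (hb : Natural id F body body) (i : ℕ) (xs : List ℕ) (ρ σ : Env) (u : ℕ) :
    Reds
      (res ((LBag.cons N C).tr (ρ.shift 1) 0)
        (share F body (xs.length + 1) (i :: xs) (σ.shift 1) 0 (u + 1)))
      (res (gsome 0 ((ρ.shift 1).names N.fv) (N.tr (ρ.shift 1) 0))
        (res (C.tr ((ρ.shift 1).shift 1) 0)
          (share F body xs.length xs (((σ.shift 1).set i 0).shift 1) 0 (u + 1 + 1)))) := by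
  have h1 : gsome 0 (((ρ.shift 1).shift 2).names N.fv) (N.tr ((ρ.shift 1).shift 2) 0)
      = rename (up 1 (fun i => i + 2))
        (gsome 0 ((ρ.shift 1).names N.fv) (N.tr (ρ.shift 1) 0)) := by
    rw [rename, ← (Tm.tr_natural_id hN).eq (f := up 1 (fun i => i + 2)) (ρ := ρ.shift 1)
      (ρ' := (ρ.shift 1).shift 2) 0 (fun _ _ _ => by simp) rfl]
    congr 1
    simp only [Env.names_shift, Finset.image_image]
    congr 1
  have h2 : C.tr ((ρ.shift 1).shift 1) (0 + 1) = rename Nat.succ (C.tr (ρ.shift 1) 0) :=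
    (LBag.tr_natural_id hC).eq 0 (fun _ _ _ => by simp) rfl
  have h3 : C.tr ((ρ.shift 1).shift 1) 0 = rename (up 1 Nat.succ) (C.tr (ρ.shift 1) 0) :=
    (LBag.tr_natural_id hC).eq 0 (fun _ _ _ => by simp) rfl
  have h4 : share F body xs.length xs (((σ.shift 1).set i 0).shift 1) 0 (u + 1 + 1)
      = rename swap01 (share F body xs.length xs (((σ.shift 1).shift 1).set i 0) (0 + 1)
        (u + 1 + 1)) := by
    refine share_natural_id hb xs (fun r j _ _ => ?_) rfl rfl
    by_cases hj : j = i
    · simp [Env.set, hj, swap01]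
    · simp [Env.set, hj, swap01]
  rw [h3, h4]
  simp only [LBag.tr]
  rw [h1, h2]
  simp only [share]
  refine share_step _ _ _ (List.mem_map.2 ⟨i, by simp, ?_⟩)
  rw [List.erase_cons_head]

/-- The environment in which the shared variables `xs` are received one after the other. -/
def shareEnv : List ℕ → Env → Env
  | [], σ => σ
  | i :: xs, σ => shareEnv xs ((σ.shift 1).set i 0)

/-- Each later reception adds a binder, so the variable received first gets the largest index. -/
theorem shareEnv_apply : ∀ (xs : List ℕ), xs.Nodup → ∀ (σ : Env) (r : Role) (j : ℕ),
    shareEnv xs σ r j = if j ∈ xs then xs.length - 1 - xs.idxOf j else σ r j + xs.length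
  | [], _, σ, r, j => by simp [shareEnv]
  | i :: xs, h, σ, r, j => by
    obtain ⟨hi, h⟩ := List.nodup_cons.1 h
    rw [shareEnv, shareEnv_apply xs h]
    by_cases hj : j = i
    · subst hj
      simp [hi, Env.set]
    · have hj' : ¬ i = j := fun h => hj h.symm
      by_cases hx : j ∈ xs
      · simp [hx, List.idxOf_cons_ne _ hj']
        omega
      · simp [hx, hj, Env.set]
        omega

/-- The rounds pair elements and variables in order and stack up the restrictions of the chain. Only
one of the possible distributions survives. -/
theorem tr_share_eq_size (hb : Natural id F body body) :
    ∀ (C : LBag) (xs : List ℕ), C.Sized → C.size = xs.length → ∀ (ρ σ : Env) (u : ℕ),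
      Reds
        (res (C.tr (ρ.shift 1) 0) (share F body xs.length xs (σ.shift 1) 0 (u + 1)))
        (chain C.trs ρ (body (shareEnv xs σ) (u + xs.length)))
  | .one, [], _, _, ρ, σ, u => by
    simp only [LBag.tr, List.length_nil, share, shareEnv, LBag.trs, chain, Nat.add_zero]
    have h1 : body ((σ.shift 1).shift 1) (u + 1 + 1) = rename (fun i => i + 2) (body σ u) :=
      hb.eq u (fun _ _ _ => by simp) rfl
    have h2 : insert (u + 1 + 1) (((σ.shift 1).shift 1).names F)
        = (insert (u + 1) ((σ.shift 1).names F)).image (up 1 Nat.succ) := by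
      rw [Env.names_shift, Env.names_shift, Finset.image_insert, Finset.image_image,
        Finset.image_image]
      congr 1
    rw [h1, h2]
    exact share_zero_one _ _
  | .cons N C, i :: xs, ⟨hN, hC⟩, hs, ρ, σ, u => by
    refine (tr_cons_share hN hC hb i xs ρ σ u).trans ?_
    have := tr_share_eq_size hb C xs hC (by simpa [LBag.size] using hs) (ρ.shift 1)
      ((σ.shift 1).set i 0) (u + 1)
    rw [Nat.add_assoc u 1 xs.length, Nat.add_comm 1 xs.length] at this
    exact this.res_right _

/-- The elements of a linear bag have pairwise disjoint sets of names. -/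
def _root_.LBag.NamesDisjoint (ρ : Env) : LBag → Prop
  | .one => True
  | .cons M C => Disjoint (ρ.names M.fv) (ρ.names C.fv) ∧ C.NamesDisjoint ρ

theorem _root_.LBag.NamesDisjoint.shift {ρ : Env} (n : ℕ) :
    ∀ {C : LBag}, C.NamesDisjoint ρ → C.NamesDisjoint (ρ.shift n)
  | .one, _ => trivial
  | .cons M C, ⟨h, hC⟩ => by
    refine ⟨?_, hC.shift n⟩
    rw [Env.names_shift, Env.names_shift]
    exact (Finset.disjoint_image (add_left_injective n)).2 h

theorem _root_.Env.names_union (ρ : Env) (F G : Role → Finset ℕ) :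
    ρ.names (fun r => F r ∪ G r) = ρ.names F ∪ ρ.names G := by
  simp only [Env.names, Finset.image_union]
  ac_rfl

theorem _root_.Env.names_cons (ρ : Env) (M : Tm) (C : LBag) :
    ρ.names (LBag.cons M C).fv = ρ.names M.fv ∪ ρ.names C.fv := by
  rw [← Env.names_union]
  rfl

theorem _root_.Env.names_one (ρ : Env) : ρ.names LBag.one.fv = ∅ := rfl

/-- Rounds are played until one side is empty, where `share_succ_one` or `share_zero_cons` applies.
On the way back, each element already handed out is discarded: the variable that received it is
linear in the body (`F .lin`), so its name is among those that have become unavailable. -/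
theorem tr_share_ne_size (hb : Natural id F body body) :
    ∀ (C : LBag) (xs : List ℕ), C.Sized → C.size ≠ xs.length → xs.Nodup →
      (∀ i ∈ xs, i ∈ F .lin) → ∀ (ρ σ : Env) (u : ℕ), C.NamesDisjoint ρ →
      Disjoint (insert u (σ.names fun r => F r \ xs.toFinset)) (ρ.names C.fv) →
      NonesTo
        (res (C.tr (ρ.shift 1) 0) (share F body xs.length xs (σ.shift 1) 0 (u + 1)))
        (insert u (σ.names fun r => F r \ xs.toFinset) ∪ ρ.names C.fv)
  | .one, [], _, hs, _, _, _, _, _, _, _ => absurd rfl hs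
  | .one, i :: xs, _, _, _, _, ρ, σ, u, _, _ => by
    simp only [LBag.tr, List.length_cons, share, Env.names_one, Finset.union_empty]
    rw [Env.names_shift, show insert (u + 1) _ =
      (insert u (σ.names fun r => F r \ (i :: xs).toFinset)).image Nat.succ by
        rw [Finset.image_insert]]
    exact share_succ_one _ _
  | .cons N C, [], _, _, _, _, ρ, σ, u, _, hd => by
    simp only [List.toFinset_nil, Finset.sdiff_empty] at hd ⊢
    change Disjoint (insert u (σ.names F)) _ at hd
    change NonesTo _ (insert u (σ.names F) ∪ _)
    simp only [LBag.tr, List.length_nil, share]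
    have h1 : rename (up 1 Nat.succ) (wait 0 (body (σ.shift 1) (u + 1)))
        = wait 0 (body ((σ.shift 1).shift 1) (u + 1 + 1)) := by
      rw [rename, ← hb.eq (ρ := σ.shift 1) (ρ' := (σ.shift 1).shift 1) (f := up 1 Nat.succ)
        (v := u + 1 + 1) (u + 1) (fun _ _ _ => by simp) (by simp)]
      rfl
    have h2 : insert (u + 1 + 1) (((σ.shift 1).shift 1).names F)
        = (insert u (σ.names F)).image (fun i => i + 2) := by
      rw [Env.shift_shift, Env.names_shift, Finset.image_insert]
    rw [← h1, h2, Env.shift_shift, Env.names_shift (1 + 1), Finset.union_comm]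
    exact share_zero_cons _ _ _ _ _ hd.symm
  | .cons N C, i :: xs, ⟨hN, hC⟩, hs, hx, hF, ρ, σ, u, ⟨hNC, hCd⟩, hd => by
    obtain ⟨hi, hx⟩ := List.nodup_cons.1 hx
    refine .of_reds (tr_cons_share hN hC hb i xs ρ σ u) (.of_reds (SC.res_comm _ _).reds ?_)
    rw [Env.names_cons, Finset.disjoint_union_right] at hd
    set σ' := (σ.shift 1).set i 0
    -- Receiving `i` adds exactly the name `0` to the names of the body. It is really there because
    -- `i` occurs linearly, and without it the element could not be discarded.
    have hσ : σ'.names (fun r => F r \ xs.toFinset)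
        = insert 0 ((σ.names fun r => F r \ (i :: xs).toFinset).image Nat.succ) := by
      have key : ∀ r, (F r \ xs.toFinset).image (σ' r) ⊆
          insert 0 (((F r \ (i :: xs).toFinset).image (σ r)).image Nat.succ) := by
        intro r a ha
        simp only [Finset.mem_image, Finset.mem_sdiff, List.mem_toFinset] at ha
        obtain ⟨j, ⟨hj, hjx⟩, rfl⟩ := ha
        by_cases hji : j = i
        · simp [σ', Env.set, hji]
        · refine Finset.mem_insert_of_mem (Finset.mem_image.2 ⟨σ r j, ?_, ?_⟩)
          · exact Finset.mem_image_of_mem _ (by simp [hj, hji, hjx])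
          · simp [σ', Env.set, hji]
      have key' : ∀ r, ((F r \ (i :: xs).toFinset).image (σ r)).image Nat.succ ⊆
          (F r \ xs.toFinset).image (σ' r) := by
        intro r a ha
        simp only [Finset.mem_image, Finset.mem_sdiff, List.mem_toFinset] at ha
        obtain ⟨_, ⟨j, ⟨hj, hjx⟩, rfl⟩, rfl⟩ := ha
        simp only [List.mem_cons, not_or] at hjx
        exact Finset.mem_image.2 ⟨j, by simp [hj, hjx.2], by simp [σ', Env.set, hjx.1]⟩
      have h0 : 0 ∈ (F .lin \ xs.toFinset).image (σ' .lin) :=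
        Finset.mem_image.2 ⟨i, by simp [hF i, hi], by simp [σ', Env.set]⟩
      unfold Env.names
      rw [Finset.image_union]
      refine Finset.Subset.antisymm (Finset.union_subset ?_ ?_) (Finset.insert_subset
        (Finset.mem_union_left _ h0) (Finset.union_subset_union (key' _) (key' _)))
      · exact (key _).trans (Finset.insert_subset_insert _ Finset.subset_union_left)
      · exact (key _).trans (Finset.insert_subset_insert _ Finset.subset_union_right)
    set A := σ.names fun r => F r \ (i :: xs).toFinset
    have ih := tr_share_ne_size hb C xs hC (by simpa [LBag.size] using hs) hx
      (fun j hj => hF j (by simp [hj])) (ρ.shift 1) σ' (u + 1) (hCd.shift 1) (by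
        rw [hσ, Env.names_shift, Finset.insert_comm, show insert (u + 1) (A.image Nat.succ)
          = (insert u A).image Nat.succ by rw [Finset.image_insert], Finset.disjoint_insert_left]
        exact ⟨by simp, (Finset.disjoint_image Nat.succ_injective).2 hd.2⟩)
    rw [Env.names_cons, Finset.union_comm (ρ.names N.fv), ← Finset.union_assoc, Env.names_shift]
    refine NonesTo.kill ?_ (Finset.disjoint_union_left.2 ⟨hd.1, hNC.symm⟩) _
    convert ih using 1
    rw [hσ, Env.names_shift, Finset.image_union, Finset.image_insert, Finset.insert_comm,
      Finset.insert_union, Finset.insert_union, Finset.insert_union]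

/-- The failed body announces every restricted name of the chain, so the elements are discarded one
after the other from the innermost outwards, each releasing its own names. -/
theorem chain_nones : ∀ (C : LBag) (ρ : Env) (P : Proc) (S : Finset ℕ), C.NamesDisjoint ρ →
    Disjoint S (ρ.names C.fv) →
    NonesTo P (Finset.range C.size ∪ S.image (fun i => i + C.size)) →
    NonesTo (chain C.trs ρ P) (S ∪ ρ.names C.fv)
  | .one, ρ, P, S, _, _, h => by simpa [LBag.size, Env.names_one, LBag.trs, chain] using h
  | .cons N C, ρ, P, S, ⟨hNC, hC⟩, hd, h => by
    rw [Env.names_cons, Finset.disjoint_union_right] at hd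
    have ih := chain_nones C (ρ.shift 1) P (insert 0 (S.image Nat.succ)) (hC.shift 1) (by
        rw [Finset.disjoint_insert_left, Env.names_shift]
        exact ⟨by simp, (Finset.disjoint_image Nat.succ_injective).2 hd.2⟩) (by
        convert h using 1
        ext a
        simp only [LBag.size, Finset.mem_union, Finset.mem_range, Finset.mem_image,
          Finset.mem_insert]
        constructor
        · rintro (h | ⟨_, rfl | ⟨b, hb, rfl⟩, rfl⟩)
          · omega
          · omega
          · exact Or.inr ⟨b, hb, by omega⟩
        · rintro (h | ⟨b, hb, rfl⟩)
          · by_cases hC : a < C.size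
            · exact Or.inl hC
            · exact Or.inr ⟨0, Or.inl rfl, by omega⟩
          · exact Or.inr ⟨b + 1, Or.inr ⟨b, hb, rfl⟩, by omega⟩)
    simp only [LBag.trs, chain]
    refine .of_reds (SC.res_comm _ _).reds ?_
    rw [Env.names_cons, Finset.union_comm (ρ.names N.fv), ← Finset.union_assoc, Env.names_shift]
    refine NonesTo.kill ?_ (Finset.disjoint_union_left.2 ⟨hd.1, hNC.symm⟩) _
    convert ih using 1
    rw [Env.names_shift, Finset.image_union, Finset.insert_union]

end Proc

/-! ### Explicit substitutions -/

/-- Inside the sharing construct the bound variable has the index `k`. It occurs in `M` in the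
unrestricted role only, so a single name `0` can stand for all its roles; the names given to the `k`
shared variables are placeholders. -/
theorem tr_esub_open {k : ℕ} {M : Tm} {C : LBag} {U : UBag} (hM : M.Sized) (hC : C.Sized)
    (hU : U.Sized) (hlin : k ∉ M.fv .lin) (hshr : k ∉ M.fv .shr) (ρ : Env) (u : ℕ) :
    Reds ((Tm.esub (.share k 0 M) C U).tr ρ u)
      (res
        (res (C.tr ((ρ.shift 1).shift 1) 0)
          (Proc.share M.fv M.tr k (List.range k)
            ((((ρ.shift 1).cons fun _ => 0).consN k fun _ => 0).shift 1) 0 (u + 1 + 1)))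
        (srv 0 (positions U.trs (ρ.shift 2) 0))) := by
  have h1 : C.tr ((ρ.shift 1).shift 1) 0 = rename (up 1 Nat.succ) (C.tr (ρ.shift 1) 0) :=
    (LBag.tr_natural_id hC).eq 0 (fun _ _ _ => by simp) rfl
  have h2 : srv 0 (positions U.trs ((ρ.shift 1).shift 2) 0)
      = rename (up 1 Nat.succ) (srv 0 (positions U.trs (ρ.shift 2) 0)) := by
    rw [Env.shift_shift, rename, positions_shift hU 2 (1 + 2) _ ρ (fun i => by simp [up]) rfl]
    rfl
  simp only [Tm.tr, bag]
  rw [h1, h2]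
  refine bag_open _ ?_
  have := share_natural_id (Tm.tr_natural_id hM) (List.range k)
    (f := scons 1 (scons 0 (fun i => i + 3))) (x := 0) (x' := 1) (u := u + 1 + 1) (u' := u + 3)
    (ρ := (((ρ.shift 1).cons fun _ => 0).consN k fun _ => 0).shift 1)
    (ρ' := ((ρ.shift 3).cons bagNames).consN k fun _ => 1) (fun r i hi hx => ?_) rfl rfl
  · rw [List.length_range] at this
    exact this
  · obtain ⟨j, rfl⟩ := Nat.exists_eq_add_of_le' (by simpa using hx : k ≤ i)
    rw [Env.consN_add, Env.shift_apply, Env.consN_add]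
    -- Index `0` is the variable of the substitution: the hypotheses rule out its linear and sharing
    -- roles, and in the unrestricted role the two environments correspond.
    rcases j with _ | j
    · cases r
      · exact absurd hi (by simpa using hlin)
      · exact absurd hi (by simpa using hshr)
      · rfl
    · rfl

/-! ### Contexts around head variables -/

namespace NCtx

@[simp] theorem depth_commit : ∀ N : NCtx, N.commit.depth = N.depth
  | hole => rfl
  | par N _ => N.depth_commit
  | res N _ => congrArg (· + 1) N.depth_commit
  | nd N _ => N.depth_commit

@[simp] theorem depth_rename : ∀ (f : ℕ → ℕ) (N : NCtx), (N.rename f).depth = N.depth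
  | _, hole => rfl
  | f, par N _ => N.depth_rename f
  | f, res N _ => congrArg (· + 1) (N.depth_rename (up 1 f))
  | f, nd N _ => N.depth_rename f

@[simp] theorem commit_commit : ∀ N : NCtx, N.commit.commit = N.commit
  | hole => rfl
  | par N _ => by simp [commit, N.commit_commit]
  | res N _ => by simp [commit, N.commit_commit]
  | nd N _ => by simp [commit, N.commit_commit]

theorem commit_rename : ∀ (f : ℕ → ℕ) (N : NCtx), (N.rename f).commit = N.commit.rename f
  | _, hole => rfl
  | f, par N _ => by simp [commit, rename, N.commit_rename]
  | f, res N _ => by simp [commit, rename, N.commit_rename]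
  | f, nd N _ => by simp [commit, rename, N.commit_rename]

end NCtx

/-- Contexts of restrictions, with the hole on either side, and choices. -/
inductive HCtx : Type
  | hole : HCtx
  | resL (G : HCtx) (P : Proc) : HCtx
  | resR (P : Proc) (G : HCtx) : HCtx
  | nd (G : HCtx) (P : Proc) : HCtx

namespace HCtx

/-- The context with its hole filled. -/
def fill : HCtx → Proc → Proc
  | hole, X => X
  | resL G P, X => .res (G.fill X) P
  | resR P G, X => .res P (G.fill X)
  | nd G P, X => .nd (G.fill X) P

/-- Number of restrictions above the hole. -/
def depth : HCtx → ℕ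
  | hole => 0
  | resL G _ => G.depth + 1
  | resR _ G => G.depth + 1
  | nd G _ => G.depth

/-- The commitment of a context. -/
def commit : HCtx → HCtx
  | hole => hole
  | resL G P => resL G.commit P
  | resR P G => resR P G.commit
  | nd G _ => G.commit

/-- Renaming of the free names. -/
def rename : (ℕ → ℕ) → HCtx → HCtx
  | _, hole => hole
  | f, resL G P => resL (G.rename (up 1 f)) (P.rename (up 1 f))
  | f, resR P G => resR (P.rename (up 1 f)) (G.rename (up 1 f))
  | f, nd G P => nd (G.rename f) (P.rename f)

/-- The structurally congruent ND-context. -/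
def toNCtx : HCtx → NCtx
  | hole => .hole
  | resL G P => .res G.toNCtx P
  | resR P G => .res G.toNCtx P
  | nd G P => .nd G.toNCtx P

@[simp] theorem depth_commit : ∀ G : HCtx, G.commit.depth = G.depth
  | hole => rfl
  | resL G _ => congrArg (· + 1) G.depth_commit
  | resR _ G => congrArg (· + 1) G.depth_commit
  | nd G _ => G.depth_commit

@[simp] theorem depth_toNCtx : ∀ G : HCtx, G.toNCtx.depth = G.depth
  | hole => rfl
  | resL G _ => congrArg (· + 1) G.depth_toNCtx
  | resR _ G => congrArg (· + 1) G.depth_toNCtx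
  | nd G _ => G.depth_toNCtx

theorem commit_toNCtx : ∀ G : HCtx, G.toNCtx.commit = G.commit.toNCtx
  | hole => rfl
  | resL G _ => by simp [toNCtx, commit, NCtx.commit, G.commit_toNCtx]
  | resR _ G => by simp [toNCtx, commit, NCtx.commit, G.commit_toNCtx]
  | nd G _ => by simp [toNCtx, commit, NCtx.commit, G.commit_toNCtx]

theorem rename_toNCtx : ∀ (f : ℕ → ℕ) (G : HCtx), (G.rename f).toNCtx = G.toNCtx.rename f
  | _, hole => rfl
  | f, resL G _ => by simp [toNCtx, rename, NCtx.rename, G.rename_toNCtx]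
  | f, resR _ G => by simp [toNCtx, rename, NCtx.rename, G.rename_toNCtx]
  | f, nd G _ => by simp [toNCtx, rename, NCtx.rename, G.rename_toNCtx]

/-- ND-contexts keep their hole on the left of restrictions, whereas a chain has its body on the
right. Commutativity of restriction bridges the gap. -/
theorem toNCtx_fill (X : Proc) : ∀ G : HCtx, SC (G.toNCtx.fill X) (G.fill X)
  | hole => SC.refl _
  | resL G _ => SC.res_congr (G.toNCtx_fill X) (SC.refl _)
  | resR _ G => (SC.res_comm _ _).trans (SC.res_congr (SC.refl _) (G.toNCtx_fill X))
  | nd G _ => SC.nd_congr (G.toNCtx_fill X) (SC.refl _)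

theorem fill_congr {X Y : Proc} (h : SC X Y) : ∀ G : HCtx, SC (G.fill X) (G.fill Y)
  | hole => h
  | resL G _ => SC.res_congr (G.fill_congr h) (SC.refl _)
  | resR _ G => SC.res_congr (SC.refl _) (G.fill_congr h)
  | nd G _ => SC.nd_congr (G.fill_congr h) (SC.refl _)

theorem exists_of_fill_eq_rename : ∀ (G : HCtx) {f : ℕ → ℕ} {X P : Proc},
    G.fill X = P.rename f →
      ∃ G₀ X₀, G = rename f G₀ ∧ P = G₀.fill X₀ ∧ X = X₀.rename (up G.depth f)
  | hole, f, X, P, h => ⟨hole, P, rfl, rfl, by simpa [depth, fill] using h⟩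
  | resL G Q, f, X, P, h => by
    cases P <;> simp [fill, Proc.rename] at h
    obtain ⟨G₀, X₀, rfl, rfl, rfl⟩ := G.exists_of_fill_eq_rename h.1
    exact ⟨resL G₀ _, X₀, by rw [rename, ← h.2], rfl, by simp [depth, up_up]⟩
  | resR Q G, f, X, P, h => by
    cases P <;> simp [fill, Proc.rename] at h
    obtain ⟨G₀, X₀, rfl, rfl, rfl⟩ := G.exists_of_fill_eq_rename h.2
    exact ⟨resR _ G₀, X₀, by rw [rename, ← h.1], rfl, by simp [depth, up_up]⟩
  | nd G Q, f, X, P, h => by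
    cases P <;> simp [fill, Proc.rename] at h
    obtain ⟨G₀, X₀, rfl, rfl, rfl⟩ := G.exists_of_fill_eq_rename h.1
    exact ⟨nd G₀ _, X₀, by rw [rename, ← h.2], rfl, by simp [depth]⟩

/-- The context around the body of a chain of restrictions. -/
def chain : List (Env → ℕ → Proc) → Env → HCtx → HCtx
  | [], _, G => G
  | Z :: Zs, ρ, G => .resR (Z (ρ.shift 1) 0) (chain Zs (ρ.shift 1) G)

theorem chain_fill (G : HCtx) (X : Proc) : ∀ (Zs : List (Env → ℕ → Proc)) (ρ : Env),
    (chain Zs ρ G).fill X = Proc.chain Zs ρ (G.fill X)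
  | [], _ => rfl
  | _ :: Zs, ρ => by simp [chain, fill, Proc.chain, chain_fill G X Zs]

theorem chain_commit (G : HCtx) : ∀ (Zs : List (Env → ℕ → Proc)) (ρ : Env),
    (chain Zs ρ G).commit = chain Zs ρ G.commit
  | [], _ => rfl
  | _ :: Zs, ρ => by simp [chain, commit, chain_commit G Zs]

theorem chain_depth (G : HCtx) : ∀ (Zs : List (Env → ℕ → Proc)) (ρ : Env),
    (chain Zs ρ G).depth = Zs.length + G.depth
  | [], _ => by simp [chain]
  | _ :: Zs, ρ => by simp [chain, depth, chain_depth G Zs]; omega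

end HCtx

theorem Proc.SC.chain {P Q : Proc} (h : SC P Q) :
    ∀ (Zs : List (Env → ℕ → Proc)) (ρ : Env), SC (Proc.chain Zs ρ P) (Proc.chain Zs ρ Q)
  | [], _ => h
  | _ :: Zs, ρ => SC.res_congr (SC.refl _) (SC.chain h Zs (ρ.shift 1))

theorem up_injective (k : ℕ) {f : ℕ → ℕ} (hf : f.Injective) : (up k f).Injective := by
  intro i j h
  unfold up at h
  split_ifs at h
  · exact h
  · omega
  · omega
  · have := hf (Nat.add_right_cancel h)
    omega

/-- The availability of `z` is consumed first, which commits `G`; then the forwarder replaces `z` by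
`w` in `Nt`. Writing `w` as `up G.depth Nat.succ y` says that `w` differs from `z`. -/
theorem reds_linear_fetch {P Nt T X : Proc} {G : HCtx} (ws : Finset ℕ) (y : ℕ)
    (hP : SC P (G.fill (psome G.depth (fwd G.depth (up G.depth Nat.succ y)))))
    (hX : X = rename (up G.depth Nat.succ) (rename (scons y (fun i => i + G.depth)) Nt))
    (hT : MoreBranches (rename Nat.succ T) (G.commit.fill X)) :
    ∃ Q, Reds (res (gsome 0 ws Nt) P) Q ∧ MoreBranches T Q := by
  -- The term `T`, already free of `z`, has at least the branches of the outcome, so the committed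
  -- context is free of `z` as forwarding demands.
  obtain ⟨Q, hQ, hTQ⟩ := hT.exists_of_rename
  obtain ⟨G₀, X₀, hG, rfl, hX₀⟩ := HCtx.exists_of_fill_eq_rename _ hQ
  refine ⟨_, ?_, hTQ⟩
  have hX₁ : X₀ = rename (scons y (fun i => i + G.depth)) Nt := by
    rw [HCtx.depth_commit] at hX₀
    exact rename_injective (up_injective _ Nat.succ_injective) (hX₀.symm.trans hX)
  have h1 := Red.some G.toNCtx .hole ws (fwd G.depth (up G.depth Nat.succ y)) Nt
  have h2 := Red.id G.toNCtx.commit G₀.toNCtx y Nt (by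
    rw [NCtx.commit_commit, HCtx.commit_toNCtx, hG, HCtx.rename_toNCtx])
  simp only [NCtx.depth_commit, HCtx.depth_toNCtx] at h1 h2
  rw [← hX₁] at h2
  refine ((SC.res_comm _ _).trans (SC.res_congr (hP.trans (HCtx.toNCtx_fill _ _).symm)
    (SC.refl _))).reds.trans (h1.reds.trans (h2.reds.trans (HCtx.toNCtx_fill _ _).reds))

/-- Three reductions: the request spawns a copy of the branch, the selection picks its label, and
the forwarder connects the copy to `w`. The server remains. -/
theorem reds_request_fetch {P : Proc} {G : HCtx} {I : Finset ℕ} (K : {i // i ∈ I} → Proc)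
    (k : {i // i ∈ I}) (w : ℕ)
    (hP : SC P (G.fill (req G.depth (sel 0 k.1 (fwd 0 (w + 1)))))) :
    Reds (res P (srv 0 (bra 0 I K)))
      (res (G.commit.fill (rename (scons w (fun i => i + G.depth)) (K k)))
        (srv 0 (bra 0 I K))) := by
  have h1 := Red.request G.toNCtx .hole .hole (sel 0 k.1 (fwd 0 (w + 1))) (bra 0 I K) rfl
  have hs : scons 1 (fun j => j + 0 + 2) = Nat.succ := by
    funext i; cases i <;> rfl
  simp only [NCtx.fill, NCtx.depth, HCtx.depth_toNCtx, rename, scons, rot_zero, up_id,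
    rename_id, id] at h1
  rw [hs] at h1
  have h2 := Red.select (G.toNCtx.commit.rename Nat.succ) .hole
    (fwd G.depth (up G.depth Nat.succ w)) I K k
  have h3 := Red.id (G.toNCtx.commit.rename Nat.succ) G.toNCtx.commit w (K k) (by
    rw [NCtx.commit_rename, NCtx.commit_commit])
  simp only [NCtx.depth_rename, NCtx.depth_commit, HCtx.depth_toNCtx, NCtx.commit_rename,
    NCtx.commit_commit, NCtx.fill, NCtx.depth, NCtx.commit] at h2 h3
  refine (SC.res_congr (hP.trans (HCtx.toNCtx_fill _ _).symm) (SC.refl _)).reds.trans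
    (h1.reds.trans (((h2.reds.trans h3.reds).trans ?_).res_left _))
  rw [HCtx.commit_toNCtx]
  exact (HCtx.toNCtx_fill _ _).reds

/-- Elements before the `i`-th stay as an outer context; those after it become part of the context
between its restriction and the body. The first element is outermost, which accounts for the index
`C.size - 1 - i`. -/
theorem reds_chain_fetch : ∀ (C : LBag) (i : ℕ) {N : Tm}, C.get? i = some N → C.Sized →
    ∀ (ρ : Env) {B T : Proc} {G : HCtx} {w : ℕ},
    SC B (G.fill (psome (C.size - 1 - i + G.depth) (fwd (C.size - 1 - i + G.depth) w))) →
    (w < G.depth ∨ C.size + G.depth ≤ w) →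
    MoreBranches (rename (skip (C.size - 1 - i)) T)
      (G.commit.fill (N.tr (ρ.shift (C.size + G.depth)) w)) →
    ∃ Q, Reds (chain C.trs ρ B) Q ∧ MoreBranches (chain (C.remove i).trs ρ T) Q
  | .cons N C, 0, _, rfl, ⟨hN, hC⟩, ρ, B, T, G, w, hB, hw, hT => by
    have hs : (LBag.cons N C).size - 1 - 0 = C.size := by simp [LBag.size]
    rw [hs] at hB hT
    set G' := HCtx.chain C.trs (ρ.shift 1) G with hG'
    have hd : G'.depth = C.size + G.depth := by rw [hG', HCtx.chain_depth, LBag.length_trs]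
    -- By `hw`, the target of the forwarder is bound inside `G` or lies beyond the whole chain,
    -- hence is not the fetched name.
    obtain ⟨y, hy⟩ : ∃ y, w = up G'.depth Nat.succ y := by
      simp only [LBag.size] at hw
      by_cases h : w < G'.depth
      · exact ⟨w, (up_lt _ h).symm⟩
      · exact ⟨w - 1, by
          unfold up
          split_ifs
          · omega
          · simp only [Nat.succ_eq_add_one]; omega⟩
    refine reds_linear_fetch (G := G') (X := N.tr (ρ.shift ((LBag.cons N C).size + G.depth)) w)
      _ y ?_ ?_ ?_
    · rw [hG', HCtx.chain_fill, ← hG', ← hy, hd]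
      exact SC.chain hB _ _
    · rw [rename_rename]
      refine (Tm.tr_natural_id hN).eq 0 (fun r j _ => ?_) hy
      simp only [Env.shift_apply, Function.comp_apply, scons, up_add, hd, LBag.size, id]
      omega
    · rw [hG', HCtx.chain_commit, HCtx.chain_fill]
      change MoreBranches (rename Nat.succ (chain C.trs ρ T)) _
      have := LBag.chain_natural id C Nat.succ ρ (ρ.shift 1) T hC (fun _ _ _ => rfl)
      rw [LBag.rename_id] at this
      -- Leaving out the fetched name under the inner restrictions of the chain is the weakening of
      -- the rest of the chain by that name.
      rw [← this, ← skip_eq_up]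
      exact MoreBranches.chain hT _ _
  | .cons M C, i + 1, N, hN, ⟨_, hC⟩, ρ, B, T, G, w, hB, hw, hT => by
    have hs : (LBag.cons M C).size - 1 - (i + 1) = C.size - 1 - i := by
      simp only [LBag.size]; omega
    rw [hs] at hB hT
    obtain ⟨Q, hQ, hTQ⟩ := reds_chain_fetch C i hN hC (ρ.shift 1) hB
      (by simp only [LBag.size] at hw; omega) (by
        rw [Env.shift_shift]
        convert hT using 4
        simp only [LBag.size]
        omega)
    exact ⟨_, hQ.res_right _, .res (.refl _) hTQ⟩

/-! ### Head variables in translations -/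

/-- The head variable, as a term. -/
def HeadVar.toTm : HeadVar → Tm
  | .lin x => .var x
  | .un x i => .uvar x i

theorem HeadVar.sized_toTm : ∀ h : HeadVar, h.toTm.Sized
  | .lin _ => trivial
  | .un _ _ => trivial

theorem HeadVar.toTm_of_lower {k : ℕ} {h h' : HeadVar} (hh : h'.lower k = some h) :
    h'.toTm = h.toTm.rename (fun i => i + k) := by
  cases h' <;> simp only [HeadVar.lower] at hh <;> split_ifs at hh with hk <;>
    obtain rfl := Option.some.inj hh <;>
    simp [HeadVar.toTm, Tm.rename, Nat.sub_add_cancel (not_lt.1 hk)]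

/-- No sharing construct occurs on the path to the head of the term. -/
def Tm.UnsharedHead : Tm → Prop
  | .app M _ _ => M.UnsharedHead
  | .share _ _ _ => False
  | .lsub _ M _ => M.UnsharedHead
  | .usub M _ => M.UnsharedHead
  | _ => True

/-- A term weakened by `k` variables does not mention them, so their names are irrelevant. -/
theorem tr_consN_rename {N : Tm} (hN : N.Sized) (k m d : ℕ) (a : ℕ → ℕ) (ρ : Env) (w : ℕ) :
    (N.rename (fun i => i + k)).tr (((ρ.shift m).consN k a).shift d) w
      = N.tr (ρ.shift (m + d)) w := by
  conv_rhs => rw [← rename_id (N.tr (ρ.shift (m + d)) w)]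
  refine (Tm.tr_natural _ N hN).eq w (fun r i _ => ?_) rfl
  simp [Nat.add_assoc]

theorem tr_cons_rename {N : Tm} (hN : N.Sized) (m d : ℕ) (a : Role → ℕ) (ρ : Env) (w : ℕ) :
    (N.rename Nat.succ).tr (((ρ.shift m).cons a).shift d) w = N.tr (ρ.shift (m + d)) w := by
  conv_rhs => rw [← rename_id (N.tr (ρ.shift (m + d)) w)]
  refine (Tm.tr_natural _ N hN).eq w (fun r i _ => ?_) rfl
  simp [Nat.add_assoc]

/-- The output name `w` of the head is either restricted by `G`, after an application, or the given
`u`. The same `G` serves for every `N`, which is what a head substitution needs. A sharing construct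
on the path would put the head behind prefixes, hence the hypothesis on it. -/
theorem tr_head : ∀ (M : Tm), M.Sized → M.UnsharedHead → ∀ (h : HeadVar), M.head = some h →
    ∀ (ρ : Env) (u : ℕ), ∃ (G : HCtx) (w : ℕ), (w < G.depth ∨ w = u + G.depth) ∧
      SC (M.tr ρ u) (G.fill (h.toTm.tr (ρ.shift G.depth) w)) ∧
      ∀ N : Tm, N.Sized →
        MoreBranches ((M.headSubst N).tr ρ u) (G.commit.fill (N.tr (ρ.shift G.depth) w))
  | .var x, _, _, _, rfl, ρ, u => ⟨.hole, u, Or.inr rfl, SC.refl _, fun _ _ => .refl _⟩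
  | .uvar x i, _, _, _, rfl, ρ, u => ⟨.hole, u, Or.inr rfl, SC.refl _, fun _ _ => .refl _⟩
  | .app M C U, ⟨hM, _, _⟩, hs, h, hh, ρ, u => by
    obtain ⟨G, w, hw, hSC, hMB⟩ := tr_head M hM hs h hh (ρ.shift 1) 0
    refine ⟨.resL G _, w, Or.inl ?_, SC.res_congr ?_ (SC.refl _), fun N hN => ?_⟩
    · simp only [HCtx.depth]; omega
    · rw [HCtx.depth, Nat.add_comm G.depth, ← Env.shift_shift]
      exact hSC
    · rw [HCtx.depth, Nat.add_comm G.depth, ← Env.shift_shift]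
      exact .res (hMB N hN) (.refl _)
  | .lsub k M C, ⟨hk, hM, hC⟩, hs, h, hh, ρ, u => by
    obtain ⟨h', hh', hl⟩ := Option.bind_eq_some_iff.1 hh
    set a : ℕ → ℕ := fun j => C.size - 1 - (List.range k).idxOf j
    have hp : List.range k ∈ (List.range k).permutations' :=
      List.mem_permutations'.2 (List.Perm.refl _)
    obtain ⟨G, w, hw, hSC, hMB⟩ := tr_head M hM hs h' hh' ((ρ.shift C.size).consN k a)
      (u + C.size)
    -- For a linear substitution, the identity permutation is singled out. The commitment drops the
    -- sum beside it, and the translation of the substituted term still contains this summand.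
    refine ⟨.chain C.trs ρ (.nd G (bigNd ((List.range k).permutations'.map (fun p =>
      M.tr ((ρ.shift C.size).consN k (fun j => C.size - 1 - p.idxOf j)) (u + C.size))))), w,
      ?_, ?_, fun N hN => ?_⟩
    · rw [HCtx.chain_depth, HCtx.depth, LBag.length_trs]
      omega
    · rw [HeadVar.toTm_of_lower hl, tr_consN_rename h.sized_toTm] at hSC
      rw [HCtx.chain_depth, HCtx.depth, LBag.length_trs, HCtx.chain_fill]
      exact SC.chain ((SC.bigNd_mem (List.mem_map.2 ⟨_, hp, rfl⟩)).trans
        (SC.nd_congr hSC (SC.refl _))) _ _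
    · have := hMB (N.rename fun i => i + k) ((Tm.sized_rename _ _).2 hN)
      rw [tr_consN_rename hN] at this
      rw [HCtx.chain_depth, HCtx.depth, LBag.length_trs, HCtx.chain_commit, HCtx.chain_fill]
      exact MoreBranches.chain (MoreBranches.bigNd_mem (List.mem_map.2 ⟨_, hp, rfl⟩) this) _ _
  | .usub M U, ⟨hM, _⟩, hs, h, hh, ρ, u => by
    obtain ⟨h', hh', hl⟩ := Option.bind_eq_some_iff.1 hh
    obtain ⟨G, w, hw, hSC, hMB⟩ := tr_head M hM hs h' hh' ((ρ.shift 1).cons fun _ => 0) (u + 1)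
    refine ⟨.resL G _, w, ?_, SC.res_congr ?_ (SC.refl _), fun N hN => ?_⟩
    · simp only [HCtx.depth]; omega
    · rw [HeadVar.toTm_of_lower hl] at hSC
      have := tr_cons_rename h.sized_toTm 1 G.depth (fun _ => 0) ρ w
      rw [HCtx.depth, Nat.add_comm G.depth, ← this]
      exact hSC
    · have := hMB (N.rename Nat.succ) ((Tm.sized_rename _ _).2 hN)
      rw [tr_cons_rename hN] at this
      rw [HCtx.depth, Nat.add_comm G.depth]
      exact .res this (.refl _)

/-! ### Consequences of well-formedness -/

theorem MTy.pow_injective {σ σ' : STy} : ∀ {k k' : ℕ}, MTy.pow σ k = MTy.pow σ' k' → k = k'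
  | 0, 0, _ => rfl
  | k + 1, k' + 1, h => by
    rw [MTy.pow, MTy.pow] at h
    injection h with _ h
    rw [MTy.pow_injective h]
  | 0, k' + 1, h => by simp [MTy.pow] at h
  | k + 1, 0, h => by simp [MTy.pow] at h

theorem LTy.toList_append : ∀ η ε : LTy, (η.append ε).toList = η.toList ++ ε.toList
  | .one _, _ => rfl
  | .cons _ η, ε => by simp [LTy.append, LTy.toList, η.toList_append ε]

mutual
theorem WfTm.sized : ∀ {Θ Γ M τ}, WfTm Θ Γ M τ → M.Sized
  | _, _, _, _, .var .. => trivial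
  | _, _, _, _, .uvar .. => trivial
  | _, _, _, _, .fail .. => trivial
  | _, _, _, _, .weak _ _ h => h.sized
  | _, _, _, _, .shar _ _ _ _ _ h => h.sized
  | _, _, _, _, .abs _ _ _ _ h => h.sized
  | _, _, _, _, .app _ _ _ _ _ _ hM hC hU _ => ⟨hM.sized, hC.sized.1, hU.sized⟩
  | _, _, _, _, .usub _ _ hM hU _ => ⟨hM.sized, hU.sized⟩
  | _, _, _, _, .esub _ _ _ _ _ _ _ hM hC hU _ => ⟨hM.sized, hC.sized.1, hU.sized⟩
  | _, _, _, _, .lsub _ _ _ hM hC => ⟨hC.sized.2 rfl, hM.sized, hC.sized.1⟩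
-- The second part makes the size of a bag readable from its type: the exponent of a power is
-- determined by the multiset type.
theorem WfLBag.sized : ∀ {Θ Γ C π}, WfLBag Θ Γ C π →
    C.Sized ∧ ∀ {σ k}, π = MTy.pow σ k → C.size = k
  | _, _, _, _, .one _ => ⟨trivial, fun {σ k} h => MTy.pow_injective (k := 0) (σ := σ) h⟩
  | _, _, _, _, .cons _ _ _ hM hC =>
    ⟨⟨hM.sized, hC.sized.1⟩, fun h => by
      rw [← MTy.pow_injective h, LBag.size, hC.sized.2 rfl]⟩
theorem WfUBag.sized : ∀ {Θ U η}, WfUBag Θ U η → U.Sized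
  | _, _, _, .one .. => trivial
  | _, _, _, .single _ hM => hM.sized
  | _, _, _, .cat _ _ hU hV => ⟨hU.sized, hV.sized⟩
end

/-- The variables that occur linearly or as sharing variables are those in the domain of the
context, and the sharing ones have multiset types. -/
def LCtx.Types (Γ : LCtx) (F : Role → Finset ℕ) : Prop :=
  ∀ x, ((x ∈ F .lin ∨ x ∈ F .shr) ↔ Γ x ≠ none) ∧ (x ∈ F .shr → ∃ π, Γ x = some (.multi π))

theorem LCtx.Types.join {Γ Δ : LCtx} {F G : Role → Finset ℕ} (hF : Γ.Types F) (hG : Δ.Types G)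
    (hd : Γ.Disj Δ) : (Γ.join Δ).Types fun r => F r ∪ G r := by
  intro x
  obtain ⟨h1, h2⟩ := hF x
  obtain ⟨h3, h4⟩ := hG x
  simp only [Finset.mem_union, LCtx.join]
  rcases hd x with h | h
  · have hl : x ∉ F .lin := fun hx => (h1.1 (Or.inl hx)) h
    have hs : x ∉ F .shr := fun hx => (h1.1 (Or.inr hx)) h
    simpa [h, hl, hs] using ⟨h3, h4⟩
  · have hl : x ∉ G .lin := fun hx => (h3.1 (Or.inl hx)) h
    have hs : x ∉ G .shr := fun hx => (h3.1 (Or.inr hx)) h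
    simpa [h, hl, hs] using ⟨h1, h2⟩

theorem LCtx.Types.lower {Γ Δ : LCtx} {F : Role → Finset ℕ} (k : ℕ) (hF : Γ.Types F)
    (h : ∀ i, Γ (i + k) = Δ i) : Δ.Types fun r => lower k (F r) := by
  intro x
  simpa only [mem_lower, h] using hF (x + k)

theorem LCtx.Types.union_of_empty {Γ : LCtx} {F G : Role → Finset ℕ} (hF : Γ.Types F)
    (hl : G .lin = ∅) (hs : G .shr = ∅) : Γ.Types fun r => F r ∪ G r := by
  intro x
  simpa [hl, hs] using hF x

theorem LCtx.Types.add_shr {Γ : LCtx} {F : Role → Finset ℕ} (hF : Γ.Types F) (x : ℕ) (π : MTy)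
    (hx : Γ x = none) :
    (Γ.add x (.multi π)).Types fun r => F r ∪ (if r = .shr then {x} else ∅) := by
  intro y
  obtain ⟨h1, h2⟩ := hF y
  by_cases hy : y = x
  · subst hy
    simp [LCtx.add]
  · simpa [LCtx.add, hy] using ⟨h1, h2⟩

theorem LCtx.ext_add (k : ℕ) (a : Asg) (Γ : LCtx) (i : ℕ) : Γ.ext k a (i + k) = Γ i := by
  simp [LCtx.ext]

theorem LCtx.lift_add (k : ℕ) (Γ : LCtx) (i : ℕ) : Γ.lift k (i + k) = Γ i := by
  simp [LCtx.lift]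

mutual
-- Induction on typing. An unrestricted occurrence uses a linear hypothesis that its conclusion
-- removes, and failure is typed in a core context, so neither disturbs the domain.
theorem WfTm.types : ∀ {Θ Γ M τ}, WfTm Θ Γ M τ → Γ.Types M.fv
  | _, _, _, _, .var Θ x σ => fun y => by
    by_cases h : y = x <;> simp [Tm.fv, LCtx.add, LCtx.empty, h]
  | _, _, _, _, .uvar Θ Δ x i η δ σ hη hi hx h => fun y => by
    have h' := h.types y
    by_cases hy : y = x
    · subst hy
      simp [Tm.fv, hx]
    · simpa [Tm.fv, LCtx.add, hy] using h'
  | _, _, _, _, .fail Θ Γ xs τ hxs h => fun y => by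
    simpa [Tm.fv] using h y
  | _, _, _, _, .weak x hx h =>
    LCtx.Types.add_shr (h.types.lower 0 fun _ => rfl) x _ hx
  | _, _, _, _, .shar k x σ hk hx h =>
    LCtx.Types.add_shr (h.types.lower k fun i => LCtx.ext_add k _ _ i) x _ hx
  | _, _, _, _, .abs n k σ η h => h.types.lower 1 fun i => LCtx.ext_add 1 _ _ i
  | _, _, _, _, .app j k σ η ε hd hM hC hU _ =>
    (hM.types.join hC.types hd).union_of_empty (hU.fv_empty _ (by simp)) (hU.fv_empty _ (by simp))
  | _, _, _, _, .usub η ε hM hU _ =>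
    (hM.types.lower 1 fun i => LCtx.lift_add 1 _ i).union_of_empty (hU.fv_empty _ (by simp))
      (hU.fv_empty _ (by simp))
  | _, _, _, _, .esub n j k σ η ε hd hM hC hU _ =>
    (LCtx.Types.join (hM.types.lower 1 fun i => LCtx.ext_add 1 _ _ i) hC.types
      hd).union_of_empty (hU.fv_empty _ (by simp)) (hU.fv_empty _ (by simp))
  | _, _, _, _, .lsub k σ hd hM hC =>
    LCtx.Types.join (hM.types.lower k fun i => LCtx.ext_add k _ _ i) hC.types hd
theorem WfLBag.types : ∀ {Θ Γ C π}, WfLBag Θ Γ C π → Γ.Types C.fv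
  | _, _, _, _, .one _ => fun x => by simp [LBag.fv, LCtx.empty]
  | _, _, _, _, .cons _ _ hd hM hC => hM.types.join hC.types hd
theorem WfUBag.fv_empty : ∀ {Θ U η}, WfUBag Θ U η → ∀ r, r ≠ .un → U.fv r = ∅
  | _, _, _, .one .., _, _ => rfl
  | _, _, _, .single _ hM, r, hr => by
    have := hM.types
    refine Finset.eq_empty_of_forall_notMem fun x hx => ?_
    have h := (this x).1
    simp only [LCtx.empty, ne_eq, not_true_eq_false, iff_false, not_or] at h
    cases r
    · exact h.1 hx
    · exact h.2 hx
    · exact hr rfl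
  | _, _, _, .cat _ _ hU hV, r, hr => by
    simp [UBag.fv, hU.fv_empty r hr, hV.fv_empty r hr]
end

/-- An unrestricted bag has as many positions as its type has entries, so an index allowed by typing
is a label that the server offers. -/
theorem WfUBag.length_positions {Θ : UCtx} : ∀ {U : UBag} {η : LTy}, WfUBag Θ U η →
    U.positions.length = η.toList.length
  | .one, _, .one _ _ => rfl
  | .single _, _, .single _ _ => rfl
  | .cat U V, _, .cat _ _ hU hV => by
    simp [UBag.positions, LTy.toList_append, hU.length_positions, hV.length_positions]

/-- No variable has a multiset type. -/
def LCtx.Strict (Γ : LCtx) : Prop := ∀ x π, Γ x ≠ some (.multi π)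

theorem LCtx.Strict.left {Γ Δ : LCtx} (h : (Γ.join Δ).Strict) : Γ.Strict :=
  fun x π hx => h x π (by simp [LCtx.join, hx])

theorem LCtx.Strict.right {Γ Δ : LCtx} (h : (Γ.join Δ).Strict) (hd : Γ.Disj Δ) : Δ.Strict :=
  fun x π hx => h x π (by rcases hd x with h | h <;> simp_all [LCtx.join])

theorem LCtx.Strict.ext {Γ : LCtx} (h : Γ.Strict) (k : ℕ) (σ : STy) :
    (Γ.ext k (.strict σ)).Strict := fun x π hx => by
  unfold LCtx.ext at hx
  split_ifs at hx
  · cases hx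
  · exact h _ _ hx

theorem LCtx.Strict.lift {Γ : LCtx} (h : Γ.Strict) (k : ℕ) : (Γ.lift k).Strict := fun x π hx => by
  unfold LCtx.lift at hx
  split_ifs at hx
  exact h _ _ hx

theorem LCtx.Types.shr_empty {Γ : LCtx} {F : Role → Finset ℕ} (h : Γ.Types F) (hΓ : Γ.Strict) :
    F .shr = ∅ :=
  Finset.eq_empty_of_forall_notMem fun x hx =>
    let ⟨π, hπ⟩ := (h x).2 hx
    hΓ x π hπ

theorem LCtx.Types.mem_lin {Γ : LCtx} {F : Role → Finset ℕ} (h : Γ.Types F) (hΓ : Γ.Strict)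
    (x : ℕ) : x ∈ F .lin ↔ Γ x ≠ none := by
  simpa [h.shr_empty hΓ] using (h x).1

theorem LCtx.not_strict_add (Γ : LCtx) (x : ℕ) (π : MTy) : ¬ (Γ.add x (.multi π)).Strict :=
  fun h => h x π (by simp [LCtx.add])

/-- A sharing construct types its sharing variable with a multiset type, contrary to strictness. The
binders passed on the way to the head add strict or no assignments. -/
theorem WfTm.unsharedHead {M : Tm} : ∀ {Θ : UCtx} {Γ : LCtx} {τ : STy}, WfTm Θ Γ M τ →
    Γ.Strict → M.UnsharedHead
  | _, _, _, .var .., _ => trivial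
  | _, _, _, .uvar .., _ => trivial
  | _, _, _, .fail .., _ => trivial
  | _, _, _, .weak .., hΓ => (LCtx.not_strict_add _ _ _ hΓ).elim
  | _, _, _, .shar .., hΓ => (LCtx.not_strict_add _ _ _ hΓ).elim
  | _, _, _, .abs .., _ => trivial
  | _, _, _, .app _ _ _ _ _ _ hM _ _ _, hΓ => hM.unsharedHead hΓ.left
  | _, _, _, .usub _ _ hM _ _, hΓ => hM.unsharedHead (hΓ.lift 1)
  | _, _, _, .esub .., _ => trivial
  | _, _, _, .lsub k σ _ hM _, hΓ => hM.unsharedHead (hΓ.left.ext k σ)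

theorem HeadVar.eq_of_lower_un {k x i : ℕ} {h : HeadVar} (hh : h.lower k = some (.un x i)) :
    h = .un (x + k) i := by
  cases h <;> simp only [HeadVar.lower] at hh <;> split_ifs at hh with hk
  · cases hh
  · simp only [Option.some.injEq, HeadVar.un.injEq] at hh
    obtain ⟨rfl, rfl⟩ := hh
    rw [Nat.sub_add_cancel (not_lt.1 hk)]

theorem WfTm.head_un {M : Tm} : ∀ {Θ : UCtx} {Γ : LCtx} {τ : STy}, WfTm Θ Γ M τ →
    M.UnsharedHead → ∀ {x i : ℕ}, M.head = some (.un x i) →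
      ∃ η, Θ x = some η ∧ 1 ≤ i ∧ i ≤ η.toList.length
  | _, _, _, .var .., _, _, _, h => by simp [Tm.head] at h
  | _, _, _, .uvar _ _ _ _ η _ _ hη hi _ _, _, _, _, h => by
    simp only [Tm.head, Option.some.injEq, HeadVar.un.injEq] at h
    obtain ⟨rfl, rfl⟩ := h
    exact ⟨η, hη, by omega, (List.getElem?_eq_some_iff.1 hi).1⟩
  | _, _, _, .fail .., _, _, _, h => by simp [Tm.head] at h
  | _, _, _, .weak .., hs, _, _, _ => hs.elim
  | _, _, _, .shar .., hs, _, _, _ => hs.elim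
  | _, _, _, .abs .., _, _, _, h => by simp [Tm.head] at h
  | _, _, _, .app _ _ _ _ _ _ hM _ _ _, hs, _, _, h => hM.head_un hs h
  | _, _, _, .usub _ _ hM _ _, hs, _, _, h => by
    obtain ⟨h', hh', hl⟩ := Option.bind_eq_some_iff.1 h
    rw [HeadVar.eq_of_lower_un hl] at hh'
    simpa [UCtx.ext] using hM.head_un hs hh'
  | _, _, _, .esub .., _, _, _, h => by simp [Tm.head] at h
  | _, _, _, .lsub k σ _ hM _, hs, _, _, h => by
    obtain ⟨h', hh', hl⟩ := Option.bind_eq_some_iff.1 h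
    rw [HeadVar.eq_of_lower_un hl] at hh'
    simpa [UCtx.lift] using hM.head_un hs hh'

theorem WfTm.share_inv {Θ : UCtx} {Γ : LCtx} {k x : ℕ} {M : Tm} {τ : STy}
    (h : WfTm Θ Γ (.share k x M) τ) : ∃ Θ' Γ₀ π σ, Γ = LCtx.add Γ₀ x (.multi π) ∧ Γ₀ x = none ∧
      WfTm Θ' (LCtx.ext k (.strict σ) Γ₀) M τ := by
  cases h with
  | weak _ hx h =>
    -- For `k = 0` the context is not extended, so the strict type is arbitrary.
    refine ⟨Θ, _, _, .unit, rfl, hx, ?_⟩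
    convert h using 1
    funext i
    simp [LCtx.ext]
  | shar _ _ σ hk hx h => exact ⟨_, _, _, _, rfl, hx, h⟩

/-- The context of the body in index form: the shared variables below `k` are strict, the
substituted variable `k` is absent, and the outer context starts at `k + 1`. -/
theorem WfTm.esub_inv {Θ : UCtx} {Γ : LCtx} {k : ℕ} {M : Tm} {C : LBag} {U : UBag} {τ : STy}
    (h : WfTm Θ Γ (.esub (.share k 0 M) C U) τ) :
    ∃ Γ₁ Δ Θ' Γ' π ε, Γ = LCtx.join Γ₁ Δ ∧ LCtx.Disj Γ₁ Δ ∧ WfTm Θ' Γ' M τ ∧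
      (∀ i < k, ∃ σ, Γ' i = some (.strict σ)) ∧ Γ' k = none ∧ (∀ i, Γ' (i + (k + 1)) = Γ₁ i) ∧
      WfLBag Θ Δ C π ∧ WfUBag Θ U ε := by
  cases h with
  | esub n j m σ η ε hd hM hC hU he =>
    obtain ⟨Θ', Γ₀, π, σ', h1, h2, h3⟩ := hM.share_inv
    refine ⟨_, _, Θ', _, _, _, rfl, hd, h3, fun i hi => ⟨σ', if_pos hi⟩, ?_, fun i => ?_, hC, hU⟩
    · simpa [LCtx.ext] using h2
    · have := congrFun h1 (i + 1)
      rw [LCtx.ext_add] at this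
      rw [Nat.add_comm k 1, ← Nat.add_assoc, LCtx.ext_add, this]
      simp [LCtx.add]

/-! ### Names of the free variables -/

theorem Env.names_of_shr_empty {F : Role → Finset ℕ} (h : F .shr = ∅) (ρ : Env) :
    ρ.names F = (F .lin).image (ρ .lin) := by
  simp [Env.names, h]

theorem disjoint_image_of_injOn {f : ℕ → ℕ} {S A B : Finset ℕ} (hf : Set.InjOn f S) (hA : A ⊆ S)
    (hB : B ⊆ S) (h : Disjoint A B) : Disjoint (A.image f) (B.image f) := by
  rw [Finset.disjoint_left] at h ⊢
  intro a ha hb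
  obtain ⟨x, hx, rfl⟩ := Finset.mem_image.1 ha
  obtain ⟨y, hy, hxy⟩ := Finset.mem_image.1 hb
  obtain rfl := hf (hB hy) (hA hx) hxy
  exact h hx hy

theorem LCtx.Types.disjoint_lin {Γ Δ : LCtx} {F G : Role → Finset ℕ} (hF : Γ.Types F)
    (hG : Δ.Types G) (hd : Γ.Disj Δ) : Disjoint (F .lin) (G .lin) :=
  Finset.disjoint_left.2 fun x hx hy =>
    (hd x).elim ((hF x).1.1 (Or.inl hx)) ((hG x).1.1 (Or.inl hy))

/-- Linear typing splits the context among the elements of a bag, and injectivity transports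
disjointness from variables to names. -/
theorem WfLBag.namesDisjoint {Θ : UCtx} {ρ : Env} : ∀ {C : LBag} {Γ : LCtx} {π : MTy},
    WfLBag Θ Γ C π → Γ.Strict → Set.InjOn (ρ .lin) (C.fv .lin) → C.NamesDisjoint ρ
  | .one, _, _, _, _, _ => trivial
  | .cons M C, _, _, .cons _ _ hd hM hC, hΓ, hρ => by
    have hC' := hΓ.right hd
    refine ⟨?_, hC.namesDisjoint hC' (hρ.mono ?_)⟩
    · rw [Env.names_of_shr_empty (hM.types.shr_empty hΓ.left),
        Env.names_of_shr_empty (hC.types.shr_empty hC')]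
      exact disjoint_image_of_injOn hρ Finset.subset_union_left Finset.subset_union_right
        (hM.types.disjoint_lin hC.types hd)
    · exact_mod_cast Finset.subset_union_right

theorem LBag.llfv_eq {C : LBag} (h : C.fv .shr = ∅) : C.llfv = C.fv .lin := by
  simp [LBag.llfv, h]

/-! ### Failure -/

theorem Proc.NonesTo.reds_fail {P : Proc} {ρ : Env} {u : ℕ} {zs : List ℕ}
    (h : NonesTo P (insert u (zs.toFinset.image (ρ .lin)))) (hzs : zs.Nodup)
    (hρ : Set.InjOn (ρ .lin) zs.toFinset) (hu : ∀ x ∈ zs, ρ .lin x ≠ u) :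
    Reds P ((Tm.fail zs).tr ρ u) := by
  refine NonesTo.reds (L := u :: zs.map (ρ .lin)) ?_ ?_
  · convert h using 1
    ext
    simp
  · refine List.nodup_cons.2 ⟨fun h => ?_, hzs.map_on fun x hx y hy => ?_⟩
    · obtain ⟨x, hx, h⟩ := List.mem_map.1 h
      exact hu x hx h
    · exact hρ (by simpa using hx) (by simpa using hy)

theorem nonesTo_fail {ρ : Env} {u : ℕ} {xs : List ℕ} (hxs : xs.Nodup)
    (hρ : Set.InjOn (ρ .lin) xs.toFinset) (hu : ∀ x ∈ xs, ρ .lin x ≠ u) :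
    NonesTo ((Tm.fail xs).tr ρ u) (insert u (xs.toFinset.image (ρ .lin))) := by
  have h : (u :: xs.map (ρ .lin)).Nodup := by
    refine List.nodup_cons.2 ⟨fun h => ?_, hxs.map_on fun x hx y hy => ?_⟩
    · obtain ⟨x, hx, h⟩ := List.mem_map.1 h
      exact hu x hx h
    · exact hρ (by simpa using hx) (by simpa using hy)
  have h' : insert u (xs.toFinset.image (ρ .lin)) = (u :: xs.map (ρ .lin)).toFinset := by
    ext
    simp
  rw [h']
  exact NonesTo.nones h

/-- The failed process no longer mentions the server, which structural congruence then collects. -/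
theorem Proc.NonesTo.res_srv {P X : Proc} {S : Finset ℕ} (h : NonesTo P (S.image Nat.succ)) :
    NonesTo (res P (srv 0 X)) S := by
  refine ⟨S.toList, S.nodup_toList, by simp, ?_⟩
  have : Reds P (rename Nat.succ (Proc.nones S.toList)) := by
    rw [rename_nones]
    refine NonesTo.reds ?_ ((List.nodup_map_iff Nat.succ_injective).2 S.nodup_toList)
    convert h using 1
    ext
    simp
  exact (this.res_left _).trans ((SC.res_comm _ _).trans (SC.res_srv _ _)).reds

-- Environments of linear substitutions

/-- The names of the variables of a linear substitution, for the order `p` of the elements. -/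
def substEnv (k : ℕ) (p : List ℕ) (ρ : Env) : Env :=
  (ρ.shift k).consN k fun j => k - 1 - p.idxOf j

/-- The name of a bound variable determines its position in `p`; this is the source of injectivity.
-/
theorem substEnv_lt {k : ℕ} {p : List ℕ} (hp : p.Perm (List.range k)) (ρ : Env) (r : Role) {j : ℕ}
    (hj : j < k) : substEnv k p ρ r j < k ∧ k - 1 - substEnv k p ρ r j = p.idxOf j := by
  have h1 : p.idxOf j < p.length := List.idxOf_lt_length_of_mem (hp.mem_iff.2 (by simpa))
  have h2 : p.length = k := by simpa using hp.length_eq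
  rw [substEnv, Env.consN_lt _ _ _ hj]
  omega

theorem substEnv_add (k : ℕ) (p : List ℕ) (ρ : Env) (r : Role) (j : ℕ) :
    substEnv k p ρ r (j + k) = ρ r j + k := by simp [substEnv]

theorem substEnv_injOn {k : ℕ} {p : List ℕ} (hp : p.Perm (List.range k)) {ρ : Env} {r : Role}
    {S : Finset ℕ} (hρ : Set.InjOn (ρ r) (lower k S)) : Set.InjOn (substEnv k p ρ r) S := by
  intro i hi j hj h
  by_cases hik : i < k <;> by_cases hjk : j < k
  · have h1 := (substEnv_lt hp ρ r hik).2
    have h2 := (substEnv_lt hp ρ r hjk).2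
    rw [h, h2] at h1
    exact (List.idxOf_inj (hp.mem_iff.2 (by simpa using hjk))).1 h1 |>.symm
  · have h1 := (substEnv_lt hp ρ r hik).1
    obtain ⟨b, rfl⟩ := Nat.exists_eq_add_of_le' (not_lt.1 hjk)
    rw [h, substEnv_add] at h1
    omega
  · have h1 := (substEnv_lt hp ρ r hjk).1
    obtain ⟨a, rfl⟩ := Nat.exists_eq_add_of_le' (not_lt.1 hik)
    rw [← h, substEnv_add] at h1
    omega
  · obtain ⟨a, rfl⟩ := Nat.exists_eq_add_of_le' (not_lt.1 hik)
    obtain ⟨b, rfl⟩ := Nat.exists_eq_add_of_le' (not_lt.1 hjk)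
    rw [substEnv_add, substEnv_add, Nat.add_right_cancel_iff] at h
    rw [hρ (mem_lower.2 hi) (mem_lower.2 hj) h]

theorem substEnv_ne {k : ℕ} {p : List ℕ} (hp : p.Perm (List.range k)) {ρ : Env} {r : Role}
    {S : Finset ℕ} {u : ℕ} (hu : ∀ x ∈ lower k S, ρ r x ≠ u) :
    ∀ x ∈ S, substEnv k p ρ r x ≠ u + k := by
  intro x hx
  by_cases hk : x < k
  · have := (substEnv_lt hp ρ r hk).1
    omega
  · obtain ⟨a, rfl⟩ := Nat.exists_eq_add_of_le' (not_lt.1 hk)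
    rw [substEnv_add]
    have := hu a (mem_lower.2 hx)
    omega

/-- A permutation only rearranges the `k` restricted names, so the image does not depend on `p`. All
summands of a failed linear substitution thus release the same names. -/
theorem substEnv_image {k : ℕ} {p : List ℕ} (hp : p.Perm (List.range k)) (ρ : Env) (r : Role)
    {S : Finset ℕ} (hS : Finset.range k ⊆ S) :
    S.image (substEnv k p ρ r)
      = Finset.range k ∪ ((lower k S).image (ρ r)).image (fun i => i + k) := by
  ext a
  simp only [Finset.mem_union, Finset.mem_image, Finset.mem_range]
  constructor
  · rintro ⟨x, hx, rfl⟩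
    by_cases hk : x < k
    · exact Or.inl (substEnv_lt hp ρ r hk).1
    · obtain ⟨b, rfl⟩ := Nat.exists_eq_add_of_le' (not_lt.1 hk)
      exact Or.inr ⟨_, ⟨b, mem_lower.2 hx, rfl⟩, (substEnv_add k p ρ r b).symm⟩
  · rintro (ha | ⟨_, ⟨b, hb, rfl⟩, rfl⟩)
    · have h2 : p.length = k := by simpa using hp.length_eq
      have hn : p.Nodup := hp.nodup_iff.2 List.nodup_range
      have hi : k - 1 - a < p.length := by omega
      have hj : p[k - 1 - a] < k := by simpa using hp.mem_iff.1 (List.getElem_mem hi)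
      refine ⟨p[k - 1 - a], hS (by simpa using hj), ?_⟩
      have := substEnv_lt hp ρ r hj
      rw [hn.idxOf_getElem] at this
      omega
    · exact ⟨b + k, mem_lower.1 hb, substEnv_add k p ρ r b⟩

theorem nonesTo_fail_substEnv {k : ℕ} {p : List ℕ} (hp : p.Perm (List.range k)) {ρ : Env} {u : ℕ}
    {xs : List ℕ} (hxs : xs.Nodup) (hk : Finset.range k ⊆ xs.toFinset)
    (hρ : Set.InjOn (ρ .lin) (lower k xs.toFinset)) (hu : ∀ x ∈ lower k xs.toFinset, ρ .lin x ≠ u) :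
    NonesTo ((Tm.fail xs).tr (substEnv k p ρ) (u + k))
      (Finset.range k ∪
        (insert u ((lower k xs.toFinset).image (ρ .lin))).image (fun i => i + k)) := by
  have := nonesTo_fail hxs (substEnv_injOn hp hρ) fun x hx => substEnv_ne hp hu x (by simpa using hx)
  rwa [substEnv_image hp ρ .lin hk, ← Finset.union_insert,
    ← Finset.image_insert (fun i => i + k)] at this

theorem tr_lsub (k : ℕ) (M : Tm) (C : LBag) (hC : C.size = k) (ρ : Env) (u : ℕ) :
    (Tm.lsub k M C).tr ρ u = chain C.trs ρ (bigNd ((List.range k).permutations'.map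
      (fun p => M.tr (substEnv k p ρ) (u + k)))) := by
  subst hC
  rfl

theorem tr_esub_chain {k : ℕ} {M : Tm} {C : LBag} {U : UBag} (hM : M.Sized) (hC : C.Sized)
    (hU : U.Sized) (hlin : k ∉ M.fv .lin) (hshr : k ∉ M.fv .shr) (hk : C.size = k) (ρ : Env)
    (u : ℕ) :
    Reds ((Tm.esub (.share k 0 M) C U).tr ρ u)
      (res
        (chain C.trs (ρ.shift 1)
          (M.tr (substEnv k (List.range k) ((ρ.shift 1).cons fun _ => 0)) (u + 1 + k)))
        (srv 0 (positions U.trs (ρ.shift 2) 0))) := by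
  refine (tr_esub_open hM hC hU hlin hshr ρ u).trans (Reds.res_left _ ?_)
  have := tr_share_eq_size (Tm.tr_natural_id hM) C (List.range k) hC (by simpa using hk)
    (ρ.shift 1) (((ρ.shift 1).cons fun _ => 0).consN k fun _ => 0) (u + 1)
  rw [List.length_range] at this
  convert this using 3
  -- Receiving the variables in the order `0, …, k - 1` produces exactly the environment of the
  -- identity permutation.
  funext r j
  rw [shareEnv_apply _ List.nodup_range]
  by_cases hj : j < k
  · simp [hj, substEnv, Env.consN_lt]
  · obtain ⟨b, rfl⟩ := Nat.exists_eq_add_of_le' (not_lt.1 hj)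
    simp [substEnv_add]

theorem image_cons_lower {S : Finset ℕ} (k : ℕ) (hk : k ∉ S) (ρ : Env) (r : Role) (a : Role → ℕ) :
    (lower k S).image (((ρ.shift 1).cons a) r)
      = ((lower (k + 1) S).image (ρ r)).image Nat.succ := by
  ext b
  simp only [Finset.mem_image, mem_lower]
  constructor
  · rintro ⟨_ | i, hi, rfl⟩
    · exact absurd hi (by simpa using hk)
    · exact ⟨_, ⟨i, by rwa [show i + (k + 1) = i + 1 + k by omega], rfl⟩, rfl⟩
  · rintro ⟨_, ⟨i, hi, rfl⟩, rfl⟩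
    exact ⟨i + 1, by rwa [show i + 1 + k = i + (k + 1) by omega], rfl⟩

/-! ### The reduction rules -/

theorem Tm.sized_headSubst : ∀ {M N : Tm}, M.Sized → N.Sized → (M.headSubst N).Sized
  | .var _, _, _, hN => hN
  | .uvar _ _, _, _, hN => hN
  | .abs _, _, hM, _ => hM
  | .app _ _ _, _, ⟨hM, hC, hU⟩, hN => ⟨Tm.sized_headSubst hM hN, hC, hU⟩
  | .fail _, _, _, _ => trivial
  | .share _ _ M, _, hM, hN => Tm.sized_headSubst (M := M) hM ((Tm.sized_rename _ _).2 hN)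
  | .esub _ _ _, _, hM, _ => hM
  | .lsub _ _ _, _, ⟨hk, hM, hC⟩, hN =>
    ⟨hk, Tm.sized_headSubst hM ((Tm.sized_rename _ _).2 hN), hC⟩
  | .usub _ _, _, ⟨hM, hU⟩, hN => ⟨Tm.sized_headSubst hM ((Tm.sized_rename _ _).2 hN), hU⟩

theorem LBag.sized_get? : ∀ {C : LBag} {i : ℕ} {N : Tm}, C.Sized → C.get? i = some N → N.Sized
  | .cons _ _, 0, _, ⟨hM, _⟩, rfl => hM
  | .cons _ _, _ + 1, _, ⟨_, hC⟩, h => LBag.sized_get? hC h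

theorem LBag.lt_size_of_get? : ∀ {C : LBag} {i : ℕ} {N : Tm}, C.get? i = some N → i < C.size
  | .cons _ _, 0, _, _ => Nat.succ_pos _
  | .cons _ _, _ + 1, _, h => Nat.succ_lt_succ (LBag.lt_size_of_get? h)

theorem LBag.size_remove : ∀ {C : LBag} {i : ℕ}, i < C.size → (C.remove i).size = C.size - 1
  | .cons _ _, 0, _ => rfl
  | .cons _ C, i + 1, h => by
    have h : i < C.size := Nat.lt_of_succ_lt_succ h
    simp only [LBag.remove, LBag.size, LBag.size_remove h]
    omega

theorem UBag.trs_getD : ∀ (U : UBag) (i : ℕ) {p : Option Tm}, U.positions[i]? = some p →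
    ∀ d, U.trs.getD i d = match p with
      | none => fun _ x => .pnone x
      | some N => fun ρ x => N.tr ρ x
  | .one, 0, _, rfl, _ => rfl
  | .single _, 0, _, rfl, _ => rfl
  | .cat U V, i, p, h, d => by
    simp only [UBag.trs, UBag.positions] at h ⊢
    by_cases hi : i < U.positions.length
    · rw [List.getElem?_append_left hi] at h
      rw [List.getD_append _ _ _ _ (by rwa [UBag.length_trs])]
      exact U.trs_getD i h d
    · rw [List.getElem?_append_right (not_lt.1 hi)] at h
      rw [List.getD_append_right _ _ _ _ (by rw [UBag.length_trs]; exact not_lt.1 hi),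
        UBag.length_trs]
      exact V.trs_getD _ h d

theorem UBag.sized_positions : ∀ {U : UBag} {N : Tm}, U.Sized → some N ∈ U.positions → N.Sized
  | .one, _, _, h => by simp [UBag.positions] at h
  | .single _, _, hU, h => by
    simp only [UBag.positions, List.mem_singleton, Option.some.injEq] at h
    exact h ▸ hU
  | .cat _ _, _, ⟨hU, hV⟩, h =>
    (List.mem_append.1 h).elim (UBag.sized_positions hU) (UBag.sized_positions hV)

/-- The protocol leaves one distribution of the elements, while the target is the sum over all of
them; the identity summand covers it. -/
theorem tr_exSub {k : ℕ} {M : Tm} {C : LBag} {U : UBag} (hM : M.Sized) (hC : C.Sized)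
    (hU : U.Sized) (hlin : k ∉ M.fv .lin) (hshr : k ∉ M.fv .shr) (hk : C.size = k) (ρ : Env)
    (u : ℕ) : ∃ Q, Reds ((Tm.esub (.share k 0 M) C U).tr ρ u) Q ∧
      MoreBranches ((Tm.usub (.lsub k M (C.rename Nat.succ)) U).tr ρ u) Q := by
  refine ⟨_, tr_esub_chain hM hC hU hlin hshr hk ρ u, ?_⟩
  rw [Tm.tr, tr_lsub _ _ _ (by simpa using hk)]
  refine .res ?_ (.refl _)
  have := LBag.chain_natural Nat.succ C id (ρ.shift 1) ((ρ.shift 1).cons fun _ => 0)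
    (M.tr (substEnv k (List.range k) ((ρ.shift 1).cons fun _ => 0)) (u + 1 + k)) hC
    (fun _ _ _ => rfl)
  rw [up_id, rename_id, rename_id] at this
  rw [← this]
  refine MoreBranches.chain (MoreBranches.bigNd_mem (List.mem_map.2 ⟨List.range k, ?_, rfl⟩)
    (.refl _)) _ _
  exact List.mem_permutations'.2 (List.Perm.refl _)

/-- List the indices other than `j` in increasing order and insert `j` at position `i`. -/
theorem exists_perm_range (k i j : ℕ) (hi : i ≤ k) (hj : j ≤ k) :
    ∃ p : List ℕ, p.Perm (List.range (k + 1)) ∧ p.idxOf j = i ∧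
      ∀ a < k, p.idxOf (skip j a) = skip i a := by
  set l := (List.range k).map (skip j) with hl
  have hll : l.length = k := by simp [hl]
  have hskip : (skip j).Injective := by
    rw [skip_eq_up]; exact up_injective _ Nat.succ_injective
  have hjl : j ∉ l := by
    simp only [hl, List.mem_map, not_exists, not_and]
    intro a _ h
    unfold skip at h
    split_ifs at h <;> omega
  have hnd : (j :: l).Nodup :=
    List.nodup_cons.2 ⟨hjl, (List.nodup_map_iff hskip).2 List.nodup_range⟩
  have hpl : (l.insertIdx i j).Perm (j :: l) := List.perm_insertIdx j l (by omega)
  have hn : (l.insertIdx i j).Nodup := hpl.nodup_iff.2 hnd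
  have hlen : (l.insertIdx i j).length = k + 1 := by simpa [hll] using hpl.length_eq
  refine ⟨l.insertIdx i j, hpl.trans ?_, ?_, fun a ha => ?_⟩
  · refine (List.subperm_of_subset hnd fun a ha => ?_).perm_of_length_le (by simp [hll])
    rcases List.mem_cons.1 ha with rfl | ha
    · simpa using Nat.lt_succ_of_le hj
    · obtain ⟨b, hb, rfl⟩ := List.mem_map.1 ha
      rw [List.mem_range] at hb ⊢
      unfold skip
      split_ifs <;> omega
  · have := hn.idxOf_getElem i (by omega)
    rwa [List.getElem_insertIdx_self] at this
  · have h1 : skip i a < (l.insertIdx i j).length := by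
      rw [hlen]; unfold skip; split_ifs <;> omega
    have h2 : (l.insertIdx i j)[skip i a] = skip j a := by
      by_cases hai : a < i
      · have h3 : skip i a = a := if_pos hai
        simp only [h3]
        rw [List.getElem_insertIdx_of_lt hai]
        simp [hl]
      · have h3 : skip i a = a + 1 := if_neg hai
        simp only [h3]
        rw [List.getElem_insertIdx_of_gt (by omega)]
        simp [hl]
    have := hn.idxOf_getElem _ h1
    rwa [h2] at this

/-- In the summand of the permutation from `exists_perm_range`, the head `x_j` carries the name of
the `i`-th element. Once this name is gone, the other variables are numbered as by the identity
permutation of `k`, so the outcome is covered by that summand of the target. -/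
theorem tr_fetchLin {k i j : ℕ} {M M'' N : Tm} {C : LBag} (hM : M.Sized) (hC : C.Sized)
    (hk : C.size = k + 1) (hs : M.UnsharedHead) (hj : j < k + 1) (hh : M.head = some (.lin j))
    (hN : C.get? i = some N)
    (h : M.headSubst (N.rename (fun a => a + (k + 1))) = M''.rename (skip j)) (ρ : Env) (u : ℕ) :
    ∃ Q, Reds ((Tm.lsub (k + 1) M C).tr ρ u) Q ∧
      MoreBranches ((Tm.lsub k M'' (C.remove i)).tr ρ u) Q := by
  have hNs := LBag.sized_get? hC hN
  have hik : i < k + 1 := hk ▸ LBag.lt_size_of_get? hN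
  have hM'' : M''.Sized := by
    rw [← Tm.sized_rename (skip j), ← h]
    exact Tm.sized_headSubst hM ((Tm.sized_rename _ _).2 hNs)
  obtain ⟨p, hp, hpj, hpa⟩ := exists_perm_range k i j (by omega) (by omega)
  obtain ⟨G, w, hw, hSC, hMB⟩ := tr_head M hM hs _ hh (substEnv (k + 1) p ρ) (u + (k + 1))
  rw [tr_lsub _ _ _ hk, tr_lsub _ _ _ (by rw [LBag.size_remove (hk ▸ hik), hk]; rfl)]
  set l := (List.range (k + 1)).permutations'.map
    (fun p => M.tr (substEnv (k + 1) p ρ) (u + (k + 1))) with hl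
  have hname : substEnv (k + 1) p ρ .lin j = C.size - 1 - i := by
    rw [substEnv, Env.consN_lt _ _ _ hj, hpj, hk]
  refine reds_chain_fetch C i hN hC ρ (G := .nd G (bigNd l)) (w := w) ?_ ?_ ?_
  · refine (SC.bigNd_mem (List.mem_map.2 ⟨p, List.mem_permutations'.2 hp, rfl⟩)).trans
      (SC.nd_congr (hSC.trans ?_) (SC.refl _))
    simp only [HeadVar.toTm, Tm.tr, Env.shift_apply, hname]
    exact SC.refl _
  · simp only [HCtx.depth]
    omega
  · rw [rename_bigNd, List.map_map]
    -- The same process is seen in two ways: as the identity summand of the target with the fetched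
    -- name left out of the indices, and as `M''` under the environment of `p` with `x_j` skipped.
    refine MoreBranches.bigNd_mem (P := M''.tr (fun r a => substEnv (k + 1) p ρ r (skip j a))
      (u + (k + 1))) (List.mem_map.2 ⟨List.range k,
        List.mem_permutations'.2 (List.Perm.refl _), ?_⟩) ?_
    · refine ((Tm.tr_natural_id hM'').eq _ (fun r a _ => ?_) ?_).symm
      · change substEnv (k + 1) p ρ r (skip j a) = _
        by_cases ha : a < k
        · have h1 : skip j a < k + 1 := by unfold skip; split_ifs <;> omega
          have h2 : (List.range k).idxOf a = a := by
            have := List.nodup_range.idxOf_getElem a (by simpa using ha : a < (List.range k).length)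
            simpa using this
          rw [substEnv, substEnv, Env.consN_lt _ _ _ h1, Env.consN_lt _ _ _ ha, hpa a ha, h2, hk]
          unfold skip
          split_ifs <;> omega
        · obtain ⟨b, rfl⟩ := Nat.exists_eq_add_of_le' (not_lt.1 ha)
          have h1 : skip j (b + k) = b + (k + 1) := by unfold skip; split_ifs <;> omega
          rw [h1, substEnv_add, substEnv_add, hk]
          unfold skip
          split_ifs <;> omega
      · rw [hk]
        unfold skip
        split_ifs <;> omega
    · have := hMB (N.rename fun a => a + (k + 1)) ((Tm.sized_rename _ _).2 hNs)
      rw [h, substEnv, tr_consN_rename hNs, ← substEnv] at this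
      rw [hk]
      convert this using 1
      conv_lhs => rw [← rename_id (M''.tr _ _)]
      refine ((Tm.tr_natural (skip j) M'' hM'').eq _ (fun r a _ => ?_) rfl).symm
      rfl
      rfl

/-- Both unrestricted rules at once: an empty position (`p = none`) behaves like the failure term
without variables. -/
theorem tr_fetchUn {M : Tm} {U : UBag} {i : ℕ} {p : Option Tm} (hM : M.Sized) (hU : U.Sized)
    (hs : M.UnsharedHead) (hh : M.head = some (.un 0 (i + 1))) (hi : U.positions[i]? = some p)
    (ρ : Env) (u : ℕ) :
    ∃ Q, Reds ((Tm.usub M U).tr ρ u) Q ∧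
      MoreBranches
        ((Tm.usub (M.headSubst ((p.getD (.fail [])).rename Nat.succ)) U).tr ρ u) Q := by
  have hps : (p.getD (.fail [])).Sized := by
    cases p with
    | none => trivial
    | some N => exact UBag.sized_positions hU (List.mem_of_getElem? hi)
  obtain ⟨G, w, hw, hSC, hMB⟩ := tr_head M hM hs _ hh ((ρ.shift 1).cons fun _ => 0) (u + 1)
  have hk : i + 1 ∈ Finset.Icc 1 U.trs.length := by
    rw [UBag.length_trs]
    have := (List.getElem?_eq_some_iff.1 hi).1
    exact Finset.mem_Icc.2 ⟨by omega, by omega⟩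
  refine ⟨_, reds_request_fetch (G := G) _ ⟨i + 1, hk⟩ w ?_ |>.trans ?_,
    .res (hMB _ ((Tm.sized_rename _ _).2 hps)) (.refl _)⟩
  · refine hSC.trans ?_
    simp only [HeadVar.toTm, Tm.tr, Env.shift_apply, Env.cons_zero, Nat.zero_add]
    exact SC.refl _
  · refine (SC.res_congr (HCtx.fill_congr ?_ _) (SC.refl _)).reds
    rw [tr_cons_rename hps]
    simp only [Nat.add_sub_cancel, U.trs_getD i hi]
    cases p with
    -- The translation of `fail []` carries an extra inactive component.
    | none => exact (SC.par_nil _).symm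
    | some N =>
      have e := (Tm.tr_natural_id hps).eq (f := scons w fun i => i + G.depth) (ρ := ρ.shift 2)
        (ρ' := ρ.shift (1 + G.depth)) (v := w) 0 (fun r a _ => by
          simp only [id, Env.shift_apply, scons]
          omega) rfl
      change SC (rename _ (((some N).getD (Tm.fail [])).tr (ρ.shift 2) 0))
        (((some N).getD (Tm.fail [])).tr (ρ.shift (1 + G.depth)) w)
      rw [← e]
      exact SC.refl _

/-! ### Reductions to failure -/

theorem lower_lower (j k : ℕ) (S : Finset ℕ) : lower j (lower k S) = lower (k + j) S := by
  ext i
  rw [mem_lower, mem_lower, mem_lower, Nat.add_assoc, Nat.add_comm j k]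

theorem WfTm.fail_nodup {Θ : UCtx} {Γ : LCtx} {xs : List ℕ} {τ : STy}
    (h : WfTm Θ Γ (.fail xs) τ) : xs.Nodup := by
  cases h
  assumption

/-- The failed function is unavailable at `v`, so the argument is discarded and releases `u`
together with the names of `C`. -/
theorem reds_fail_app {Θ : UCtx} {Γ : LCtx} {xs zs : List ℕ} {C : LBag} {U : UBag} {τ : STy}
    (h : WfTm Θ Γ (.app (.fail xs) C U) τ) (hΓ : Γ.Strict) (hzs : zs.Nodup)
    (he : zs.toFinset = xs.toFinset ∪ C.llfv) {ρ : Env} {u : ℕ}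
    (hρ : Set.InjOn (ρ .lin) ((Tm.app (.fail xs) C U).fv .lin))
    (hu : ∀ x ∈ (Tm.app (.fail xs) C U).fv .lin, ρ .lin x ≠ u) :
    Reds ((Tm.app (.fail xs) C U).tr ρ u) ((Tm.fail zs).tr ρ u) := by
  cases h with
  | app j k σ η ε hd hM hC hU _ =>
    have hs := hC.types.shr_empty (hΓ.right hd)
    rw [LBag.llfv_eq hs] at he
    have hsub : xs.toFinset ∪ C.fv .lin ⊆ (Tm.app (.fail xs) C U).fv .lin :=
      Finset.subset_union_left
    have hx : Disjoint xs.toFinset (C.fv .lin) := hM.types.disjoint_lin hC.types hd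
    have hxs : xs.toFinset ⊆ (Tm.app (.fail xs) C U).fv .lin :=
      Finset.subset_union_left.trans hsub
    have key := NonesTo.kill (S := xs.toFinset.image (ρ .lin))
      (ws := insert u ((C.fv .lin).image (ρ .lin))) (P := (Tm.fail xs).tr (ρ.shift 1) 0) (by
        have := nonesTo_fail (ρ := ρ.shift 1) (u := 0) hM.fail_nodup
          (fun x hx y hy h => hρ (hxs hx) (hxs hy) (Nat.succ_injective h))
          (fun _ _ => Nat.succ_ne_zero _)
        rwa [Finset.image_image]) (by
        rw [Finset.disjoint_insert_right]
        refine ⟨fun h => ?_, disjoint_image_of_injOn hρ hxs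
          (Finset.subset_union_right.trans hsub) hx⟩
        obtain ⟨x, hx, h⟩ := Finset.mem_image.1 h
        exact hu x (hxs hx) h)
      (.out 0 (Proc.bag C.fv C.tr U.trs (ρ.shift 2) 0) (.fwd 0 (u + 1)))
    refine NonesTo.reds_fail ?_ hzs (by rw [he]; exact hρ.mono (by exact_mod_cast hsub))
      fun x hx => hu x (hsub (he ▸ List.mem_toFinset.2 hx))
    rw [he, Finset.image_union, ← Finset.union_insert]
    rw [Finset.image_insert] at key
    rw [Tm.tr, Env.names_shift, Env.names_of_shr_empty hs]
    exact key

/-- Every summand collapses to the same unavailable names; idempotence merges them, and the chain is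
then discarded element by element. -/
theorem reds_fail_lsub {Θ : UCtx} {Γ : LCtx} {k : ℕ} {xs zs : List ℕ} {C : LBag} {τ : STy}
    (h : WfTm Θ Γ (.lsub k (.fail xs) C) τ) (hΓ : Γ.Strict) (hx : Finset.range k ⊆ xs.toFinset)
    (hzs : zs.Nodup) (he : zs.toFinset = lower k xs.toFinset ∪ C.llfv) {ρ : Env} {u : ℕ}
    (hρ : Set.InjOn (ρ .lin) ((Tm.lsub k (.fail xs) C).fv .lin))
    (hu : ∀ x ∈ (Tm.lsub k (.fail xs) C).fv .lin, ρ .lin x ≠ u) :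
    Reds ((Tm.lsub k (.fail xs) C).tr ρ u) ((Tm.fail zs).tr ρ u) := by
  cases h with
  | lsub _ σ hd hM hC =>
    have hs := hC.types.shr_empty (hΓ.right hd)
    rw [LBag.llfv_eq hs] at he
    have hsub : lower k xs.toFinset ∪ C.fv .lin = (Tm.lsub k (.fail xs) C).fv .lin := rfl
    rw [← hsub] at hρ hu
    have hd' : Disjoint (lower k xs.toFinset) (C.fv .lin) :=
      LCtx.Types.disjoint_lin (hM.types.lower k fun i => LCtx.ext_add k _ _ i) hC.types hd
    have hk := hC.sized.2 rfl
    refine NonesTo.reds_fail ?_ hzs (by rwa [he])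
      fun x hx => hu x (he ▸ List.mem_toFinset.2 hx)
    rw [he, Finset.image_union, ← Finset.insert_union, ← Env.names_of_shr_empty hs, tr_lsub _ _ _ hk]
    refine Proc.chain_nones C ρ _ _ (hC.namesDisjoint (hΓ.right hd)
      (hρ.mono (by exact_mod_cast Finset.subset_union_right))) ?_ ?_
    · rw [Env.names_of_shr_empty hs, Finset.disjoint_insert_left]
      refine ⟨fun h => ?_, disjoint_image_of_injOn hρ Finset.subset_union_left
        Finset.subset_union_right hd'⟩
      obtain ⟨x, hx, h⟩ := Finset.mem_image.1 h
      exact hu x (Finset.mem_union_right _ hx) h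
    · rw [hk]
      have hp : ∀ p ∈ (List.range k).permutations', NonesTo ((Tm.fail xs).tr (substEnv k p ρ) (u + k))
          (Finset.range k ∪
            (insert u ((lower k xs.toFinset).image (ρ .lin))).image (fun i => i + k)) :=
        fun p hp => nonesTo_fail_substEnv (List.mem_permutations'.1 hp) hM.fail_nodup hx
          (hρ.mono (by exact_mod_cast Finset.subset_union_left))
          fun x hx => hu x (Finset.mem_union_left _ hx)
      have h0 := hp (List.range k) (List.mem_permutations'.2 (.refl _))
      set S := Finset.range k ∪
        (insert u ((lower k xs.toFinset).image (ρ .lin))).image (fun i => i + k)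
      -- One fixed enumeration of `S` is used for all permutations, so that the summands become
      -- literally equal.
      refine NonesTo.of_reds (Q := Proc.nones S.toList) ?_ (by
        simpa using NonesTo.nones S.nodup_toList)
      refine (Reds.bigNd (q := fun _ => Proc.nones S.toList) fun p hpm => ?_).trans
        (SC.bigNd_const ?_ ?_).reds
      · exact NonesTo.reds (by simpa using hp p hpm) S.nodup_toList
      · simpa using List.ne_nil_of_mem (List.mem_permutations'.2 (List.Perm.refl (List.range k)))
      · intro Q hQ
        obtain ⟨_, _, rfl⟩ := List.mem_map.1 hQ
        exact SC.refl _

theorem fv_esub_share (k : ℕ) (M : Tm) (C : LBag) (U : UBag) :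
    (Tm.esub (.share k 0 M) C U).fv .lin = lower (k + 1) (M.fv .lin) ∪ C.fv .lin ∪ U.fv .lin := by
  simp [Tm.fv, lower_lower]

/-- The common end of both failures of an intermediate substitution: collect the server and order
the names as in the failure term. -/
theorem reds_fail_of_esub {P X : Proc} {S : Finset ℕ} {zs : List ℕ} {C : LBag}
    (hs : C.fv .shr = ∅) (hzs : zs.Nodup) (he : zs.toFinset = S ∪ C.fv .lin) {ρ : Env} {u : ℕ}
    (hρ : Set.InjOn (ρ .lin) (S ∪ C.fv .lin : Finset ℕ))
    (hu : ∀ x ∈ S ∪ C.fv .lin, ρ .lin x ≠ u)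
    (h : NonesTo P (insert (u + 1) ((S.image (ρ .lin)).image Nat.succ) ∪ (ρ.shift 1).names C.fv)) :
    Reds (res P (srv 0 X)) ((Tm.fail zs).tr ρ u) := by
  refine NonesTo.reds_fail ?_ hzs (by rwa [he]) fun x hx => hu x (he ▸ List.mem_toFinset.2 hx)
  refine NonesTo.res_srv ?_
  rw [he, Finset.image_union, ← Finset.insert_union, ← Env.names_of_shr_empty hs,
    Finset.image_union, Finset.image_insert]
  rwa [Env.names_shift] at h

theorem disjoint_insert_names {S : Finset ℕ} {C : LBag} {ρ : Env} {u : ℕ} (hs : C.fv .shr = ∅)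
    (hd : Disjoint S (C.fv .lin)) (hρ : Set.InjOn (ρ .lin) (S ∪ C.fv .lin : Finset ℕ))
    (hu : ∀ x ∈ S ∪ C.fv .lin, ρ .lin x ≠ u) :
    Disjoint (insert u (S.image (ρ .lin))) (ρ.names C.fv) := by
  rw [Env.names_of_shr_empty hs, Finset.disjoint_insert_left]
  refine ⟨fun h => ?_, disjoint_image_of_injOn hρ Finset.subset_union_left
    Finset.subset_union_right hd⟩
  obtain ⟨x, hx, h⟩ := Finset.mem_image.1 h
  exact hu x (Finset.mem_union_right _ hx) h

theorem disjoint_insert_names_shift {S : Finset ℕ} {C : LBag} {ρ : Env} {u : ℕ}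
    (hs : C.fv .shr = ∅) (hd : Disjoint S (C.fv .lin))
    (hρ : Set.InjOn (ρ .lin) (S ∪ C.fv .lin : Finset ℕ))
    (hu : ∀ x ∈ S ∪ C.fv .lin, ρ .lin x ≠ u) :
    Disjoint (insert (u + 1) ((S.image (ρ .lin)).image Nat.succ)) ((ρ.shift 1).names C.fv) := by
  have := (Finset.disjoint_image Nat.succ_injective).2 (disjoint_insert_names hs hd hρ hu)
  rw [Finset.image_insert] at this
  rwa [Env.names_shift]

theorem reds_fail_esub {Θ : UCtx} {Γ : LCtx} {k : ℕ} {xs zs : List ℕ} {C : LBag} {U : UBag}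
    {τ : STy} (h : WfTm Θ Γ (.esub (.share k 0 (.fail xs)) C U) τ) (hΓ : Γ.Strict)
    (hk : C.size = k) (hx : Finset.range k ⊆ xs.toFinset) (hzs : zs.Nodup)
    (he : zs.toFinset = lower (k + 1) xs.toFinset ∪ C.llfv) {ρ : Env} {u : ℕ}
    (hρ : Set.InjOn (ρ .lin) ((Tm.esub (.share k 0 (.fail xs)) C U).fv .lin))
    (hu : ∀ x ∈ (Tm.esub (.share k 0 (.fail xs)) C U).fv .lin, ρ .lin x ≠ u) :
    Reds ((Tm.esub (.share k 0 (.fail xs)) C U).tr ρ u) ((Tm.fail zs).tr ρ u) := by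
  have hsz := h.sized
  obtain ⟨Γ₁, Δ, Θ', Γ', π, ε, rfl, hd, hM, -, hΓk, hΓ', hC, hU⟩ := h.esub_inv
  have hs := hC.types.shr_empty (hΓ.right hd)
  rw [LBag.llfv_eq hs] at he
  have hkx : k ∉ xs.toFinset := fun h => ((hM.types k).1.1 (Or.inl h)) hΓk
  have hsub := fv_esub_share k (.fail xs) C U ▸ Finset.subset_union_left (s₂ := U.fv .lin)
  replace hρ : Set.InjOn (ρ .lin) (lower (k + 1) xs.toFinset ∪ C.fv .lin : Finset ℕ) :=
    hρ.mono (by exact_mod_cast hsub)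
  replace hu : ∀ x ∈ lower (k + 1) xs.toFinset ∪ C.fv .lin, ρ .lin x ≠ u :=
    fun x hx => hu x (hsub hx)
  have hd' : Disjoint (lower (k + 1) xs.toFinset) (C.fv .lin) :=
    LCtx.Types.disjoint_lin (hM.types.lower (k + 1) hΓ') hC.types hd
  refine (tr_esub_chain (M := .fail xs) hsz.1 hsz.2.1 hsz.2.2 hkx (by simp [Tm.fv]) hk ρ u).trans
    (reds_fail_of_esub hs hzs he hρ hu ?_)
  refine Proc.chain_nones C _ _ _ ((hC.namesDisjoint (hΓ.right hd)
    (hρ.mono (by exact_mod_cast Finset.subset_union_right))).shift 1)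
    (disjoint_insert_names_shift hs hd' hρ hu) ?_
  rw [hk, ← image_cons_lower k hkx ρ .lin fun _ => 0]
  refine nonesTo_fail_substEnv (.refl _) hM.fail_nodup hx ?_ ?_
  · rintro (_ | x) hx (_ | y) hy hxy
    · rfl
    · exact (hkx (by simpa [mem_lower] using hx)).elim
    · exact (hkx (by simpa [mem_lower] using hy)).elim
    · rw [hρ (Finset.mem_union_left _ (by simpa [mem_lower, Nat.add_assoc, Nat.add_comm 1] using hx))
        (Finset.mem_union_left _ (by simpa [mem_lower, Nat.add_assoc, Nat.add_comm 1] using hy))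
        (Nat.succ_injective hxy)]
  · rintro (_ | x) hx
    · exact (Nat.succ_ne_zero u).symm
    · exact fun hxy => hu x (Finset.mem_union_left _
        (by simpa [mem_lower, Nat.add_assoc, Nat.add_comm 1] using hx)) (Nat.succ_injective hxy)

/-- The body need not have failed: the protocol itself detects the mismatch and discards it,
releasing its names apart from those of the shared variables. -/
theorem reds_fail_size {Θ : UCtx} {Γ : LCtx} {k : ℕ} {M : Tm} {zs : List ℕ} {C : LBag} {U : UBag}
    {τ : STy} (h : WfTm Θ Γ (.esub (.share k 0 M) C U) τ) (hΓ : Γ.Strict)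
    (hk : C.size ≠ k) (hzs : zs.Nodup)
    (he : zs.toFinset = lower (k + 1) M.llfv ∪ C.llfv) {ρ : Env} {u : ℕ}
    (hρ : Set.InjOn (ρ .lin) ((Tm.esub (.share k 0 M) C U).fv .lin))
    (hu : ∀ x ∈ (Tm.esub (.share k 0 M) C U).fv .lin, ρ .lin x ≠ u) :
    Reds ((Tm.esub (.share k 0 M) C U).tr ρ u) ((Tm.fail zs).tr ρ u) := by
  have hsz := h.sized
  obtain ⟨Γ₁, Δ, Θ', Γ', π, ε, rfl, hd, hM, hΓi, hΓk, hΓ', hC, hU⟩ := h.esub_inv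
  have hs := hC.types.shr_empty (hΓ.right hd)
  have hΓs : Γ'.Strict := fun x π hx => by
    rcases lt_trichotomy x k with hxk | rfl | hxk
    · obtain ⟨σ, hσ⟩ := hΓi x hxk
      rw [hσ] at hx
      cases hx
    · rw [hΓk] at hx
      cases hx
    · obtain ⟨b, rfl⟩ := Nat.exists_eq_add_of_le' (Nat.succ_le_of_lt hxk)
      exact hΓ.left b π (by rw [← hΓ' b]; exact hx)
  have hMs := hM.types.shr_empty hΓs
  have hMl : M.llfv = M.fv .lin := by simp [Tm.llfv, hMs]
  rw [LBag.llfv_eq hs, hMl] at he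
  have hkx : k ∉ M.fv .lin := fun h => ((hM.types k).1.1 (Or.inl h)) hΓk
  have hsub := fv_esub_share k M C U ▸ Finset.subset_union_left (s₂ := U.fv .lin)
  replace hρ : Set.InjOn (ρ .lin) (lower (k + 1) (M.fv .lin) ∪ C.fv .lin : Finset ℕ) :=
    hρ.mono (by exact_mod_cast hsub)
  replace hu : ∀ x ∈ lower (k + 1) (M.fv .lin) ∪ C.fv .lin, ρ .lin x ≠ u :=
    fun x hx => hu x (hsub hx)
  have hd' : Disjoint (lower (k + 1) (M.fv .lin)) (C.fv .lin) :=
    LCtx.Types.disjoint_lin (hM.types.lower (k + 1) hΓ') hC.types hd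
  refine (tr_esub_open (M := M) hsz.1 hsz.2.1 hsz.2.2 hkx (by simp [hMs]) ρ u).trans
    (reds_fail_of_esub hs hzs he hρ hu ?_)
  have hn : (((ρ.shift 1).cons fun _ => 0).consN k fun _ => 0).names
      (fun r => M.fv r \ (List.range k).toFinset)
      = ((lower (k + 1) (M.fv .lin)).image (ρ .lin)).image Nat.succ := by
    rw [Env.names_of_shr_empty (by simp [hMs]), ← image_cons_lower k hkx ρ .lin fun _ => 0]
    ext a
    simp only [Finset.mem_image, Finset.mem_sdiff, List.mem_toFinset, List.mem_range, mem_lower]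
    constructor
    · rintro ⟨x, ⟨hx, hxk⟩, rfl⟩
      obtain ⟨b, rfl⟩ := Nat.exists_eq_add_of_le' (not_lt.1 hxk)
      exact ⟨b, hx, by simp⟩
    · rintro ⟨b, hb, rfl⟩
      exact ⟨b + k, ⟨hb, by simp⟩, by simp⟩
  have := Proc.tr_share_ne_size (Tm.tr_natural_id (M := M) hsz.1) C (List.range k) hsz.2.1
    (by simpa using hk) List.nodup_range
    (fun i hi => (hM.types.mem_lin hΓs i).2 (by
      obtain ⟨σ, hσ⟩ := hΓi i (List.mem_range.1 hi)
      simp [hσ])) (ρ.shift 1) (((ρ.shift 1).cons fun _ => 0).consN k fun _ => 0) (u + 1)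
    ((hC.namesDisjoint (hΓ.right hd)
      (hρ.mono (by exact_mod_cast Finset.subset_union_right))).shift 1)
    (by rw [hn]; exact disjoint_insert_names_shift hs hd' hρ hu)
  rwa [hn, List.length_range] at this

theorem reds_fail_usub (xs : List ℕ) (U : UBag) (ρ : Env) (u : ℕ) :
    Reds ((Tm.usub (.fail (xs.map Nat.succ)) U).tr ρ u) ((Tm.fail xs).tr ρ u) := by
  have : (Tm.fail (xs.map Nat.succ)).tr ((ρ.shift 1).cons fun _ => 0) (u + 1)
      = rename Nat.succ ((Tm.fail xs).tr ρ u) := by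
    simp only [Tm.tr, rename, rename_nones, List.map_map]
    rfl
  change Reds (res ((Tm.fail (xs.map Nat.succ)).tr ((ρ.shift 1).cons fun _ => 0) (u + 1)) _) _
  rw [this]
  exact ((SC.res_comm _ _).trans (SC.res_srv _ _)).reds

/-! ### Loose completeness -/

/-- Injectivity of the names and their difference from `u` are used by the failing rules and by the
contexts that lead to them. -/
theorem WfTm.exists_moreBranches {N M : Tm} (hred : Tm.Red N M) :
    ∀ {Θ : UCtx} {Γ : LCtx} {τ : STy}, WfTm Θ Γ N τ → Γ.Strict → ∀ {ρ : Env} {u : ℕ},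
      Set.InjOn (ρ .lin) (N.fv .lin) → (∀ x ∈ N.fv .lin, ρ .lin x ≠ u) →
      ∃ Q, Reds (N.tr ρ u) Q ∧ MoreBranches (M.tr ρ u) Q := by
  induction hred with
  | beta M C U =>
    intro Θ Γ τ h _ ρ u _ _
    have hs := h.sized
    exact ⟨_, tr_beta (M := M) hs.1 hs.2.1 hs.2.2 ρ u, .refl _⟩
  | exSub k M C U hk _ =>
    intro Θ Γ τ h _ ρ u _ _
    have hs := h.sized
    obtain ⟨_, _, _, _, _, _, -, -, hM, -, hΓk, -⟩ := h.esub_inv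
    exact tr_exSub (M := M) hs.1 hs.2.1 hs.2.2 (fun h => (hM.types k).1.1 (Or.inl h) hΓk)
      (fun h => (hM.types k).1.1 (Or.inr h) hΓk) hk ρ u
  | fetchLin k M C i j N M'' hj hM hN he =>
    intro Θ Γ τ h hΓ ρ u _ _
    have hs := h.sized
    cases h with
    | lsub _ σ hd hM' hC =>
      exact tr_fetchLin hs.2.1 hs.2.2 hs.1 (hM'.unsharedHead (hΓ.left.ext _ σ)) hj hM hN he ρ u
  | failLin k M C U ys hC hys he =>
    intro Θ Γ τ h hΓ ρ u hρ hu
    exact ⟨_, reds_fail_size h hΓ hC hys he hρ hu, .refl _⟩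
  | fetchUn M U i N hM hN =>
    intro Θ Γ τ h hΓ ρ u _ _
    have hs := h.sized
    cases h with
    | usub η ε hM' hU he =>
      -- Positions count from `1`, so index `0` never yields an element.
      cases i with
      | zero => simp [UBag.at] at hN
      | succ i =>
        exact tr_fetchUn (p := some N) hs.1 hs.2 (hM'.unsharedHead (hΓ.lift 1)) hM
          (Option.join_eq_some_iff.1 hN) ρ u
  | failUn M U i hM hN =>
    intro Θ Γ τ h hΓ ρ u _ _
    have hs := h.sized
    cases h with
    | usub η ε hM' hU he =>
      have hh := hM'.unsharedHead (hΓ.lift 1)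
      obtain ⟨η', h1, h2, h3⟩ := hM'.head_un hh hM
      obtain rfl : η = η' := by simpa [UCtx.ext] using h1
      obtain ⟨i, rfl⟩ := Nat.exists_eq_add_of_le' h2
      -- Typing puts the index within the bag. An absent element is therefore an empty position, for
      -- which the server offers a label, and not a missing one.
      have hi : i < U.positions.length := by
        rw [hU.length_positions]
        exact lt_of_lt_of_le h3 he.length_le
      have hp : U.positions[i]? = some none := by
        rw [UBag.at, List.getElem?_eq_getElem hi] at hN
        rw [List.getElem?_eq_getElem hi]
        simpa using hN
      exact tr_fetchUn (p := none) hs.1 hs.2 hh hM hp ρ u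
  | cons₁ xs C U zs hzs he =>
    intro Θ Γ τ h hΓ ρ u hρ hu
    exact ⟨_, reds_fail_app h hΓ hzs he hρ hu, .refl _⟩
  | cons₂ k xs C U zs hC hx hzs he =>
    intro Θ Γ τ h hΓ ρ u hρ hu
    exact ⟨_, reds_fail_esub h hΓ hC hx hzs he hρ hu, .refl _⟩
  | cons₃ k xs C zs hx hzs he =>
    intro Θ Γ τ h hΓ ρ u hρ hu
    exact ⟨_, reds_fail_lsub h hΓ hx hzs he hρ hu, .refl _⟩
  | cons₄ xs U =>
    intro Θ Γ τ _ _ ρ u _ _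
    exact ⟨_, reds_fail_usub xs U ρ u, .refl _⟩
  | @appCtx M M' C U _ ih =>
    intro Θ Γ τ h hΓ ρ u hρ _
    cases h with
    | app j k σ η ε hd hM hC hU _ =>
      -- The function is translated at the fresh name `0`, from which all shifted names differ.
      obtain ⟨Q, h1, h2⟩ := ih hM hΓ.left (ρ := ρ.shift 1) (u := 0)
        (fun x hx y hy hxy => hρ (by simp_all [Tm.fv]) (by simp_all [Tm.fv])
          (Nat.succ_injective hxy)) (fun _ _ => Nat.succ_ne_zero _)
      exact ⟨_, h1.res_left _, .res h2 (.refl _)⟩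
  | @lsubCtx k M M' C _ ih =>
    intro Θ Γ τ h hΓ ρ u hρ hu
    cases h with
    | lsub _ σ hd hM hC =>
      have hk := hC.sized.2 rfl
      have hsub : lower k (M.fv .lin) ⊆ (Tm.lsub k M C).fv .lin := Finset.subset_union_left
      -- Each permutation has its own outcome, and these outcomes are summed. Lists that are not
      -- permutations get a dummy so that a function can be chosen.
      have key : ∀ p : List ℕ, ∃ Q, p ∈ (List.range k).permutations' →
          Reds (M.tr (substEnv k p ρ) (u + k)) Q ∧
          MoreBranches (M'.tr (substEnv k p ρ) (u + k)) Q := fun p => by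
        by_cases hp : p ∈ (List.range k).permutations'
        · obtain ⟨Q, hQ⟩ := ih hM (hΓ.left.ext k σ)
            (substEnv_injOn (List.mem_permutations'.1 hp)
              (hρ.mono (by exact_mod_cast hsub)))
            (substEnv_ne (List.mem_permutations'.1 hp) fun x hx => hu x (hsub hx))
          exact ⟨Q, fun _ => hQ⟩
        · exact ⟨.nil, fun h => (hp h).elim⟩
      choose q hq using key
      rw [tr_lsub _ _ _ hk, tr_lsub _ _ _ hk]
      exact ⟨_, Reds.chain (Reds.bigNd fun p hp => (hq p hp).1) _ _,
        MoreBranches.chain (MoreBranches.bigNd fun p hp => (hq p hp).2) _ _⟩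
  | @usubCtx M M' U _ ih =>
    intro Θ Γ τ h hΓ ρ u hρ hu
    cases h with
    | usub η ε hM hU _ =>
      have hsub : lower 1 (M.fv .lin) ⊆ (Tm.usub M U).fv .lin := Finset.subset_union_left
      have h0 : 0 ∉ M.fv .lin := fun h => (hM.types 0).1.1 (Or.inl h) rfl
      obtain ⟨Q, h1, h2⟩ := ih hM (hΓ.lift 1) (ρ := (ρ.shift 1).cons fun _ => 0) (u := u + 1)
        (by
          rintro (_ | x) hx (_ | y) hy hxy
          · rfl
          · exact (h0 hx).elim
          · exact (h0 hy).elim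
          · rw [hρ (hsub (mem_lower.2 hx)) (hsub (mem_lower.2 hy)) (Nat.succ_injective hxy)])
        (by
          rintro (_ | x) hx hxy
          · exact h0 hx
          · exact hu x (hsub (mem_lower.2 hx)) (Nat.succ_injective hxy))
      exact ⟨_, h1.res_left _, .res h2 (.refl _)⟩
  | shareCtx k x _ _ =>
    intro Θ Γ τ h hΓ
    -- The sharing variable has a multiset type in the context, which contradicts strictness.
    obtain ⟨_, _, _, _, rfl, -⟩ := h.share_inv
    exact (LCtx.not_strict_add _ _ _ hΓ).elim

theorem theorem6 (N M : Tm) (hwf : N.WellFormed) (hcl : N.Closed) (hred : Tm.Red N M)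
    (ρ : Env) (u : ℕ) :
    ∃ Q : Proc, Proc.Reds (N.tr ρ u) Q ∧ Proc.MoreBranches (M.tr ρ u) Q := by
  obtain ⟨Θ, Γ, τ, h⟩ := hwf
  -- Every variable in the domain of the context occurs free, so a closed term has an empty context.
  have hΓ : Γ.Strict := fun x π hx => by
    have := (h.types x).1.2 (by simp [hx])
    simp [hcl _] at this
  exact h.exists_moreBranches hred hΓ (by simp [hcl .lin]) (by simp [hcl .lin])
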